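/- Let $n,m\in\mathbb N$, let $\Omega\subset\mathbb R^n$ be a nonempty, bounded, connected open set with Lipschitz boundary, let $D\subset\Omega$ be measurable, and let $p\in(1,\infty)$, $s\in(0,1)$, $l\in\{0,1\}$, $z\ge 0$. Let $\rho\in C_c^\infty(\mathbb R^n;\mathbb R)$ be a mollifier: $\rho$ is non-negative and radially symmetric, $\int_{\mathbb R^n}\rho=1$, and there are $0<\tau<\|\rho\|_{L^\infty}$ and $\eta>0$ with $\{x:\rho(x)\ge\tau\}=\{x:|x|\le\eta\}$. Let $K=\mathrm{SPD}^{\mathrm{Log}}_z$ be the set of symmetric positive definite $M\in\mathbb R^{m\times m}$ with $\|\mathrm{Log}(M)\|_F\le z$, where $\mathrm{Log}$ is the matrix logarithm and $\|\cdot\|_F$ the Frobenius norm, and let $d(A,B)=\|\mathrm{Log}(A)-\mathrm{Log}(B)\|_F$ be the log-Euclidean metric. Let $W^{s,p}(\Omega;\mathbb R^{m\times m})$ be the space of all $w\in L^p(\Omega;\mathbb R^{m\times m})$ with $|w|_{s,p}^p:=\int_{\Omega\times\Omega}\frac{\|w(x)-w(y)\|_F^p}{|x-y|^{n+ps}}\,d(x,y)<\infty$,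 normed by $(\|w\|_{L^p}^p+|w|_{s,p}^p)^{1/p}$, and let $W^{s,p}(\Omega;K)$ and $L^p(\Omega;K)$ be the sets of those $w$ in $W^{s,p}(\Omega;\mathbb R^{m\times m})$, respectively $L^p(\Omega;\mathbb R^{m\times m})$, with $w(x)\in K$ for a.e. $x\in\Omega$. For $\alpha>0$, $v\in L^p(\Omega;K)$ and $w\in W^{s,p}(\Omega;K)$ put $$\Phi(w)=\int_{\Omega\times\Omega}\frac{d^p(w(x),w(y))}{|x-y|^{n+ps}}\,\rho^l(x-y)\,d(x,y),\qquad \mathcal F^{\alpha,v}(w)=\int_{\Omega}\chi_{\Omega\setminus D}(x)\,d^p(w(x),v(x))\,dx+\alpha\,\Phi(w).$$ Then the following hold. - **Existence.** For every $v\in L^p(\Omega;K)$ and $\alpha>0$ the functional $\mathcal F^{\alpha,v}$ takes finite values on $W^{s,p}(\Omega;K)$ and attains a minimizer there. - **Stability.** Let $\alpha>0$, $w^\delta\in L^p(\Omega;K)$, and let $v_k\in L^p(\Omega;K)$ with $\|w^\delta-v_k\|_{L^p}\to0$. Then every sequence $(w_k)$ of minimizers $w_k$ of $\mathcal F^{\alpha,v_k}$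 over $W^{s,p}(\Omega;K)$ has a subsequence converging weakly in $W^{s,p}(\Omega;\mathbb R^{m\times m})$. The weak limit $\tilde w$ of every weakly converging subsequence $(w_{k_j})$ is a minimizer of $\mathcal F^{\alpha,w^\delta}$ over $W^{s,p}(\Omega;K)$, and $\Phi(w_{k_j})\to\Phi(\tilde w)$. - **Convergence.** Suppose that $\Omega\setminus D$ is not a null set and that the true solution $w^0\in W^{s,p}(\Omega;K)$ satisfies $\Phi(w^0)\le\Phi(u)$ for all $u\in W^{s,p}(\Omega;K)$ with $u=w^0$ a.e. on $\Omega\setminus D$ (both conditions are automatic if $D$ is a null set, in particular for denoising, $D=\emptyset$). Let $\alpha:(0,\infty)\to(0,\infty)$ satisfy $\alpha(\delta)\to0$ and $\delta^p/\alpha(\delta)\to0$ as $\delta\to0$, let $\delta_k>0$ with $\delta_k\to0$, and let $v_k\in L^p(\Omega;K)$ with $\|w^0-v_k\|_{L^p}\le\delta_k$. Then every sequence $(w_k)$ of minimizers $w_k$ of $\mathcal F^{\alpha(\delta_k),v_k}$ over $W^{s,p}(\Omega;K)$ has a subsequence $(w_{k_j})$ with $w_{k_j}\rightharpoonup w^0$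 weakly in $W^{s,p}(\Omega;\mathbb R^{m\times m})$ and $\Phi(w_{k_j})\to\Phi(w^0)$; moreover the whole sequence satisfies $w_k\rightharpoonup w^0$ and $\Phi(w_k)\to\Phi(w^0)$. -/

import Mathlib

open MeasureTheory Filter Topology
open scoped ENNReal

namespace TensorReg

/-- The matrix logarithm `Log (V diag(μ) Vᵀ) = V diag(log μ) Vᵀ` of a symmetric matrix. -/
noncomputable def matLog {m : ℕ} (A : Matrix (Fin m) (Fin m) ℝ) : Matrix (Fin m) (Fin m) ℝ :=
  cfc Real.log A

/-- `matLog` is given by the eigendecomposition of the matrix. -/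
theorem matLog_eq {m : ℕ} {A : Matrix (Fin m) (Fin m) ℝ} (hA : A.IsHermitian) :
    matLog A = (hA.eigenvectorUnitary : Matrix (Fin m) (Fin m) ℝ) *
      Matrix.diagonal (fun i => Real.log (hA.eigenvalues i)) *
      star (hA.eigenvectorUnitary : Matrix (Fin m) (Fin m) ℝ) := by
  rw [matLog, hA.cfc_eq]
  simp [Matrix.IsHermitian.cfc, Function.comp_def, Unitary.conjStarAlgAut_apply]

/-- `ℝⁿ` with the Euclidean norm. -/
abbrev Space (n : ℕ) := EuclideanSpace ℝ (Fin n)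

/-- `ℝ^{m×m}` with the Frobenius norm, the Euclidean norm of the family of entries. -/
abbrev Mat (m : ℕ) := EuclideanSpace ℝ (Fin m × Fin m)

/-- An element of `ℝ^{m×m}` as a matrix. -/
def Mat.toMatrix {m : ℕ} (A : Mat m) : Matrix (Fin m) (Fin m) ℝ := Matrix.of fun i j => A (i, j)

/-- A matrix as an element of `ℝ^{m×m}` with the Frobenius norm. -/
def Mat.ofMatrix {m : ℕ} (A : Matrix (Fin m) (Fin m) ℝ) : Mat m :=
  WithLp.toLp 2 fun q => A q.1 q.2

/-- The norm on `Mat m` is the Frobenius norm. -/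
theorem Mat.norm_ofMatrix {m : ℕ} (A : Matrix (Fin m) (Fin m) ℝ) :
    ‖Mat.ofMatrix A‖ = Real.sqrt (∑ i, ∑ j, |A i j| ^ 2) := by
  rw [EuclideanSpace.norm_eq, Fintype.sum_prod_type]
  simp [Mat.ofMatrix]

/-- The matrix logarithm on `Mat m`. -/
noncomputable def Log {m : ℕ} (A : Mat m) : Mat m := Mat.ofMatrix (matLog A.toMatrix)

/-- The symmetric positive definite matrices `M` with `‖Log M‖_F ≤ z`. -/
def SPDLog (m : ℕ) (z : ℝ) : Set (Mat m) :=
  {M | M.toMatrix.PosDef ∧ ‖Log M‖ ≤ z}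

/-- The log-Euclidean metric `‖Log A - Log B‖_F`. -/
noncomputable def logDist {m : ℕ} (A B : Mat m) : ℝ := ‖Log A - Log B‖

/-- Lipschitz boundary: near every boundary point, `Ω` is the strict epigraph, in some unit
direction `e`, of a Lipschitz function of the component orthogonal to `e`. -/
def HasLipschitzBoundary {n : ℕ} (Ω : Set (Space n)) : Prop :=
  ∀ x ∈ frontier Ω, ∃ (e : Space n) (r : ℝ) (L : NNReal) (g : Space n → ℝ),
    ‖e‖ = 1 ∧ 0 < r ∧ LipschitzWith L g ∧
    ∀ y ∈ Metric.ball x r, y ∈ Ω ↔ g (y - inner ℝ e y • e) < inner ℝ e y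

/-- Mollifiers. -/
structure IsMollifier {n : ℕ} (ρ : Space n → ℝ) : Prop where
  smooth : ContDiff ℝ ((⊤ : ℕ∞) : WithTop ℕ∞) ρ
  compactSupport : HasCompactSupport ρ
  nonneg : ∀ x, 0 ≤ ρ x
  radial : ∀ x y, ‖x‖ = ‖y‖ → ρ x = ρ y
  integral_eq_one : ∫ x, ρ x = 1
  superlevel : ∃ τ η : ℝ, 0 < τ ∧ ENNReal.ofReal τ < eLpNorm ρ ⊤ volume ∧ 0 < η ∧
    {x | τ ≤ ρ x} = {x | ‖x‖ ≤ η}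

/-- Lebesgue measure on `Ω × Ω`. -/
noncomputable abbrev volSq {n : ℕ} (Ω : Set (Space n)) : Measure (Space n × Space n) :=
  (volume.restrict Ω).prod (volume.restrict Ω)

/-- The difference quotient `‖w(x) - w(y)‖_F / |x - y|^(n/p + s)`. -/
noncomputable def diffQuot {n m : ℕ} (s p : ℝ) (w : Space n → Mat m) (q : Space n × Space n) : ℝ :=
  ‖w q.1 - w q.2‖ / ‖q.1 - q.2‖ ^ ((n : ℝ) / p + s)

theorem aestronglyMeasurable_diffQuot {n m : ℕ} {Ω : Set (Space n)} {s p : ℝ}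
    {w : Space n → Mat m} (hw : AEStronglyMeasurable w (volume.restrict Ω)) :
    AEStronglyMeasurable (diffQuot s p w) (volSq Ω) := by
  have h1 : AEStronglyMeasurable (fun q : Space n × Space n => w q.1 - w q.2) (volSq Ω) :=
    hw.comp_fst.sub hw.comp_snd
  have h2 : Measurable fun q : Space n × Space n => ‖q.1 - q.2‖ ^ ((n : ℝ) / p + s) := by
    fun_prop
  exact (h1.norm.aemeasurable.div h2.aemeasurable).aestronglyMeasurable

/-- The fractional Sobolev space `W^{s,p}(Ω; ℝ^{m×m})`, as the space of representatives: functions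
whose restriction to `Ω` is in `L^p` and whose difference quotient is in `L^p(Ω × Ω)`. -/
def Wsp {n : ℕ} (m : ℕ) (Ω : Set (Space n)) (s p : ℝ) : Submodule ℝ (Space n → Mat m) where
  carrier := {w | MemLp w (ENNReal.ofReal p) (volume.restrict Ω) ∧
    MemLp (diffQuot s p w) (ENNReal.ofReal p) (volSq Ω)}
  zero_mem' := by
    refine ⟨MemLp.zero, ?_⟩
    have : diffQuot s p (0 : Space n → Mat m) = 0 := by
      funext q; simp [diffQuot]
    rw [this]
    exact MemLp.zero
  add_mem' := by
    rintro u v ⟨hu, hu'⟩ ⟨hv, hv'⟩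
    refine ⟨hu.add hv, (hu'.add hv').mono
      (aestronglyMeasurable_diffQuot (hu.add hv).aestronglyMeasurable) (Eventually.of_forall ?_)⟩
    intro q
    have h0 : 0 ≤ ‖q.1 - q.2‖ ^ ((n : ℝ) / p + s) := by positivity
    simp only [diffQuot, Pi.add_apply, Real.norm_eq_abs]
    rw [abs_of_nonneg (by positivity), abs_of_nonneg (by positivity), ← add_div]
    refine div_le_div_of_nonneg_right ?_ h0
    rw [add_sub_add_comm]
    exact norm_add_le _ _
  smul_mem' := by
    rintro c u ⟨hu, hu'⟩
    refine ⟨hu.const_smul c, ?_⟩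
    have : diffQuot s p (c • u) = fun q => ‖c‖ * diffQuot s p u q := by
      funext q
      simp only [diffQuot, Pi.smul_apply]
      rw [← smul_sub, norm_smul, mul_div_assoc]
    rw [this]
    exact hu'.const_mul _

/-- The norm of `W^{s,p}(Ω; ℝ^{m×m})`; it vanishes exactly on the functions that are zero almost
everywhere on `Ω`. -/
noncomputable def wspNorm {n m : ℕ} (Ω : Set (Space n)) (s p : ℝ) (w : Space n → Mat m) : ℝ :=
  ((eLpNorm w (ENNReal.ofReal p) (volume.restrict Ω)).toReal ^ p +
    (eLpNorm (diffQuot s p w) (ENNReal.ofReal p) (volSq Ω)).toReal ^ p) ^ (1 / p)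

/-- Weak convergence `u k ⇀ w` in `W^{s,p}(Ω; ℝ^{m×m})`: convergence under all bounded linear
functionals (a bounded functional does not distinguish functions equal a.e. on `Ω`). -/
def WeakTendsto {n m : ℕ} (Ω : Set (Space n)) (s p : ℝ) (u : ℕ → Space n → Mat m)
    (w : Space n → Mat m) : Prop :=
  ∃ (hu : ∀ k, u k ∈ Wsp m Ω s p) (hw : w ∈ Wsp m Ω s p),
    ∀ f : Wsp m Ω s p →ₗ[ℝ] ℝ,
      (∃ C : ℝ, ∀ v : Wsp m Ω s p, |f v| ≤ C * wspNorm Ω s p (v : Space n → Mat m)) →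
      Tendsto (fun k => f ⟨u k, hu k⟩) atTop (𝓝 (f ⟨w, hw⟩))

/-- The set `W^{s,p}(Ω; K)`. -/
def WspSet {n m : ℕ} (Ω : Set (Space n)) (s p : ℝ) (K : Set (Mat m)) : Set (Space n → Mat m) :=
  {w | w ∈ Wsp m Ω s p ∧ ∀ᵐ x ∂(volume.restrict Ω), w x ∈ K}

/-- The set `L^p(Ω; K)`. -/
def LpSet {n m : ℕ} (Ω : Set (Space n)) (p : ℝ) (K : Set (Mat m)) : Set (Space n → Mat m) :=
  {w | MemLp w (ENNReal.ofReal p) (volume.restrict Ω) ∧ ∀ᵐ x ∂(volume.restrict Ω), w x ∈ K}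

/-- The regularizer
`Φ(w) = ∫_{Ω×Ω} d(w(x), w(y))^p / |x - y|^(n + p s) * ρ(x - y)^l d(x,y)`
for the log-Euclidean metric `d`. -/
noncomputable def Phi {n m : ℕ} (Ω : Set (Space n)) (s p : ℝ) (l : ℕ) (ρ : Space n → ℝ)
    (w : Space n → Mat m) : ℝ≥0∞ :=
  ∫⁻ q, ENNReal.ofReal (logDist (w q.1) (w q.2) ^ p / ‖q.1 - q.2‖ ^ ((n : ℝ) + p * s) *
    ρ (q.1 - q.2) ^ l) ∂(volSq Ω)

/-- The functional `F^{α,v}(w) = ∫_Ω χ_{Ω∖D}(x) d(w(x), v(x))^p dx + α Φ(w)`. -/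
noncomputable def Func {n m : ℕ} (Ω D : Set (Space n)) (s p : ℝ) (l : ℕ) (ρ : Space n → ℝ)
    (α : ℝ) (v w : Space n → Mat m) : ℝ≥0∞ :=
  (∫⁻ x in Ω, (Ω \ D).indicator (fun x => ENNReal.ofReal (logDist (w x) (v x) ^ p)) x) +
    ENNReal.ofReal α * Phi Ω s p l ρ w

/-- `w` minimizes `F^{α,v}` over `W^{s,p}(Ω; K)`. -/
def IsMinimizer {n m : ℕ} (Ω D : Set (Space n)) (s p : ℝ) (l : ℕ) (ρ : Space n → ℝ)
    (K : Set (Mat m)) (α : ℝ) (v w : Space n → Mat m) : Prop :=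
  w ∈ WspSet Ω s p K ∧ ∀ u ∈ WspSet Ω s p K, Func Ω D s p l ρ α v w ≤ Func Ω D s p l ρ α v u

/-- `w⁰` is a true solution: it lies in `W^{s,p}(Ω; K)` and has the least regularizer value among
all elements of `W^{s,p}(Ω; K)` which agree with it where data are available, i.e. on `Ω ∖ D`.
The second condition is void if `D` is a null set. -/
def IsTrueSolution {n m : ℕ} (Ω D : Set (Space n)) (s p : ℝ) (l : ℕ) (ρ : Space n → ℝ)
    (K : Set (Mat m)) (w0 : Space n → Mat m) : Prop :=
  w0 ∈ WspSet Ω s p K ∧ ∀ u ∈ WspSet Ω s p K,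
    (∀ᵐ x ∂(volume.restrict (Ω \ D)), u x = w0 x) → Phi Ω s p l ρ w0 ≤ Phi Ω s p l ρ u

end TensorReg

open TensorReg

/-!
The direct method. On `K` the matrix logarithm is bi-Lipschitz onto a compact convex set, so `Φ(w)`
is the `p`-th power of an `L^p` norm of the fractional difference quotient of `Log ∘ w`. The kernel
is bounded below near the diagonal, and away from it the difference quotient of a `K`-valued
function is bounded; hence a bound on `Φ` is a bound on the Gagliardo seminorm.

A uniformly bounded sequence with bounded Gagliardo seminorm is compact in `L^p`, whatever the
boundary of `Ω`: partition `Ω`, up to a null set, into small balls, control the oscillation on the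
balls by a fractional Poincaré inequality, and extract convergent averages. The functional is lower
semicontinuous along such sequences, and `L^p` convergence with a bounded seminorm is weak
convergence in `W^{s,p}`, by uniform convexity of the seminorm.

For the convergence to the true solution, the limit agrees with it off `D` and has minimal `Φ`.
The midpoint of the two logarithms is again the logarithm of a competitor, so strict convexity makes
their difference locally constant, hence constant on the connected set `Ω`, and it vanishes off `D`.
-/

namespace TensorReg

section MatrixLog

variable {m : ℕ}

theorem Mat.norm_sq_ofMatrix (A : Matrix (Fin m) (Fin m) ℝ) :
    ‖Mat.ofMatrix A‖ ^ 2 = (star A * A).trace := by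
  rw [Mat.norm_ofMatrix, Real.sq_sqrt (by positivity), Finset.sum_comm]
  simp [Matrix.trace, Matrix.mul_apply, Matrix.star_apply, sq]

theorem Mat.norm_ofMatrix_star_unitary_mul_mul_unitary (U V : Matrix.unitaryGroup (Fin m) ℝ)
    (A : Matrix (Fin m) (Fin m) ℝ) :
    ‖Mat.ofMatrix (star U.1 * A * V.1)‖ = ‖Mat.ofMatrix A‖ := by
  have hU : U.1 * star U.1 = 1 := Unitary.mul_star_self_of_mem U.2
  have hV : V.1 * star V.1 = 1 := Unitary.mul_star_self_of_mem V.2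
  have hgram : star (star U.1 * A * V.1) * (star U.1 * A * V.1) =
      star V.1 * (star A * A * V.1) := by
    simp only [star_mul, star_star, mul_assoc]
    rw [← mul_assoc U.1 (star _), hU, one_mul]
  rw [← sq_eq_sq₀ (norm_nonneg _) (norm_nonneg _), Mat.norm_sq_ofMatrix, Mat.norm_sq_ofMatrix,
    hgram, Matrix.trace_mul_comm, mul_assoc, hV, mul_one]

theorem cfc_eq_unitary_mul_diagonal_mul_star {A : Matrix (Fin m) (Fin m) ℝ} (hA : A.IsHermitian)
    (f : ℝ → ℝ) :
    cfc f A = hA.eigenvectorUnitary.1 * Matrix.diagonal (fun i => f (hA.eigenvalues i)) *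
      star hA.eigenvectorUnitary.1 := by
  rw [hA.cfc_eq]
  simp [Matrix.IsHermitian.cfc, Function.comp_def, Unitary.conjStarAlgAut_apply]

theorem star_eigenvectorUnitary_mul_cfc_sub_cfc_mul_apply {A B : Matrix (Fin m) (Fin m) ℝ}
    (hA : A.IsHermitian) (hB : B.IsHermitian) (f : ℝ → ℝ) (i j : Fin m) :
    (star hA.eigenvectorUnitary.1 * (cfc f A - cfc f B) * hB.eigenvectorUnitary.1) i j =
      (f (hA.eigenvalues i) - f (hB.eigenvalues j)) *
        (star hA.eigenvectorUnitary.1 * hB.eigenvectorUnitary.1) i j := by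
  set U := hA.eigenvectorUnitary.1 with hU_def
  set V := hB.eigenvectorUnitary.1 with hV_def
  have hU : star U * U = 1 := Unitary.star_mul_self_of_mem hA.eigenvectorUnitary.2
  have hV : star V * V = 1 := Unitary.star_mul_self_of_mem hB.eigenvectorUnitary.2
  have hconj : star U * (cfc f A - cfc f B) * V =
      Matrix.diagonal (fun i => f (hA.eigenvalues i)) * (star U * V) -
        (star U * V) * Matrix.diagonal (fun i => f (hB.eigenvalues i)) := by
    rw [cfc_eq_unitary_mul_diagonal_mul_star hA, cfc_eq_unitary_mul_diagonal_mul_star hB,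
      ← hU_def, ← hV_def, mul_sub, sub_mul]
    congr 1
    · simp only [← mul_assoc]
      rw [hU, one_mul]
    · simp only [mul_assoc]
      rw [hV, mul_one]
  rw [hconj, Matrix.sub_apply, Matrix.diagonal_mul, Matrix.mul_diagonal]
  ring

theorem Mat.norm_cfc_sub_cfc_le {A B : Matrix (Fin m) (Fin m) ℝ} (hA : A.IsHermitian)
    (hB : B.IsHermitian) {f g : ℝ → ℝ} {C : ℝ} (hC : 0 ≤ C)
    (hfg : ∀ x ∈ spectrum ℝ A, ∀ y ∈ spectrum ℝ B, |f x - f y| ≤ C * |g x - g y|) :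
    ‖Mat.ofMatrix (cfc f A - cfc f B)‖ ≤ C * ‖Mat.ofMatrix (cfc g A - cfc g B)‖ := by
  -- In the eigenbases of `A` and `B` the entries of both sides are divided differences.
  rw [← Mat.norm_ofMatrix_star_unitary_mul_mul_unitary hA.eigenvectorUnitary
      hB.eigenvectorUnitary (cfc f A - cfc f B),
    ← Mat.norm_ofMatrix_star_unitary_mul_mul_unitary hA.eigenvectorUnitary
      hB.eigenvectorUnitary (cfc g A - cfc g B),
    Mat.norm_ofMatrix, Mat.norm_ofMatrix, ← Real.sqrt_sq hC, ← Real.sqrt_mul (sq_nonneg C)]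
  refine Real.sqrt_le_sqrt ?_
  simp only [Finset.mul_sum]
  refine Finset.sum_le_sum fun i _ => Finset.sum_le_sum fun j _ => ?_
  rw [star_eigenvectorUnitary_mul_cfc_sub_cfc_mul_apply,
    star_eigenvectorUnitary_mul_cfc_sub_cfc_mul_apply, abs_mul, abs_mul, mul_pow, mul_pow,
    ← mul_assoc, ← mul_pow C]
  gcongr
  exact hfg _ (hA.eigenvalues_mem_spectrum_real i) _ (hB.eigenvalues_mem_spectrum_real j)

theorem Mat.norm_sq_cfc {A : Matrix (Fin m) (Fin m) ℝ} (hA : A.IsHermitian) (f : ℝ → ℝ) :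
    ‖Mat.ofMatrix (cfc f A)‖ ^ 2 = ∑ i, f (hA.eigenvalues i) ^ 2 := by
  have hU : star hA.eigenvectorUnitary.1 * hA.eigenvectorUnitary.1 = 1 :=
    Unitary.star_mul_self_of_mem hA.eigenvectorUnitary.2
  have hconj : ∀ U D : Matrix (Fin m) (Fin m) ℝ,
      star U * (U * D * star U) * U = (star U * U) * D * (star U * U) := fun U D => by
    simp only [mul_assoc]
  rw [← Mat.norm_ofMatrix_star_unitary_mul_mul_unitary hA.eigenvectorUnitary
      hA.eigenvectorUnitary, cfc_eq_unitary_mul_diagonal_mul_star hA, hconj, hU, one_mul, mul_one,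
    Mat.norm_sq_ofMatrix]
  simp [Matrix.trace, Matrix.star_eq_conjTranspose, sq]

theorem Mat.abs_le_norm_cfc {A : Matrix (Fin m) (Fin m) ℝ} (hA : A.IsHermitian) (f : ℝ → ℝ)
    {x : ℝ} (hx : x ∈ spectrum ℝ A) : |f x| ≤ ‖Mat.ofMatrix (cfc f A)‖ := by
  rw [hA.spectrum_real_eq_range_eigenvalues] at hx
  obtain ⟨i, rfl⟩ := hx
  refine abs_le_of_sq_le_sq ?_ (norm_nonneg _)
  rw [Mat.norm_sq_cfc hA]
  exact Finset.single_le_sum (f := fun i => f (hA.eigenvalues i) ^ 2)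
    (fun _ _ => sq_nonneg _) (Finset.mem_univ i)

theorem abs_exp_sub_exp_le {z a b : ℝ} (ha : a ≤ z) (hb : b ≤ z) :
    |Real.exp a - Real.exp b| ≤ Real.exp z * |a - b| := by
  wlog hba : b ≤ a generalizing a b
  · rw [abs_sub_comm, abs_sub_comm a]
    exact this hb ha (le_of_not_ge hba)
  rw [abs_of_nonneg (sub_nonneg.2 (Real.exp_le_exp.2 hba)), abs_of_nonneg (sub_nonneg.2 hba)]
  calc Real.exp a - Real.exp b = Real.exp a * (1 - Real.exp (b - a)) := by
        rw [mul_sub, ← Real.exp_add, mul_one, add_sub_cancel]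
    _ ≤ Real.exp a * (a - b) := by
        refine mul_le_mul_of_nonneg_left ?_ (Real.exp_pos a).le
        linarith [Real.add_one_le_exp (b - a)]
    _ ≤ Real.exp z * (a - b) := by gcongr

theorem abs_sub_le_exp_mul_abs_exp_sub_exp {z a b : ℝ} (ha : -z ≤ a) (hb : -z ≤ b) :
    |a - b| ≤ Real.exp z * |Real.exp a - Real.exp b| := by
  wlog hba : b ≤ a generalizing a b
  · rw [abs_sub_comm, abs_sub_comm (Real.exp a)]
    exact this hb ha (le_of_not_ge hba)
  rw [abs_of_nonneg (sub_nonneg.2 (Real.exp_le_exp.2 hba)), abs_of_nonneg (sub_nonneg.2 hba)]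
  calc a - b ≤ Real.exp (z + b) * (Real.exp (a - b) - 1) := by
        nlinarith [Real.add_one_le_exp (a - b), Real.one_le_exp (by linarith : 0 ≤ z + b)]
    _ = Real.exp z * (Real.exp a - Real.exp b) := by
        rw [Real.exp_add, mul_assoc, mul_sub, ← Real.exp_add, mul_one, add_sub_cancel]

/-- The symmetric matrices, as a subspace of `ℝ^{m×m}`: the range of `Log` lies in it. -/
def symMat (m : ℕ) : Submodule ℝ (Mat m) where
  carrier := {A | A.toMatrix.IsHermitian}
  zero_mem' := Matrix.isHermitian_zero
  add_mem' hA hB := Matrix.IsHermitian.add hA hB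
  smul_mem' c _ hA := Matrix.IsHermitian.smul hA (IsSelfAdjoint.all c)

/-- The matrix exponential of symmetric matrices on `ℝ^{m×m}`, the inverse of `Log`. -/
noncomputable def Exp (A : Mat m) : Mat m := Mat.ofMatrix (cfc Real.exp A.toMatrix)

theorem Log_Exp {A : Mat m} (hA : A ∈ symMat m) : Log (Exp A) = A := by
  have hsa : IsSelfAdjoint A.toMatrix := Matrix.IsHermitian.isSelfAdjoint hA
  have hlog_exp : cfc Real.log (cfc Real.exp A.toMatrix) = A.toMatrix := by
    rw [← cfc_comp Real.log Real.exp A.toMatrix hsa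
      (Real.continuousOn_log.mono (by rintro _ ⟨x, -, rfl⟩; exact (Real.exp_pos x).ne'))
      (by fun_prop)]
    conv_rhs => rw [← cfc_id ℝ A.toMatrix hsa]
    exact cfc_congr fun x _ => Real.log_exp x
  exact congrArg Mat.ofMatrix hlog_exp

theorem posDef_toMatrix_Exp {A : Mat m} (hA : A ∈ symMat m) : (Exp A).toMatrix.PosDef := by
  have hsa : IsSelfAdjoint A.toMatrix := Matrix.IsHermitian.isSelfAdjoint hA
  have hexp : (cfc Real.exp A.toMatrix).IsHermitian := cfc_predicate (R := ℝ) Real.exp A.toMatrix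
  refine hexp.posDef_iff_eigenvalues_pos.2 fun i => ?_
  have hi := hexp.eigenvalues_mem_spectrum_real i
  rw [cfc_map_spectrum (R := ℝ) Real.exp A.toMatrix hsa (by fun_prop)] at hi
  obtain ⟨x, -, hx⟩ := hi
  exact hx ▸ Real.exp_pos x

theorem Exp_mem_SPDLog {z : ℝ} {A : Mat m} (hA : A ∈ symMat m) (hAz : ‖A‖ ≤ z) :
    Exp A ∈ SPDLog m z :=
  ⟨posDef_toMatrix_Exp hA, by rwa [Log_Exp hA]⟩

theorem image_Log_SPDLog (m : ℕ) (z : ℝ) :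
    Log '' SPDLog m z = (symMat m : Set (Mat m)) ∩ Metric.closedBall 0 z := by
  refine Set.Subset.antisymm ?_ fun A hA => ?_
  · rintro _ ⟨A, hA, rfl⟩
    exact ⟨cfc_predicate (R := ℝ) Real.log A.toMatrix, mem_closedBall_zero_iff.2 hA.2⟩
  · exact ⟨Exp A, Exp_mem_SPDLog hA.1 (mem_closedBall_zero_iff.1 hA.2), Log_Exp hA.1⟩

theorem pos_and_abs_log_le_of_mem_spectrum {z : ℝ} {A : Mat m} (hA : A ∈ SPDLog m z) {x : ℝ}
    (hx : x ∈ spectrum ℝ A.toMatrix) : 0 < x ∧ |Real.log x| ≤ z := by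
  have hH := hA.1.isHermitian
  refine ⟨?_, (Mat.abs_le_norm_cfc hH Real.log hx).trans hA.2⟩
  rw [hH.spectrum_real_eq_range_eigenvalues] at hx
  obtain ⟨i, rfl⟩ := hx
  exact hA.1.eigenvalues_pos i

theorem norm_Log_sub_Log_le {z : ℝ} {A B : Mat m} (hA : A ∈ SPDLog m z) (hB : B ∈ SPDLog m z) :
    ‖Log A - Log B‖ ≤ Real.exp z * ‖A - B‖ := by
  have hle := Mat.norm_cfc_sub_cfc_le (f := Real.log) (g := id) hA.1.isHermitian hB.1.isHermitian
    (Real.exp_pos z).le fun x hx y hy => by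
      obtain ⟨hx0, hxz⟩ := pos_and_abs_log_le_of_mem_spectrum hA hx
      obtain ⟨hy0, hyz⟩ := pos_and_abs_log_le_of_mem_spectrum hB hy
      simpa [Real.exp_log hx0, Real.exp_log hy0] using
        abs_sub_le_exp_mul_abs_exp_sub_exp (abs_le.1 hxz).1 (abs_le.1 hyz).1
  rwa [cfc_id ℝ A.toMatrix hA.1.isHermitian.isSelfAdjoint,
    cfc_id ℝ B.toMatrix hB.1.isHermitian.isSelfAdjoint] at hle

theorem norm_sub_le_norm_Log_sub_Log {z : ℝ} {A B : Mat m} (hA : A ∈ SPDLog m z)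
    (hB : B ∈ SPDLog m z) : ‖A - B‖ ≤ Real.exp z * ‖Log A - Log B‖ := by
  have hle := Mat.norm_cfc_sub_cfc_le (f := id) (g := Real.log) hA.1.isHermitian hB.1.isHermitian
    (Real.exp_pos z).le fun x hx y hy => by
      obtain ⟨hx0, hxz⟩ := pos_and_abs_log_le_of_mem_spectrum hA hx
      obtain ⟨hy0, hyz⟩ := pos_and_abs_log_le_of_mem_spectrum hB hy
      simpa [Real.exp_log hx0, Real.exp_log hy0] using
        abs_exp_sub_exp_le (abs_le.1 hxz).2 (abs_le.1 hyz).2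
  rwa [cfc_id ℝ A.toMatrix hA.1.isHermitian.isSelfAdjoint,
    cfc_id ℝ B.toMatrix hB.1.isHermitian.isSelfAdjoint] at hle

/-- A set of matrices that `Log` maps bi-Lipschitz onto a compact convex set. This is all that
existence, stability and convergence require of the values of the competitors. -/
structure IsLogConvexBody (K : Set (Mat m)) : Prop where
  nonempty : K.Nonempty
  isCompact_image : IsCompact (Log '' K)
  convex_image : Convex ℝ (Log '' K)
  exists_lipschitzOnWith : ∃ L, LipschitzOnWith L Log K
  exists_antilipschitzWith : ∃ L, AntilipschitzWith L (K.domRestrict Log)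

theorem isLogConvexBody_SPDLog (m : ℕ) {z : ℝ} (hz : 0 ≤ z) : IsLogConvexBody (SPDLog m z) where
  nonempty := ⟨Exp 0, Exp_mem_SPDLog (zero_mem _) (by simpa using hz)⟩
  isCompact_image := by
    rw [image_Log_SPDLog]
    exact (isCompact_closedBall 0 z).inter_left (Submodule.closed_of_finiteDimensional _)
  convex_image := by
    rw [image_Log_SPDLog]
    exact (symMat m).convex.inter (convex_closedBall 0 z)
  exists_lipschitzOnWith := ⟨⟨Real.exp z, (Real.exp_pos z).le⟩,
    LipschitzOnWith.of_dist_le_mul fun A hA B hB => by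
      rw [dist_eq_norm, dist_eq_norm]; exact norm_Log_sub_Log_le hA hB⟩
  exists_antilipschitzWith := ⟨⟨Real.exp z, (Real.exp_pos z).le⟩,
    AntilipschitzWith.of_le_mul_dist fun A B => by
      rw [Subtype.dist_eq, dist_eq_norm, dist_eq_norm]; exact norm_sub_le_norm_Log_sub_Log A.2 B.2⟩

end MatrixLog

section UniformConvexity

variable {V : Type*} [NormedAddCommGroup V] [NormedSpace ℝ V] {p : ℝ}

theorem norm_inv_two_smul_add_le (a b : V) :
    ‖(2⁻¹ : ℝ) • (a + b)‖ ≤ 2⁻¹ * ‖a‖ + 2⁻¹ * ‖b‖ := by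
  rw [norm_smul, ← mul_add, Real.norm_of_nonneg (by norm_num)]
  gcongr
  exact norm_add_le a b

theorem norm_midpoint_rpow_le (hp : 1 ≤ p) (a b : V) :
    ‖(2⁻¹ : ℝ) • (a + b)‖ ^ p ≤ 2⁻¹ * (‖a‖ ^ p + ‖b‖ ^ p) := by
  calc ‖(2⁻¹ : ℝ) • (a + b)‖ ^ p ≤ (2⁻¹ * ‖a‖ + 2⁻¹ * ‖b‖) ^ p := by
        gcongr
        exact norm_inv_two_smul_add_le a b
    _ ≤ 2⁻¹ * ‖a‖ ^ p + 2⁻¹ * ‖b‖ ^ p :=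
        (convexOn_rpow hp).2 (norm_nonneg a) (norm_nonneg b) (by norm_num) (by norm_num)
          (by norm_num)
    _ = 2⁻¹ * (‖a‖ ^ p + ‖b‖ ^ p) := (mul_add _ _ _).symm

theorem norm_midpoint_rpow_lt [StrictConvexSpace ℝ V] (hp : 1 < p) {a b : V} (hab : a ≠ b) :
    ‖(2⁻¹ : ℝ) • (a + b)‖ ^ p < 2⁻¹ * (‖a‖ ^ p + ‖b‖ ^ p) := by
  rcases eq_or_ne ‖a‖ ‖b‖ with hnorm | hnorm
  · have hlt : ‖(2⁻¹ : ℝ) • (a + b)‖ < ‖a‖ := by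
      simpa only [one_div] using (norm_midpoint_lt_iff hnorm).2 hab
    have hlt_rpow := Real.rpow_lt_rpow (norm_nonneg _) hlt (zero_lt_one.trans hp)
    rw [← hnorm]
    linarith
  · calc ‖(2⁻¹ : ℝ) • (a + b)‖ ^ p ≤ (2⁻¹ * ‖a‖ + 2⁻¹ * ‖b‖) ^ p := by
          gcongr
          exact norm_inv_two_smul_add_le a b
      _ < 2⁻¹ * ‖a‖ ^ p + 2⁻¹ * ‖b‖ ^ p :=
          (strictConvexOn_rpow hp).2 (norm_nonneg a) (norm_nonneg b) hnorm (by norm_num)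
            (by norm_num) (by norm_num)
      _ = 2⁻¹ * (‖a‖ ^ p + ‖b‖ ^ p) := (mul_add _ _ _).symm

theorem exists_pos_norm_midpoint_rpow_add_le [StrictConvexSpace ℝ V] [ProperSpace V] (hp : 1 < p)
    {ε : ℝ} (hε : 0 < ε) :
    ∃ γ : ℝ, 0 < γ ∧ ∀ a b : V, ‖(a, b)‖ = 1 → ε ≤ ‖a - b‖ ^ p →
      ‖(2⁻¹ : ℝ) • (a + b)‖ ^ p + γ ≤ 2⁻¹ * (‖a‖ ^ p + ‖b‖ ^ p) := by
  have hp0 : 0 < p := zero_lt_one.trans hp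
  have hrpow : Continuous fun x : ℝ => x ^ p := Real.continuous_rpow_const hp0.le
  let gap : V × V → ℝ := fun q => 2⁻¹ * (‖q.1‖ ^ p + ‖q.2‖ ^ p) - ‖(2⁻¹ : ℝ) • (q.1 + q.2)‖ ^ p
  let T : Set (V × V) := Metric.sphere 0 1 ∩ {q | ε ≤ ‖q.1 - q.2‖ ^ p}
  have hT : IsCompact T :=
    (isCompact_sphere 0 1).inter_right (isClosed_le continuous_const (by fun_prop))
  have hgap : ContinuousOn gap T := by fun_prop
  have hgap_pos : ∀ q ∈ T, 0 < gap q := by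
    rintro ⟨a, b⟩ ⟨-, hab⟩
    refine sub_pos.2 (norm_midpoint_rpow_lt hp ?_)
    intro (heq : a = b)
    simp only [heq, sub_self, norm_zero, Set.mem_ofPred_eq, Real.zero_rpow hp0.ne'] at hab
    exact hε.not_ge hab
  obtain ⟨γ, hγ, hle⟩ := hT.exists_forall_le' hgap hgap_pos
  exact ⟨γ, hγ, fun a b hab hdist => le_sub_iff_add_le'.1
    (hle (a, b) ⟨mem_sphere_zero_iff_norm.2 hab, hdist⟩)⟩

theorem exists_uniform_convexity_of_norm_eq_one [StrictConvexSpace ℝ V] [ProperSpace V]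
    (hp : 1 < p) {ε : ℝ} (hε : 0 < ε) :
    ∃ C : ℝ, 0 ≤ C ∧ ∀ a b : V, ‖(a, b)‖ = 1 →
      ‖a - b‖ ^ p + C * ‖(2⁻¹ : ℝ) • (a + b)‖ ^ p ≤ (ε + C / 2) * (‖a‖ ^ p + ‖b‖ ^ p) := by
  obtain ⟨γ, hγ, hgap⟩ := exists_pos_norm_midpoint_rpow_add_le (V := V) hp hε
  refine ⟨2 ^ p / γ, by positivity, fun a b hab => ?_⟩
  set C := (2 : ℝ) ^ p / γ with hC
  have hC0 : 0 ≤ C := by positivity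
  rcases le_total ε (‖a - b‖ ^ p) with hdist | hdist
  · have hdist_le : ‖a - b‖ ^ p ≤ C * γ := by
      rw [hC, div_mul_cancel₀ _ hγ.ne']
      gcongr
      linarith [norm_sub_le a b, norm_fst_le (a, b), norm_snd_le (a, b)]
    have hmid := mul_le_mul_of_nonneg_left (hgap a b hab hdist) hC0
    have hε_nonneg : 0 ≤ ε * (‖a‖ ^ p + ‖b‖ ^ p) := by positivity
    linarith
  · have hone_le : 1 ≤ ‖a‖ ^ p + ‖b‖ ^ p := by
      have ha : 0 ≤ ‖a‖ ^ p := by positivity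
      have hb : 0 ≤ ‖b‖ ^ p := by positivity
      rcases max_choice ‖a‖ ‖b‖ with hmax | hmax <;> rw [Prod.norm_mk, hmax] at hab <;>
        rw [hab, Real.one_rpow] <;> linarith
    have hmid := mul_le_mul_of_nonneg_left (norm_midpoint_rpow_le hp.le a b) hC0
    have hε_le : ε ≤ ε * (‖a‖ ^ p + ‖b‖ ^ p) := le_mul_of_one_le_right hε.le hone_le
    linarith

theorem exists_uniform_convexity [StrictConvexSpace ℝ V] [ProperSpace V] (hp : 1 < p) {ε : ℝ}
    (hε : 0 < ε) :
    ∃ C : ℝ, 0 ≤ C ∧ ∀ a b : V,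
      ‖a - b‖ ^ p + C * ‖(2⁻¹ : ℝ) • (a + b)‖ ^ p ≤ (ε + C / 2) * (‖a‖ ^ p + ‖b‖ ^ p) := by
  have hp0 : 0 < p := zero_lt_one.trans hp
  obtain ⟨C, hC, hsphere⟩ := exists_uniform_convexity_of_norm_eq_one (V := V) hp hε
  refine ⟨C, hC, fun a b => ?_⟩
  rcases eq_or_ne (a, b) 0 with h0 | h0
  · obtain ⟨rfl, rfl⟩ : a = 0 ∧ b = 0 := Prod.mk_eq_zero.1 h0
    simp [Real.zero_rpow hp0.ne']
  set t := ‖(a, b)‖ with ht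
  have ht0 : 0 < t := norm_pos_iff.2 h0
  have hnormalized := hsphere (t⁻¹ • a) (t⁻¹ • b) (by
    rw [← Prod.smul_mk, norm_smul, ← ht, Real.norm_of_nonneg (inv_nonneg.2 ht0.le),
      inv_mul_cancel₀ ht0.ne'])
  have hhom : ∀ c : V, ‖t⁻¹ • c‖ ^ p = (t ^ p)⁻¹ * ‖c‖ ^ p := fun c => by
    rw [norm_smul, Real.mul_rpow (norm_nonneg _) (norm_nonneg _),
      Real.norm_of_nonneg (inv_nonneg.2 ht0.le), Real.inv_rpow ht0.le]
  rw [← smul_sub, ← smul_add, smul_comm (2⁻¹ : ℝ)] at hnormalized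
  simp only [hhom] at hnormalized
  refine le_of_mul_le_mul_left ?_ (inv_pos.2 (by positivity : 0 < t ^ p))
  linarith

end UniformConvexity

section LpPow

variable {X : Type*} [MeasurableSpace X] {V : Type*} [NormedAddCommGroup V] {p : ℝ} {μ : Measure X}

/-- The `p`-th power of the `L^p` norm. Unlike the norm it is additive over the domain and an
integral, so that Fatou's lemma, convexity and Fubini apply to it directly. -/
noncomputable def lpPow (p : ℝ) (μ : Measure X) (f : X → V) : ℝ≥0∞ := ∫⁻ x, ‖f x‖ₑ ^ p ∂μ

theorem eLpNorm_rpow_eq_lpPow (hp : 0 < p) (f : X → V) :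
    eLpNorm f (ENNReal.ofReal p) μ ^ p = lpPow p μ f := by
  rw [eLpNorm_eq_lintegral_rpow_enorm_toReal (by simpa using hp) ENNReal.ofReal_ne_top,
    ENNReal.toReal_ofReal hp.le, ← ENNReal.rpow_mul, one_div, inv_mul_cancel₀ hp.ne',
    ENNReal.rpow_one, lpPow]

theorem memLp_iff_lpPow_lt_top (hp : 0 < p) {f : X → V} :
    MemLp f (ENNReal.ofReal p) μ ↔ AEStronglyMeasurable f μ ∧ lpPow p μ f < ⊤ := by
  rw [MemLp, ← eLpNorm_rpow_eq_lpPow hp, ENNReal.rpow_lt_top_iff_of_pos hp]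

theorem tendsto_lpPow_of_tendsto_eLpNorm (hp : 0 < p) {ι : Type*} {F : Filter ι} {f : ι → X → V}
    (hf : Tendsto (fun i => eLpNorm (f i) (ENNReal.ofReal p) μ) F (𝓝 0)) :
    Tendsto (fun i => lpPow p μ (f i)) F (𝓝 0) := by
  simpa only [Function.comp_def, eLpNorm_rpow_eq_lpPow hp, ENNReal.zero_rpow_of_pos hp] using
    ((ENNReal.continuous_rpow_const (y := p)).tendsto 0).comp hf

theorem tendsto_eLpNorm_of_tendsto_lpPow (hp : 0 < p) {ι : Type*} {F : Filter ι} {f : ι → X → V}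
    (hf : Tendsto (fun i => lpPow p μ (f i)) F (𝓝 0)) :
    Tendsto (fun i => eLpNorm (f i) (ENNReal.ofReal p) μ) F (𝓝 0) := by
  have hroot := ((ENNReal.continuous_rpow_const (y := p⁻¹)).tendsto 0).comp hf
  simpa only [Function.comp_def, ← eLpNorm_rpow_eq_lpPow hp, ← ENNReal.rpow_mul,
    mul_inv_cancel₀ hp.ne', ENNReal.rpow_one, ENNReal.zero_rpow_of_pos (inv_pos.2 hp)] using hroot

theorem lpPow_mono_measure {ν : Measure X} (h : ν ≤ μ) (f : X → V) : lpPow p ν f ≤ lpPow p μ f :=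
  lintegral_mono' h le_rfl

theorem lpPow_congr {f g : X → V} (h : f =ᵐ[μ] g) : lpPow p μ f = lpPow p μ g :=
  lintegral_congr_ae (h.mono fun x hx => by simp only [hx])

theorem lpPow_sub_comm (f g : X → V) : lpPow p μ (f - g) = lpPow p μ (g - f) := by
  simp only [lpPow, Pi.sub_apply, enorm_sub_rev]

theorem ae_eq_of_lpPow_sub_eq_zero (hp : 0 < p) {f g : X → V} (hf : AEStronglyMeasurable f μ)
    (hg : AEStronglyMeasurable g μ) (h : lpPow p μ (f - g) = 0) : f =ᵐ[μ] g := by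
  rw [lpPow, lintegral_eq_zero_iff' ((hf.sub hg).enorm.pow_const p)] at h
  filter_upwards [h] with x hx
  simpa [hp, sub_eq_zero] using hx

theorem lpPow_le_liminf {f : ℕ → X → V} {g : X → V} (hf : ∀ k, AEStronglyMeasurable (f k) μ)
    (hlim : ∀ᵐ x ∂μ, Tendsto (fun k => f k x) atTop (𝓝 (g x))) :
    lpPow p μ g ≤ liminf (fun k => lpPow p μ (f k)) atTop := by
  refine le_trans (lintegral_mono_ae ?_) (lintegral_liminf_le' fun k => (hf k).enorm.pow_const p)
  filter_upwards [hlim] with x hx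
  exact (((ENNReal.continuous_rpow_const (y := p)).tendsto _).comp hx.enorm).liminf_eq.ge

theorem tendsto_lpPow_of_tendsto_lpPow_sub (hp : 1 ≤ p) {f : ℕ → X → V} {g : X → V}
    (hf : ∀ k, AEStronglyMeasurable (f k) μ) (hg : MemLp g (ENNReal.ofReal p) μ)
    (h : Tendsto (fun k => lpPow p μ (f k - g)) atTop (𝓝 0)) :
    Tendsto (fun k => lpPow p μ (f k)) atTop (𝓝 (lpPow p μ g)) := by
  have hp0 : 0 < p := zero_lt_one.trans_le hp
  have hp1 : 1 ≤ ENNReal.ofReal p := by simpa using hp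
  have hsub := tendsto_eLpNorm_of_tendsto_lpPow hp0 h
  have hlower := ENNReal.Tendsto.sub
    (tendsto_const_nhds (x := eLpNorm g (ENNReal.ofReal p) μ)) hsub (.inl hg.2.ne)
  have hupper := (tendsto_const_nhds (x := eLpNorm g (ENNReal.ofReal p) μ)).add hsub
  rw [tsub_zero] at hlower
  rw [add_zero] at hupper
  have hnorm : Tendsto (fun k => eLpNorm (f k) (ENNReal.ofReal p) μ) atTop
      (𝓝 (eLpNorm g (ENNReal.ofReal p) μ)) := by
    refine tendsto_of_tendsto_of_tendsto_of_le_of_le hlower hupper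
      (fun k => tsub_le_iff_right.2 ?_) fun k => ?_
    · simpa only [sub_sub_cancel] using eLpNorm_sub_le (hf k) ((hf k).sub hg.1) hp1
    · simpa only [add_sub_cancel] using eLpNorm_add_le hg.1 ((hf k).sub hg.1) hp1
  simpa only [Function.comp_def, eLpNorm_rpow_eq_lpPow hp0] using
    ((ENNReal.continuous_rpow_const (y := p)).tendsto _).comp hnorm

theorem lpPow_add_le (hp : 1 ≤ p) {f g : X → V} (hf : AEStronglyMeasurable f μ) :
    lpPow p μ (f + g) ≤ 2 ^ (p - 1) * (lpPow p μ f + lpPow p μ g) := by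
  have htwo : (2 : ℝ≥0∞) ^ (p - 1) ≠ ⊤ :=
    ENNReal.rpow_ne_top_of_nonneg (sub_nonneg.2 hp) ENNReal.ofNat_ne_top
  rw [lpPow, lpPow, lpPow, ← lintegral_add_left' (hf.enorm.pow_const p),
    ← lintegral_const_mul' _ _ htwo]
  refine lintegral_mono fun x => ?_
  calc ‖f x + g x‖ₑ ^ p ≤ (‖f x‖ₑ + ‖g x‖ₑ) ^ p := by
        gcongr
        exact enorm_add_le _ _
    _ ≤ 2 ^ (p - 1) * (‖f x‖ₑ ^ p + ‖g x‖ₑ ^ p) :=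
        ENNReal.rpow_add_le_mul_rpow_add_rpow _ _ hp

theorem lpPow_le_of_ae_norm_le (hp : 0 ≤ p) {f : X → V} {M : ℝ} (h : ∀ᵐ x ∂μ, ‖f x‖ ≤ M) :
    lpPow p μ f ≤ ENNReal.ofReal M ^ p * μ Set.univ := by
  rw [← lintegral_const]
  refine lintegral_mono_ae (h.mono fun x hx => ENNReal.rpow_le_rpow ?_ hp)
  rw [← ofReal_norm]
  exact ENNReal.ofReal_le_ofReal hx

theorem lpPow_le_of_ae_norm_le_mul (hp : 0 ≤ p) {W : Type*} [NormedAddCommGroup W] {L : NNReal}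
    {f : X → V} {g : X → W} (h : ∀ᵐ x ∂μ, ‖g x‖ ≤ L * ‖f x‖) :
    lpPow p μ g ≤ (L : ℝ≥0∞) ^ p * lpPow p μ f := by
  have hL : (L : ℝ≥0∞) ^ p ≠ ⊤ := ENNReal.rpow_ne_top_of_nonneg hp ENNReal.coe_ne_top
  rw [lpPow, lpPow, ← lintegral_const_mul' _ _ hL]
  refine lintegral_mono_ae (h.mono fun x hx => ?_)
  rw [← ENNReal.mul_rpow_of_nonneg _ _ hp]
  gcongr
  simp only [enorm_eq_nnnorm]
  exact_mod_cast hx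

theorem exists_lpPow_uniform_convexity [NormedSpace ℝ V] [StrictConvexSpace ℝ V] [ProperSpace V]
    (hp : 1 < p) {ε : NNReal} (hε : 0 < ε) :
    ∃ C : NNReal, ∀ {X : Type _} [MeasurableSpace X] (μ : Measure X) (f g : X → V),
      AEStronglyMeasurable f μ → AEStronglyMeasurable g μ →
      lpPow p μ (f - g) + C * lpPow p μ ((2⁻¹ : ℝ) • (f + g)) ≤
        (ε + C / 2) * (lpPow p μ f + lpPow p μ g) := by
  have hp0 : 0 ≤ p := zero_le_one.trans hp.le
  obtain ⟨C, hC, hV⟩ := exists_uniform_convexity (V := V) hp (NNReal.coe_pos.2 hε)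
  lift C to NNReal using hC
  refine ⟨C, fun μ f g hf hg => ?_⟩
  have hpointwise : ∀ a b : V, ‖a - b‖ₑ ^ p + C * ‖(2⁻¹ : ℝ) • (a + b)‖ₑ ^ p ≤
      (ε + C / 2) * (‖a‖ₑ ^ p + ‖b‖ₑ ^ p) := by
    intro a b
    have hnn : ‖a - b‖₊ ^ p + C * ‖(2⁻¹ : ℝ) • (a + b)‖₊ ^ p ≤
        (ε + C / 2) * (‖a‖₊ ^ p + ‖b‖₊ ^ p) := by
      have := hV a b
      exact_mod_cast this
    have henn := ENNReal.coe_le_coe.2 hnn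
    simp only [enorm_eq_nnnorm, ← ENNReal.coe_rpow_of_nonneg _ hp0]
    push_cast at henn ⊢
    exact henn
  simp only [lpPow]
  rw [← lintegral_const_mul' _ _ ENNReal.coe_ne_top,
    ← lintegral_add_left' ((hf.sub hg).enorm.pow_const p),
    ← lintegral_add_left' (hf.enorm.pow_const p),
    ← lintegral_const_mul' _ _ (by finiteness)]
  exact lintegral_mono fun x => hpointwise (f x) (g x)

theorem enorm_midpoint_rpow_le [NormedSpace ℝ V] (hp : 1 ≤ p) (a b : V) :
    ‖(2⁻¹ : ℝ) • (a + b)‖ₑ ^ p ≤ 2⁻¹ * (‖a‖ₑ ^ p + ‖b‖ₑ ^ p) := by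
  have hp0 : 0 ≤ p := zero_le_one.trans hp
  have hnn : ‖(2⁻¹ : ℝ) • (a + b)‖₊ ^ p ≤ 2⁻¹ * (‖a‖₊ ^ p + ‖b‖₊ ^ p) := by
    have := norm_midpoint_rpow_le hp a b
    exact_mod_cast this
  have henn := ENNReal.coe_le_coe.2 hnn
  simp only [enorm_eq_nnnorm, ← ENNReal.coe_rpow_of_nonneg _ hp0]
  push_cast at henn ⊢
  exact henn

theorem lpPow_midpoint_le [NormedSpace ℝ V] (hp : 1 ≤ p) {f : X → V}
    (hf : AEStronglyMeasurable f μ) (g : X → V) :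
    lpPow p μ ((2⁻¹ : ℝ) • (f + g)) ≤ 2⁻¹ * (lpPow p μ f + lpPow p μ g) := by
  simp only [lpPow]
  rw [← lintegral_add_left' (hf.enorm.pow_const p), ← lintegral_const_mul' _ _ (by simp)]
  exact lintegral_mono fun x => enorm_midpoint_rpow_le hp (f x) (g x)

theorem ae_eq_of_lpPow_add_lpPow_le_two_mul [NormedSpace ℝ V] [StrictConvexSpace ℝ V]
    (hp : 1 < p) {f g : X → V} (hf : AEStronglyMeasurable f μ) (hg : AEStronglyMeasurable g μ)
    (hf_fin : lpPow p μ f ≠ ⊤) (hg_fin : lpPow p μ g ≠ ⊤)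
    (hmid : lpPow p μ f + lpPow p μ g ≤ 2 * lpPow p μ ((2⁻¹ : ℝ) • (f + g))) : f =ᵐ[μ] g := by
  have hle : ∀ x, ‖(2⁻¹ : ℝ) • (f x + g x)‖ₑ ^ p ≤ 2⁻¹ * (‖f x‖ₑ ^ p + ‖g x‖ₑ ^ p) :=
    fun x => enorm_midpoint_rpow_le hp.le (f x) (g x)
  have hint : ∫⁻ x, 2⁻¹ * (‖f x‖ₑ ^ p + ‖g x‖ₑ ^ p) ∂μ = 2⁻¹ * (lpPow p μ f + lpPow p μ g) := by
    rw [lintegral_const_mul' _ _ (by simp), lintegral_add_left' (hf.enorm.pow_const p), lpPow,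
      lpPow]
  have hint_ne_top : ∫⁻ x, 2⁻¹ * (‖f x‖ₑ ^ p + ‖g x‖ₑ ^ p) ∂μ ≠ ⊤ := by
    rw [hint]
    finiteness
  have heq := ae_eq_of_ae_le_of_lintegral_le (Eventually.of_forall hle)
    (ne_top_of_le_ne_top hint_ne_top (lintegral_mono hle))
    (((hf.enorm.pow_const p).add (hg.enorm.pow_const p)).const_mul 2⁻¹) (by
      rw [hint]
      exact ENNReal.inv_mul_le_iff two_ne_zero ENNReal.ofNat_ne_top |>.2 hmid)
  filter_upwards [heq] with x hx
  by_contra hne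
  have hp0 : 0 ≤ p := zero_le_one.trans hp.le
  have hlt : ‖(2⁻¹ : ℝ) • (f x + g x)‖₊ ^ p < 2⁻¹ * (‖f x‖₊ ^ p + ‖g x‖₊ ^ p) := by
    have := norm_midpoint_rpow_lt hp hne
    exact_mod_cast this
  have hlt_enorm := ENNReal.coe_lt_coe.2 hlt
  simp only [enorm_eq_nnnorm, ← ENNReal.coe_rpow_of_nonneg _ hp0] at hx
  push_cast at hx hlt_enorm
  exact hlt_enorm.ne hx

end LpPow

section UniformlyConvexFunctional

variable {X : Type*} {P : X → ℝ} {S : ℕ → Set X} {M : ℝ}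

theorem exists_asymptotically_minimizing_seq (hP : ∀ x, 0 ≤ P x) (hS : Antitone S)
    (hM : ∀ N, ∃ x ∈ S N, P x ≤ M) :
    ∃ (x : ℕ → X) (d : ℕ → ℝ) (D : ℝ), (∀ N, x N ∈ S N) ∧ (∀ N, ∀ y ∈ S N, d N ≤ P y) ∧
      Tendsto d atTop (𝓝 D) ∧ D ≤ M ∧ ∀ N, P (x N) ≤ D + 1 / ((N : ℝ) + 1) := by
  let d : ℕ → ℝ := fun N => sInf (P '' S N)
  have hbelow : ∀ N, BddBelow (P '' S N) := fun N => ⟨0, by rintro _ ⟨x, -, rfl⟩; exact hP x⟩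
  have hd_le : ∀ N, ∀ y ∈ S N, d N ≤ P y := fun N y hy => csInf_le (hbelow N) ⟨y, hy, rfl⟩
  have hne : ∀ N, (P '' S N).Nonempty := fun N =>
    let ⟨x, hx, _⟩ := hM N
    ⟨P x, x, hx, rfl⟩
  have hd_mono : Monotone d := fun N N' h =>
    csInf_le_csInf (hbelow N) (hne N') (Set.image_mono (hS h))
  have hd_le_M : ∀ N, d N ≤ M := fun N =>
    let ⟨x, hx, hxM⟩ := hM N
    (hd_le N x hx).trans hxM
  have habove : BddAbove (Set.range d) := ⟨M, by rintro _ ⟨N, rfl⟩; exact hd_le_M N⟩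
  have hnear : ∀ N : ℕ, ∃ x ∈ S N, P x < d N + 1 / ((N : ℝ) + 1) := fun N => by
    obtain ⟨_, ⟨x, hx, rfl⟩, hlt⟩ := exists_lt_of_csInf_lt (hne N)
      (lt_add_of_pos_right (d N) (by positivity : 0 < 1 / ((N : ℝ) + 1)))
    exact ⟨x, hx, hlt⟩
  choose x hxS hxlt using hnear
  refine ⟨x, d, ⨆ N, d N, hxS, hd_le, tendsto_atTop_ciSup hd_mono habove, ciSup_le hd_le_M,
    fun N => (hxlt N).le.trans ?_⟩
  gcongr
  exact le_ciSup habove N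

/-- Uniform convexity makes near-minimizers of shrinking convex sets a Cauchy sequence; this stands
in for Mazur's lemma and reflexivity. -/
theorem exists_mem_convex_cauchy [AddCommGroup X] [Module ℝ X] (hP : ∀ x, 0 ≤ P x)
    (hUC : ∀ ε : ℝ, 0 < ε → ∃ C : ℝ, 0 ≤ C ∧ ∀ x y,
      P (x - y) + C * P ((2⁻¹ : ℝ) • (x + y)) ≤ (ε + C / 2) * (P x + P y))
    (hS : Antitone S) (hconvex : ∀ N, Convex ℝ (S N)) (hM : ∀ N, ∃ x ∈ S N, P x ≤ M) :
    ∃ x : ℕ → X, (∀ N, x N ∈ S N) ∧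
      ∀ ε : ℝ, 0 < ε → ∃ N₀, ∀ N ≥ N₀, ∀ N' ≥ N, P (x N - x N') ≤ ε := by
  obtain ⟨x, d, D, hxS, hd_le, hdlim, hDM, hxP⟩ := exists_asymptotically_minimizing_seq hP hS hM
  refine ⟨x, hxS, fun ε hε => ?_⟩
  have hM0 : 0 ≤ M := let ⟨x, _, hx⟩ := hM 0; (hP x).trans hx
  obtain ⟨C, hC, hconv⟩ := hUC (ε / (4 * (M + 1))) (by positivity)
  have hgap : Tendsto (fun N : ℕ => C * (D + 1 / ((N : ℝ) + 1) - d N)) atTop (𝓝 0) := by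
    simpa using (((tendsto_const_nhds (x := D)).add
      tendsto_one_div_add_atTop_nhds_zero_nat).sub hdlim).const_mul C
  obtain ⟨N₀, hN₀⟩ := eventually_atTop.1 (hgap.eventually_lt_const (half_pos hε))
  refine ⟨N₀, fun N hN N' hN' => ?_⟩
  set t : ℝ := 1 / ((N : ℝ) + 1) with ht
  have ht' : 1 / ((N' : ℝ) + 1) ≤ t := by rw [ht]; gcongr
  have ht1 : t ≤ 1 := by
    rw [ht, div_le_one (by positivity)]
    linarith [N.cast_nonneg (α := ℝ)]
  have hmid : (2⁻¹ : ℝ) • (x N + x N') ∈ S N := by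
    rw [smul_add]
    exact hconvex N (hxS N) (hS hN' (hxS N')) (by norm_num) (by norm_num) (by norm_num)
  have hsum : P (x N) + P (x N') ≤ 2 * (D + t) := by linarith [hxP N, hxP N']
  calc P (x N - x N')
      ≤ (ε / (4 * (M + 1)) + C / 2) * (P (x N) + P (x N')) -
          C * P ((2⁻¹ : ℝ) • (x N + x N')) := le_sub_iff_add_le.2 (hconv _ _)
    _ ≤ (ε / (4 * (M + 1)) + C / 2) * (2 * (D + t)) - C * d N := by
        gcongr
        exact hd_le N _ hmid
    _ = ε / (4 * (M + 1)) * (2 * (D + t)) + C * (D + t - d N) := by ring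
    _ ≤ ε / (4 * (M + 1)) * (2 * (M + 1)) + ε / 2 := by
        gcongr
        exact (hN₀ N hN).le
    _ = ε := by field_simp; norm_num

end UniformlyConvexFunctional

section Sequences

theorem le_liminf_of_forall_subseq {F : ℕ → ℝ≥0∞} {c : ℝ≥0∞}
    (h : ∀ φ : ℕ → ℕ, StrictMono φ → ∃ ψ : ℕ → ℕ, StrictMono ψ ∧
      c ≤ liminf (fun k => F (φ (ψ k))) atTop) : c ≤ liminf F atTop := by
  by_contra! hlt
  obtain ⟨b, hb, hbc⟩ := exists_between hlt
  obtain ⟨φ, hφ, hφb⟩ := extraction_of_frequently_atTop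
    (frequently_lt_of_liminf_lt (by isBoundedDefault) hb)
  obtain ⟨ψ, -, hψ⟩ := h φ hφ
  exact hbc.not_ge (hψ.trans (liminf_le_of_frequently_le'
    (Eventually.of_forall fun k => (hφb (ψ k)).le).frequently))

theorem exists_subseq_ae_tendsto_of_tendsto_lpPow {X : Type*} [MeasurableSpace X] {μ : Measure X}
    {V : Type*} [NormedAddCommGroup V] {p : ℝ} (hp : 0 < p) {u : ℕ → X → V} {w : X → V}
    (hu : ∀ k, AEStronglyMeasurable (u k) μ) (hw : AEStronglyMeasurable w μ)
    (h : Tendsto (fun k => lpPow p μ (u k - w)) atTop (𝓝 0)) :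
    ∃ φ : ℕ → ℕ, StrictMono φ ∧ ∀ᵐ x ∂μ, Tendsto (fun k => u (φ k) x) atTop (𝓝 (w x)) :=
  (tendstoInMeasure_of_tendsto_eLpNorm (by simpa using hp) hu hw
    (tendsto_eLpNorm_of_tendsto_lpPow hp h)).exists_seq_tendsto_ae

theorem liminf_add_liminf_le_liminf_add (f g : ℕ → ℝ≥0∞) :
    liminf f atTop + liminf g atTop ≤ liminf (fun k => f k + g k) atTop := by
  simp only [liminf_eq_iSup_iInf_of_nat]
  rw [ENNReal.iSup_add_iSup_of_monotone (fun _ _ h => biInf_mono fun _ => h.trans)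
    fun _ _ h => biInf_mono fun _ => h.trans]
  exact iSup_mono fun k => le_iInf₂ fun i hi => add_le_add (iInf₂_le i hi) (iInf₂_le i hi)

theorem tendsto_of_tendsto_div_ofReal {e : ℕ → ℝ≥0∞} {α : ℕ → ℝ} (hα : ∀ k, 0 < α k)
    (hαlim : Tendsto α atTop (𝓝 0))
    (he : Tendsto (fun k => e k / ENNReal.ofReal (α k)) atTop (𝓝 0)) :
    Tendsto e atTop (𝓝 0) := by
  have hmul := ENNReal.Tendsto.mul he (.inr (by simp)) (ENNReal.tendsto_ofReal hαlim)
    (.inr (by simp))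
  simpa only [ENNReal.div_mul_cancel (ENNReal.ofReal_pos.2 (hα _)).ne' ENNReal.ofReal_ne_top,
    ENNReal.ofReal_zero, mul_zero] using hmul

theorem exists_forall_le_of_limsup_ne_top {f : ℕ → ℝ≥0∞} (hf : ∀ k, f k ≠ ⊤)
    (hlim : limsup f atTop ≠ ⊤) : ∃ B : ℝ≥0∞, B ≠ ⊤ ∧ ∀ k, f k ≤ B := by
  obtain ⟨N, hN⟩ := eventually_atTop.1
    (eventually_lt_of_limsup_lt (ENNReal.lt_add_right hlim one_ne_zero))
  refine ⟨limsup f atTop + 1 + ∑ i ∈ Finset.range N, f i,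
    ENNReal.add_ne_top.2 ⟨by finiteness, ENNReal.sum_ne_top.2 fun i _ => hf i⟩, fun k => ?_⟩
  rcases le_or_gt N k with hk | hk
  · exact (hN k hk).le.trans le_self_add
  · exact (Finset.single_le_sum_of_canonicallyOrdered (Finset.mem_range.2 hk)).trans le_add_self

end Sequences

theorem ae_prod_self_of_ae {X : Type*} [MeasurableSpace X] {μ : Measure X} {Q : X → Prop}
    (h : ∀ᵐ x ∂μ, Q x) : ∀ᵐ q ∂(μ.prod μ), Q q.1 ∧ Q q.2 :=
  (Measure.quasiMeasurePreserving_fst.ae h).and (Measure.quasiMeasurePreserving_snd.ae h)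

section FracDiff

variable {E : Type*} [NormedAddCommGroup E] {V : Type*} [NormedAddCommGroup V] [NormedSpace ℝ V]

/-- The vector-valued difference quotient of order `a`, which is linear in the function, unlike its
norm `diffQuot`. -/
noncomputable def fracDiff (a : ℝ) : (E → V) →ₗ[ℝ] E × E → V where
  toFun w q := (‖q.1 - q.2‖ ^ a)⁻¹ • (w q.1 - w q.2)
  map_add' u v := by
    funext q
    simp only [Pi.add_apply, ← smul_add, add_sub_add_comm]
  map_smul' c u := by
    funext q
    simp only [Pi.smul_apply, RingHom.id_apply, ← smul_sub, smul_comm c]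

variable {a p : ℝ}

theorem fracDiff_apply (w : E → V) (q : E × E) :
    fracDiff a w q = (‖q.1 - q.2‖ ^ a)⁻¹ • (w q.1 - w q.2) := rfl

theorem norm_fracDiff (w : E → V) (q : E × E) :
    ‖fracDiff a w q‖ = ‖w q.1 - w q.2‖ / ‖q.1 - q.2‖ ^ a := by
  rw [fracDiff_apply, norm_smul, norm_inv, Real.norm_of_nonneg (by positivity), inv_mul_eq_div]

variable [MeasurableSpace E] {μ : Measure E}

theorem aestronglyMeasurable_fracDiff [BorelSpace E] [SecondCountableTopology E] {w : E → V}
    (hw : AEStronglyMeasurable w μ) : AEStronglyMeasurable (fracDiff a w) (μ.prod μ) :=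
  have hweight : Measurable fun q : E × E => (‖q.1 - q.2‖ ^ a)⁻¹ := by fun_prop
  hweight.aestronglyMeasurable.smul (hw.comp_fst.sub hw.comp_snd)

theorem fracDiff_ae_congr {u w : E → V} (h : u =ᵐ[μ] w) :
    fracDiff a u =ᵐ[μ.prod μ] fracDiff a w := by
  filter_upwards [ae_prod_self_of_ae h] with q hq
  rw [fracDiff_apply, fracDiff_apply, hq.1, hq.2]

theorem ae_tendsto_fracDiff {u : ℕ → E → V} {w : E → V}
    (h : ∀ᵐ x ∂μ, Tendsto (fun k => u k x) atTop (𝓝 (w x))) :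
    ∀ᵐ q ∂(μ.prod μ), Tendsto (fun k => fracDiff a (u k) q) atTop (𝓝 (fracDiff a w q)) := by
  filter_upwards [ae_prod_self_of_ae h] with q hq
  exact (hq.1.sub hq.2).const_smul _

theorem lpPow_fracDiff_le_liminf [BorelSpace E] [SecondCountableTopology E] (hp : 0 < p)
    {ν : Measure (E × E)} (hν : ν ≪ μ.prod μ) {u : ℕ → E → V} {w : E → V}
    (hu : ∀ k, AEStronglyMeasurable (u k) μ) (hw : AEStronglyMeasurable w μ)
    (h : Tendsto (fun k => lpPow p μ (u k - w)) atTop (𝓝 0)) :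
    lpPow p ν (fracDiff a w) ≤ liminf (fun k => lpPow p ν (fracDiff a (u k))) atTop := by
  refine le_liminf_of_forall_subseq fun φ hφ => ?_
  obtain ⟨ψ, hψ, hae⟩ := exists_subseq_ae_tendsto_of_tendsto_lpPow hp (fun k => hu (φ k)) hw
    (h.comp hφ.tendsto_atTop)
  exact ⟨ψ, hψ, lpPow_le_liminf
    (fun k => (aestronglyMeasurable_fracDiff (hu (φ (ψ k)))).mono_ac hν)
    (hν.ae_le (ae_tendsto_fracDiff hae))⟩

end FracDiff

section Wsp

variable {n m : ℕ} {Ω : Set (Space n)} {s p : ℝ}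

/-- The `p`-th power `|w|_{s,p}^p` of the Gagliardo seminorm. -/
noncomputable def gagliardo {V : Type*} [NormedAddCommGroup V] [NormedSpace ℝ V]
    (Ω : Set (Space n)) (s p : ℝ) (w : Space n → V) : ℝ≥0∞ :=
  lpPow p (volSq Ω) (fracDiff ((n : ℝ) / p + s) w)

section Seminorm

variable {V : Type*} [NormedAddCommGroup V] [NormedSpace ℝ V]

theorem gagliardo_neg (w : Space n → V) : gagliardo Ω s p (-w) = gagliardo Ω s p w := by
  simp only [gagliardo, map_neg, lpPow, Pi.neg_apply, enorm_neg]

theorem gagliardo_sub_le (hp : 1 ≤ p) {u w : Space n → V}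
    (hu : AEStronglyMeasurable u (volume.restrict Ω)) :
    gagliardo Ω s p (u - w) ≤ 2 ^ (p - 1) * (gagliardo Ω s p u + gagliardo Ω s p w) := by
  rw [← gagliardo_neg w, sub_eq_add_neg, gagliardo, map_add]
  exact lpPow_add_le hp (aestronglyMeasurable_fracDiff hu)

end Seminorm

theorem lpPow_diffQuot (w : Space n → Mat m) :
    lpPow p (volSq Ω) (diffQuot s p w) = gagliardo Ω s p w :=
  lintegral_congr fun q => by rw [diffQuot, ← norm_fracDiff, enorm_norm]

theorem mem_Wsp_iff (hp : 0 < p) {w : Space n → Mat m} :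
    w ∈ Wsp m Ω s p ↔ AEStronglyMeasurable w (volume.restrict Ω) ∧
      lpPow p (volume.restrict Ω) w < ⊤ ∧ gagliardo Ω s p w < ⊤ := by
  rw [← lpPow_diffQuot]
  change MemLp _ _ _ ∧ MemLp _ _ _ ↔ _
  rw [memLp_iff_lpPow_lt_top hp, memLp_iff_lpPow_lt_top hp, and_assoc]
  exact and_congr_right fun hw => and_congr_right fun _ =>
    and_iff_right (aestronglyMeasurable_diffQuot hw)

theorem Wsp.aestronglyMeasurable (w : Wsp m Ω s p) :
    AEStronglyMeasurable (w : Space n → Mat m) (volume.restrict Ω) := w.2.1.1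

theorem Wsp.gagliardo_ne_top (hp : 0 < p) (w : Wsp m Ω s p) :
    gagliardo Ω s p (w : Space n → Mat m) ≠ ⊤ := ((mem_Wsp_iff hp).1 w.2).2.2.ne

theorem wspNorm_eq (hp : 0 < p) (w : Space n → Mat m) :
    wspNorm Ω s p w =
      ((lpPow p (volume.restrict Ω) w).toReal + (gagliardo Ω s p w).toReal) ^ (1 / p) := by
  rw [wspNorm, ENNReal.toReal_rpow, ENNReal.toReal_rpow, eLpNorm_rpow_eq_lpPow hp,
    eLpNorm_rpow_eq_lpPow hp, lpPow_diffQuot]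

theorem Wsp.exists_gagliardo_uniform_convexity (hp : 1 < p) {ε : ℝ} (hε : 0 < ε) :
    ∃ C : ℝ, 0 ≤ C ∧ ∀ x y : Wsp m Ω s p,
      (gagliardo Ω s p (x - y : Space n → Mat m)).toReal +
          C * (gagliardo Ω s p ((2⁻¹ : ℝ) • (x + y) : Space n → Mat m)).toReal ≤
        (ε + C / 2) * ((gagliardo Ω s p (x : Space n → Mat m)).toReal +
          (gagliardo Ω s p (y : Space n → Mat m)).toReal) := by
  lift ε to NNReal using hε.le
  have hp0 : 0 < p := zero_lt_one.trans hp
  obtain ⟨C, hC⟩ := exists_lpPow_uniform_convexity (V := Mat m) hp (NNReal.coe_pos.1 hε)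
  refine ⟨C, C.2, fun x y => ?_⟩
  have h := hC (volSq Ω) (fracDiff ((n : ℝ) / p + s) (x : Space n → Mat m))
    (fracDiff ((n : ℝ) / p + s) (y : Space n → Mat m))
    (aestronglyMeasurable_fracDiff (Wsp.aestronglyMeasurable x))
    (aestronglyMeasurable_fracDiff (Wsp.aestronglyMeasurable y))
  rw [← map_sub, ← map_add, ← map_smul] at h
  have hsub := Wsp.gagliardo_ne_top hp0 (x - y)
  have hmid := Wsp.gagliardo_ne_top hp0 ((2⁻¹ : ℝ) • (x + y))
  have hx := Wsp.gagliardo_ne_top hp0 x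
  have hy := Wsp.gagliardo_ne_top hp0 y
  simp only [Submodule.coe_sub, Submodule.coe_smul, Submodule.coe_add] at hsub hmid
  simp only [gagliardo] at hsub hmid hx hy ⊢
  have hreal := ENNReal.toReal_mono (by finiteness) h
  rw [ENNReal.toReal_add hsub (by finiteness), ENNReal.toReal_mul, ENNReal.toReal_mul,
    ENNReal.toReal_add hx hy, ENNReal.toReal_add (by finiteness) (by finiteness),
    ENNReal.toReal_div] at hreal
  simpa using hreal

theorem Wsp.convex_eLpNorm_le (hp : 1 ≤ p) (ε : ℝ≥0∞) :
    Convex ℝ {w : Wsp m Ω s p |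
      eLpNorm (w : Space n → Mat m) (ENNReal.ofReal p) (volume.restrict Ω) ≤ ε} := by
  intro w hw w' hw' a b ha hb hab
  calc eLpNorm (a • (w : Space n → Mat m) + b • (w' : Space n → Mat m)) _ (volume.restrict Ω)
      ≤ ‖a‖ₑ * eLpNorm (w : Space n → Mat m) (ENNReal.ofReal p) (volume.restrict Ω) +
          ‖b‖ₑ * eLpNorm (w' : Space n → Mat m) (ENNReal.ofReal p) (volume.restrict Ω) := by
        rw [← eLpNorm_const_smul, ← eLpNorm_const_smul]
        exact eLpNorm_add_le ((Wsp.aestronglyMeasurable w).const_smul a)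
          ((Wsp.aestronglyMeasurable w').const_smul b) (by simpa using hp)
    _ ≤ ‖a‖ₑ * ε + ‖b‖ₑ * ε := by
        gcongr
        exacts [hw, hw']
    _ = ε := by
        rw [← add_mul, Real.enorm_of_nonneg ha, Real.enorm_of_nonneg hb,
          ← ENNReal.ofReal_add ha hb, hab, ENNReal.ofReal_one, one_mul]

theorem Wsp.tendsto_lpPow_of_mem_convexHull (hp : 1 ≤ p) {v x : ℕ → Wsp m Ω s p}
    (hv : Tendsto (fun k => lpPow p (volume.restrict Ω) (v k : Space n → Mat m)) atTop (𝓝 0))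
    (hx : ∀ N, x N ∈ convexHull ℝ (v '' Set.Ici N)) :
    Tendsto (fun N => lpPow p (volume.restrict Ω) (x N : Space n → Mat m)) atTop (𝓝 0) := by
  have hp0 : 0 < p := zero_lt_one.trans_le hp
  refine tendsto_lpPow_of_tendsto_eLpNorm hp0 (ENNReal.tendsto_nhds_zero.2 fun ε hε => ?_)
  obtain ⟨N₀, hN₀⟩ := eventually_atTop.1
    (ENNReal.tendsto_nhds_zero.1 (tendsto_eLpNorm_of_tendsto_lpPow hp0 hv) ε hε)
  filter_upwards [eventually_ge_atTop N₀] with N hN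
  refine convexHull_min ?_ (Wsp.convex_eLpNorm_le hp ε) (hx N)
  rintro _ ⟨k, hk, rfl⟩
  exact hN₀ k (hN.trans hk)

theorem Wsp.gagliardo_le_liminf_sub (hp : 0 < p) {x : ℕ → Wsp m Ω s p}
    (hx : Tendsto (fun N => lpPow p (volume.restrict Ω) (x N : Space n → Mat m)) atTop (𝓝 0))
    (y : Wsp m Ω s p) :
    gagliardo Ω s p (y : Space n → Mat m) ≤
      liminf (fun N => gagliardo Ω s p (y - x N : Space n → Mat m)) atTop := by
  refine lpPow_fracDiff_le_liminf hp .rfl (fun N => Wsp.aestronglyMeasurable (y - x N))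
    (Wsp.aestronglyMeasurable y) ?_
  simpa only [Submodule.coe_sub, sub_sub_cancel_left, lpPow, Pi.neg_apply, enorm_neg] using hx

theorem Wsp.exists_convexHull_tendsto_wspNorm (hp : 1 < p) {v : ℕ → Wsp m Ω s p} {M : ℝ}
    (hv : Tendsto (fun k => lpPow p (volume.restrict Ω) (v k : Space n → Mat m)) atTop (𝓝 0))
    (hM : ∀ k, (gagliardo Ω s p (v k : Space n → Mat m)).toReal ≤ M) :
    ∃ x : ℕ → Wsp m Ω s p, (∀ N, x N ∈ convexHull ℝ (v '' Set.Ici N)) ∧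
      Tendsto (fun N => wspNorm Ω s p (x N : Space n → Mat m)) atTop (𝓝 0) := by
  have hp0 : 0 < p := zero_lt_one.trans hp
  obtain ⟨x, hx, hcauchy⟩ := exists_mem_convex_cauchy
    (P := fun w : Wsp m Ω s p => (gagliardo Ω s p (w : Space n → Mat m)).toReal)
    (S := fun N => convexHull ℝ (v '' Set.Ici N)) (fun _ => ENNReal.toReal_nonneg)
    (fun ε hε => Wsp.exists_gagliardo_uniform_convexity hp hε)
    (fun N N' h => convexHull_mono (Set.image_mono (Set.Ici_subset_Ici.2 h)))
    (fun N => convex_convexHull ℝ _)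
    (fun N => ⟨v N, subset_convexHull ℝ _ ⟨N, Set.self_mem_Ici, rfl⟩, hM N⟩)
  have hx_lp := Wsp.tendsto_lpPow_of_mem_convexHull hp.le hv hx
  have hx_gag : Tendsto (fun N => gagliardo Ω s p (x N : Space n → Mat m)) atTop (𝓝 0) := by
    refine ENNReal.tendsto_nhds_zero.2 fun ε hε => ?_
    obtain ⟨ε', hε'0, hε'⟩ : ∃ ε' : ℝ, 0 < ε' ∧ ENNReal.ofReal ε' ≤ ε := by
      obtain ⟨r, hr0, hr⟩ := ENNReal.lt_iff_exists_nnreal_btwn.1 hε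
      exact ⟨r, by simpa using hr0, by simpa using hr.le⟩
    obtain ⟨N₀, hN₀⟩ := hcauchy ε' hε'0
    filter_upwards [eventually_ge_atTop N₀] with N hN
    refine (Wsp.gagliardo_le_liminf_sub hp0 hx_lp (x N)).trans
      (liminf_le_of_frequently_le' (Eventually.frequently ?_))
    filter_upwards [eventually_ge_atTop N] with N' hN'
    exact ((ENNReal.le_ofReal_iff_toReal_le (Wsp.gagliardo_ne_top hp0 (x N - x N')) hε'0.le).2
      (hN₀ N hN N' hN')).trans hε'
  refine ⟨x, hx, ?_⟩
  have hsum := ((ENNReal.tendsto_toReal ENNReal.zero_ne_top).comp hx_lp).add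
    ((ENNReal.tendsto_toReal ENNReal.zero_ne_top).comp hx_gag)
  have hroot := ((Real.continuous_rpow_const (by positivity : 0 ≤ 1 / p)).tendsto _).comp hsum
  simpa [Function.comp_def, wspNorm_eq hp0, Real.zero_rpow (inv_ne_zero hp0.ne')] using hroot

theorem Wsp.eventually_functional_lt (hp : 1 < p) {v : ℕ → Wsp m Ω s p} {M : ℝ}
    (hv : Tendsto (fun k => lpPow p (volume.restrict Ω) (v k : Space n → Mat m)) atTop (𝓝 0))
    (hM : ∀ k, (gagliardo Ω s p (v k : Space n → Mat m)).toReal ≤ M) (f : Wsp m Ω s p →ₗ[ℝ] ℝ)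
    (hf : ∃ C : ℝ, ∀ w : Wsp m Ω s p, |f w| ≤ C * wspNorm Ω s p (w : Space n → Mat m))
    {ε : ℝ} (hε : 0 < ε) : ∀ᶠ k in atTop, f (v k) < ε := by
  by_contra hcon
  simp only [not_eventually, not_lt] at hcon
  obtain ⟨φ, hφ, hεf⟩ := extraction_of_frequently_atTop hcon
  obtain ⟨x, hx, hx0⟩ := Wsp.exists_convexHull_tendsto_wspNorm hp (v := v ∘ φ)
    (hv.comp hφ.tendsto_atTop) fun k => hM (φ k)
  have hεx : ∀ N, ε ≤ f (x N) := fun N => by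
    refine convexHull_min ?_ (convex_halfSpace_ge f.isLinear ε) (hx N)
    rintro _ ⟨k, -, rfl⟩
    exact hεf k
  obtain ⟨C, hC⟩ := hf
  have hlim : Tendsto (fun N => C * wspNorm Ω s p (x N : Space n → Mat m)) atTop (𝓝 0) := by
    simpa using hx0.const_mul C
  exact hε.not_ge (ge_of_tendsto' hlim fun N => (hεx N).trans ((le_abs_self _).trans (hC (x N))))

theorem Wsp.tendsto_functional_zero (hp : 1 < p) {v : ℕ → Wsp m Ω s p} {M : ℝ}
    (hv : Tendsto (fun k => lpPow p (volume.restrict Ω) (v k : Space n → Mat m)) atTop (𝓝 0))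
    (hM : ∀ k, (gagliardo Ω s p (v k : Space n → Mat m)).toReal ≤ M) (f : Wsp m Ω s p →ₗ[ℝ] ℝ)
    (hf : ∃ C : ℝ, ∀ w : Wsp m Ω s p, |f w| ≤ C * wspNorm Ω s p (w : Space n → Mat m)) :
    Tendsto (fun k => f (v k)) atTop (𝓝 0) := by
  refine tendsto_order.2 ⟨fun ε hε => ?_, fun ε hε =>
    Wsp.eventually_functional_lt hp hv hM f hf hε⟩
  have hneg := Wsp.eventually_functional_lt hp hv hM (-f) (by simpa using hf) (neg_pos.2 hε)
  simpa only [LinearMap.neg_apply, neg_lt_neg_iff] using hneg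

theorem weakTendsto_of_tendsto_lpPow (hp : 1 < p) {u : ℕ → Space n → Mat m} {w : Space n → Mat m}
    (hu : ∀ k, u k ∈ Wsp m Ω s p) (hw : w ∈ Wsp m Ω s p)
    (hlim : Tendsto (fun k => lpPow p (volume.restrict Ω) (u k - w)) atTop (𝓝 0))
    {M : ℝ≥0∞} (hMtop : M ≠ ⊤) (hM : ∀ k, gagliardo Ω s p (u k) ≤ M) :
    WeakTendsto Ω s p u w := by
  refine ⟨hu, hw, fun f hf => ?_⟩
  have hp0 : 0 < p := zero_lt_one.trans hp
  have hw_gag := ((mem_Wsp_iff hp0).1 hw).2.2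
  have hbound : ∀ k, gagliardo Ω s p (u k - w) ≤ 2 ^ (p - 1) * (M + gagliardo Ω s p w) :=
    fun k => (gagliardo_sub_le hp.le (hu k).1.1).trans (by gcongr; exact hM k)
  have htop : (2 : ℝ≥0∞) ^ (p - 1) * (M + gagliardo Ω s p w) ≠ ⊤ :=
    ENNReal.mul_ne_top (ENNReal.rpow_ne_top_of_nonneg (by linarith) (by simp)) (by finiteness)
  let v : ℕ → Wsp m Ω s p := fun k => ⟨u k, hu k⟩ - ⟨w, hw⟩
  have hv : ∀ k, (v k : Space n → Mat m) = u k - w := fun _ => rfl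
  have hzero : Tendsto (fun k => f (v k)) atTop (𝓝 0) :=
    Wsp.tendsto_functional_zero hp (by simpa only [hv] using hlim)
      (fun k => ENNReal.toReal_mono htop ((congrArg _ (hv k)).trans_le (hbound k))) f hf
  simpa only [v, map_sub, tendsto_sub_nhds_zero_iff] using hzero

theorem Wsp.integrable [IsFiniteMeasure (volume.restrict Ω)] (hp : 1 ≤ p) (w : Wsp m Ω s p) :
    Integrable (w : Space n → Mat m) (volume.restrict Ω) :=
  w.2.1.integrable (by simpa using hp)

theorem Wsp.integrable_coord [IsFiniteMeasure (volume.restrict Ω)] (hp : 1 ≤ p) (w : Wsp m Ω s p)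
    (i : Fin m × Fin m) :
    Integrable (fun x => (w : Space n → Mat m) x i) (volume.restrict Ω) :=
  (EuclideanSpace.proj (𝕜 := ℝ) i).integrable_comp (Wsp.integrable hp w)

/-- Integration of one coordinate over a set: the bounded functionals that identify weak limits. -/
noncomputable def Wsp.integralCoord [IsFiniteMeasure (volume.restrict Ω)] (hp : 1 ≤ p)
    (i : Fin m × Fin m) (A : Set (Space n)) : Wsp m Ω s p →ₗ[ℝ] ℝ where
  toFun w := ∫ x in A, (w : Space n → Mat m) x i ∂(volume.restrict Ω)
  map_add' w w' :=
    integral_add (Wsp.integrable_coord hp w i).integrableOn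
      (Wsp.integrable_coord hp w' i).integrableOn
  map_smul' c _ := integral_const_mul c _

theorem eLpNorm_toReal_le_wspNorm (hp : 0 < p) (w : Space n → Mat m) :
    (eLpNorm w (ENNReal.ofReal p) (volume.restrict Ω)).toReal ≤ wspNorm Ω s p w := by
  rw [wspNorm, one_div, Real.le_rpow_inv_iff_of_pos ENNReal.toReal_nonneg (by positivity) hp]
  exact le_add_of_nonneg_right (by positivity)

theorem Wsp.exists_abs_integralCoord_le [IsFiniteMeasure (volume.restrict Ω)] (hp : 1 ≤ p)
    (i : Fin m × Fin m) (A : Set (Space n)) :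
    ∃ C : ℝ, ∀ w : Wsp m Ω s p,
      |Wsp.integralCoord hp i A w| ≤ C * wspNorm Ω s p (w : Space n → Mat m) := by
  have hp0 : 0 < p := zero_lt_one.trans_le hp
  have hp1 : (1 : ℝ≥0∞) ≤ ENNReal.ofReal p := by simpa using hp
  set c : ℝ≥0∞ := (volume.restrict Ω) Set.univ ^
    (1 / (1 : ℝ≥0∞).toReal - 1 / (ENNReal.ofReal p).toReal)
  have hc : c ≠ ⊤ := by
    refine ENNReal.rpow_ne_top_of_nonneg ?_ (measure_ne_top _ _)
    rw [ENNReal.toReal_one, ENNReal.toReal_ofReal hp0.le, div_one, sub_nonneg, div_le_one hp0]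
    exact hp
  refine ⟨c.toReal, fun w => ?_⟩
  calc |Wsp.integralCoord hp i A w|
      ≤ ∫ x in A, ‖(w : Space n → Mat m) x i‖ ∂(volume.restrict Ω) :=
        norm_integral_le_integral_norm (fun x => (w : Space n → Mat m) x i)
    _ ≤ ∫ x, ‖(w : Space n → Mat m) x i‖ ∂(volume.restrict Ω) :=
        setIntegral_le_integral (Wsp.integrable_coord hp w i).norm
          (.of_forall fun _ => norm_nonneg _)
    _ ≤ ∫ x, ‖(w : Space n → Mat m) x‖ ∂(volume.restrict Ω) :=
        integral_mono (Wsp.integrable_coord hp w i).norm (Wsp.integrable hp w).norm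
          fun x => PiLp.norm_apply_le _ i
    _ = (eLpNorm (w : Space n → Mat m) 1 (volume.restrict Ω)).toReal := by
        rw [integral_norm_eq_lintegral_enorm (Wsp.aestronglyMeasurable w),
          eLpNorm_one_eq_lintegral_enorm]
    _ ≤ (eLpNorm (w : Space n → Mat m) (ENNReal.ofReal p) (volume.restrict Ω) * c).toReal :=
        ENNReal.toReal_mono (ENNReal.mul_ne_top w.2.1.2.ne hc)
          (eLpNorm_le_eLpNorm_mul_rpow_measure_univ hp1 (Wsp.aestronglyMeasurable w))
    _ ≤ c.toReal * wspNorm Ω s p (w : Space n → Mat m) := by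
        rw [ENNReal.toReal_mul, mul_comm]
        gcongr
        exact eLpNorm_toReal_le_wspNorm hp0 _

theorem WeakTendsto.ae_unique [IsFiniteMeasure (volume.restrict Ω)] (hp : 1 ≤ p)
    {u : ℕ → Space n → Mat m} {w w' : Space n → Mat m} (h : WeakTendsto Ω s p u w)
    (h' : WeakTendsto Ω s p u w') : w =ᵐ[volume.restrict Ω] w' := by
  obtain ⟨hu, hw, hlim⟩ := h
  obtain ⟨_, hw', hlim'⟩ := h'
  have hcoord : ∀ i, (fun x => w x i) =ᵐ[volume.restrict Ω] fun x => w' x i := fun i => by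
    refine (Wsp.integrable_coord hp ⟨w, hw⟩ i).ae_eq_of_forall_setIntegral_eq _ _
      (Wsp.integrable_coord hp ⟨w', hw'⟩ i) fun A _ _ => ?_
    have hbound := Wsp.exists_abs_integralCoord_le hp i A (s := s) (Ω := Ω)
    exact tendsto_nhds_unique (hlim _ hbound) (hlim' _ hbound)
  filter_upwards [ae_all_iff.2 hcoord] with x hx
  ext i
  exact hx i

end Wsp

section Oscillation

variable {V : Type*} [NormedAddCommGroup V] [NormedSpace ℝ V] {p : ℝ}

theorem enorm_sub_average_rpow_le {X : Type*} [MeasurableSpace X] [CompleteSpace V] (hp : 1 ≤ p)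
    {ν : Measure X} [IsFiniteMeasure ν] [NeZero ν] {u : X → V} (hu : Integrable u ν) (c : V) :
    ‖c - ⨍ y, u y ∂ν‖ₑ ^ p ≤ ⨍⁻ y, ‖c - u y‖ₑ ^ p ∂ν := by
  have hu' : Integrable u ((ν Set.univ)⁻¹ • ν) := hu.to_average
  have hdiff : c - ⨍ y, u y ∂ν = ⨍ y, (c - u y) ∂ν := by
    rw [average, average, integral_sub (integrable_const _) hu', integral_const, probReal_univ,
      one_smul]
  calc ‖c - ⨍ y, u y ∂ν‖ₑ ^ p
      ≤ eLpNorm (fun y => c - u y) (ENNReal.ofReal p) ((ν Set.univ)⁻¹ • ν) ^ p := by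
        gcongr
        rw [hdiff]
        refine (enorm_integral_le_lintegral_enorm _).trans ?_
        rw [← eLpNorm_one_eq_lintegral_enorm]
        exact eLpNorm_le_eLpNorm_of_exponent_le (by simpa using hp)
          (aestronglyMeasurable_const.sub hu'.1)
    _ = ⨍⁻ y, ‖c - u y‖ₑ ^ p ∂ν := eLpNorm_rpow_eq_lpPow (zero_lt_one.trans_le hp) _

theorem lpPow_sub_average_le {X : Type*} [MeasurableSpace X] [CompleteSpace V] (hp : 1 ≤ p)
    {ν : Measure X} [IsFiniteMeasure ν] [NeZero ν] {u : X → V} (hu : Integrable u ν) :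
    lpPow p ν (u - fun _ => ⨍ y, u y ∂ν) ≤
      (ν Set.univ)⁻¹ * ∫⁻ q, ‖u q.1 - u q.2‖ₑ ^ p ∂(ν.prod ν) := by
  have hmeas : AEMeasurable (fun q : X × X => ‖u q.1 - u q.2‖ₑ ^ p) (ν.prod ν) :=
    (hu.1.comp_fst.sub hu.1.comp_snd).enorm.pow_const p
  rw [lintegral_prod _ hmeas, ← lintegral_const_mul' _ _
    (ENNReal.inv_ne_top.2 (by simpa using NeZero.ne ν))]
  refine lintegral_mono fun x => (enorm_sub_average_rpow_le hp hu (u x)).trans_eq ?_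
  rw [laverage_eq, ENNReal.div_eq_inv_mul]

theorem enorm_sub_rpow_le_mul_enorm_fracDiff {E : Type*} [NormedAddCommGroup E] {a δ : ℝ}
    (hp : 0 ≤ p) (ha : 0 ≤ a) (u : E → V) {x y : E} (h : ‖x - y‖ ≤ δ) :
    ‖u x - u y‖ₑ ^ p ≤ ENNReal.ofReal (δ ^ (a * p)) * ‖fracDiff a u (x, y)‖ₑ ^ p := by
  have hδ : 0 ≤ δ := (norm_nonneg _).trans h
  have hnorm : ‖u x - u y‖ ≤ δ ^ a * ‖fracDiff a u (x, y)‖ := by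
    rw [norm_fracDiff]
    obtain rfl | hxy := eq_or_ne x y
    · rw [sub_self, norm_zero]
      positivity
    · have : 0 < ‖x - y‖ := norm_sub_pos_iff.2 hxy
      calc ‖u x - u y‖ = ‖x - y‖ ^ a * (‖u x - u y‖ / ‖x - y‖ ^ a) := by field_simp
        _ ≤ δ ^ a * (‖u x - u y‖ / ‖x - y‖ ^ a) := by gcongr
  rw [Real.rpow_mul hδ, ← ENNReal.ofReal_rpow_of_nonneg (by positivity) hp,
    ← ENNReal.mul_rpow_of_nonneg _ _ hp]
  gcongr
  rw [← ofReal_norm, ← ofReal_norm, ← ENNReal.ofReal_mul (by positivity)]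
  exact ENNReal.ofReal_le_ofReal hnorm

variable {n : ℕ} {Ω : Set (Space n)} {s : ℝ}

/-- The constant of the fractional Poincaré inequality on balls of radius at most `R`. -/
noncomputable def poincareConst (n : ℕ) (s p R : ℝ) : ℝ≥0∞ :=
  ENNReal.ofReal (2 ^ ((n : ℝ) + p * s) * R ^ (p * s)) / volume (Metric.ball (0 : Space n) 1)

theorem tendsto_poincareConst (n : ℕ) (hs : 0 < s) (hp : 0 < p) :
    Tendsto (poincareConst n s p) (𝓝 0) (𝓝 0) := by
  have hps : 0 < p * s := by positivity
  have hnum : Tendsto (fun R : ℝ => (2 : ℝ) ^ ((n : ℝ) + p * s) * R ^ (p * s)) (𝓝 0) (𝓝 0) := by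
    simpa [Real.zero_rpow hps.ne'] using
      ((Real.continuous_rpow_const hps.le).tendsto 0).const_mul ((2 : ℝ) ^ ((n : ℝ) + p * s))
  have hdiv := ENNReal.Tendsto.div_const (ENNReal.tendsto_ofReal hnum)
    (b := volume (Metric.ball (0 : Space n) 1)) (Or.inr (Metric.measure_ball_pos _ _ one_pos).ne')
  rwa [ENNReal.ofReal_zero, ENNReal.zero_div] at hdiv

theorem inv_volume_closedBall_mul_le_poincareConst (hs : 0 ≤ s) (hp : 0 ≤ p) (x : Space n)
    {r R : ℝ} (hr : 0 < r) (hrR : r ≤ R) :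
    (volume (Metric.closedBall x r))⁻¹ * ENNReal.ofReal ((2 * r) ^ ((n : ℝ) + p * s)) ≤
      poincareConst n s p R := by
  have hball : volume (Metric.ball (0 : Space n) 1) ≠ 0 :=
    (Metric.measure_ball_pos _ _ one_pos).ne'
  have hball' : volume (Metric.ball (0 : Space n) 1) ≠ ⊤ := measure_ball_lt_top.ne
  rw [Measure.addHaar_closedBall volume x hr.le, poincareConst, finrank_euclideanSpace_fin,
    ENNReal.mul_inv (Or.inr hball') (Or.inr hball), mul_right_comm, ← div_eq_mul_inv,
    ← ENNReal.ofReal_inv_of_pos (by positivity), ← ENNReal.ofReal_mul (by positivity)]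
  refine ENNReal.div_le_div_right (ENNReal.ofReal_le_ofReal ?_) _
  calc (r ^ n)⁻¹ * (2 * r) ^ ((n : ℝ) + p * s)
      = 2 ^ ((n : ℝ) + p * s) * r ^ (p * s) := by
        rw [Real.mul_rpow zero_le_two hr.le, Real.rpow_add hr, Real.rpow_natCast]
        field_simp
    _ ≤ 2 ^ ((n : ℝ) + p * s) * R ^ (p * s) := by gcongr

theorem lpPow_sub_average_closedBall_le [CompleteSpace V] (hp : 1 ≤ p) (hs : 0 ≤ s)
    {u : Space n → V} {x : Space n} {r R : ℝ} (hr : 0 < r) (hrR : r ≤ R)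
    (hu : IntegrableOn u (Metric.closedBall x r)) :
    lpPow p (volume.restrict (Metric.closedBall x r))
        (u - fun _ => ⨍ y in Metric.closedBall x r, u y) ≤
      poincareConst n s p R * gagliardo (Metric.closedBall x r) s p u := by
  have hp0 : 0 < p := zero_lt_one.trans_le hp
  set B := Metric.closedBall x r
  have : NeZero (volume.restrict B) :=
    ⟨by simpa using (Metric.measure_closedBall_pos volume x hr).ne'⟩
  have : IsFiniteMeasure (volume.restrict B) := ⟨by simpa using measure_closedBall_lt_top⟩
  have hincrement : ∫⁻ q, ‖u q.1 - u q.2‖ₑ ^ p ∂(volSq B) ≤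
      ENNReal.ofReal ((2 * r) ^ ((n : ℝ) + p * s)) * gagliardo B s p u := by
    rw [gagliardo, lpPow, ← lintegral_const_mul' _ _ ENNReal.ofReal_ne_top]
    refine lintegral_mono_ae ?_
    filter_upwards [ae_prod_self_of_ae (ae_restrict_mem Metric.isClosed_closedBall.measurableSet)]
      with q hq
    have hdist : ‖q.1 - q.2‖ ≤ 2 * r := by
      rw [← dist_eq_norm]
      linarith [dist_triangle_right q.1 q.2 x, Metric.mem_closedBall.1 hq.1,
        Metric.mem_closedBall.1 hq.2]
    convert enorm_sub_rpow_le_mul_enorm_fracDiff hp0.le (by positivity : 0 ≤ (n : ℝ) / p + s) u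
      hdist using 4
    field_simp
  calc lpPow p (volume.restrict B) (u - fun _ => ⨍ y in B, u y)
      ≤ (volume B)⁻¹ *
          (ENNReal.ofReal ((2 * r) ^ ((n : ℝ) + p * s)) * gagliardo B s p u) := by
        refine (lpPow_sub_average_le hp hu).trans ?_
        rw [Measure.restrict_apply_univ]
        gcongr
    _ ≤ poincareConst n s p R * gagliardo B s p u := by
        rw [← mul_assoc]
        gcongr
        exact inv_volume_closedBall_mul_le_poincareConst hs hp0.le x hr hrR

end Oscillation

section BallPartition

variable {n : ℕ} {Ω : Set (Space n)} {R : ℝ}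

/-- A partition, up to a null set, of `Ω` into disjoint closed balls of radius at most `R`. -/
structure BallPartition (Ω : Set (Space n)) (R : ℝ) where
  centers : Set (Space n)
  radius : Space n → ℝ
  countable_centers : centers.Countable
  radius_pos : ∀ x ∈ centers, 0 < radius x
  radius_le : ∀ x ∈ centers, radius x ≤ R
  closedBall_subset : ∀ x ∈ centers, Metric.closedBall x (radius x) ⊆ Ω
  pairwiseDisjoint : centers.PairwiseDisjoint fun x => Metric.closedBall x (radius x)
  measure_diff : volume (Ω \ ⋃ x ∈ centers, Metric.closedBall x (radius x)) = 0

theorem nonempty_ballPartition (hΩ : IsOpen Ω) (hR : 0 < R) : Nonempty (BallPartition Ω R) := by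
  obtain ⟨t, r, htc, -, hr, hcover, hdisj⟩ := Besicovitch.exists_disjoint_closedBall_covering_ae
    (volume : Measure (Space n)) (fun x => {r | Metric.closedBall x r ⊆ Ω}) Ω (fun x hx δ hδ => by
      obtain ⟨ε, hε, hball⟩ := Metric.nhds_basis_closedBall.mem_iff.1 (hΩ.mem_nhds hx)
      exact ⟨min ε (δ / 2), (Metric.closedBall_subset_closedBall (min_le_left _ _)).trans hball,
        lt_min hε (half_pos hδ), (min_le_right _ _).trans_lt (half_lt_self hδ)⟩)
    (fun _ => R) (fun _ _ => hR)
  exact ⟨⟨t, r, htc, fun x hx => (hr x hx).2.1, fun x hx => (hr x hx).2.2.le,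
    fun x hx => (hr x hx).1, hdisj, hcover⟩⟩

namespace BallPartition

variable (P : BallPartition Ω R)

/-- The balls of the partition. -/
def cell (x : P.centers) : Set (Space n) := Metric.closedBall x (P.radius x)

instance : Countable P.centers := P.countable_centers.to_subtype

theorem measurableSet_cell (x : P.centers) : MeasurableSet (P.cell x) :=
  Metric.isClosed_closedBall.measurableSet

theorem cell_subset (x : P.centers) : P.cell x ⊆ Ω := P.closedBall_subset x x.2

theorem volume_cell_ne_zero (x : P.centers) : volume (P.cell x) ≠ 0 :=
  (Metric.measure_closedBall_pos _ _ (P.radius_pos x x.2)).ne'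

theorem volume_cell_ne_top (x : P.centers) : volume (P.cell x) ≠ ⊤ := measure_closedBall_lt_top.ne

theorem pairwise_disjoint_cell : Pairwise (Function.onFun Disjoint P.cell) :=
  fun x y hxy => P.pairwiseDisjoint x.2 y.2 fun h => hxy (Subtype.ext h)

theorem restrict_iUnion_cell : volume.restrict (⋃ x, P.cell x) = volume.restrict Ω := by
  refine Measure.restrict_congr_set (ae_eq_set.2 ⟨?_, ?_⟩)
  · rw [Set.sdiff_eq_empty.2 (Set.iUnion_subset P.cell_subset), measure_empty]
  · rw [← P.measure_diff, Set.biUnion_eq_iUnion]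
    rfl

theorem tsum_volume_cell_le : ∑' x, volume (P.cell x) ≤ volume Ω := by
  rw [← measure_iUnion P.pairwise_disjoint_cell P.measurableSet_cell]
  exact measure_mono (Set.iUnion_subset P.cell_subset)

variable {V : Type*} [NormedAddCommGroup V] {p : ℝ}

theorem lpPow_eq_tsum (f : Space n → V) :
    lpPow p (volume.restrict Ω) f = ∑' x, lpPow p (volume.restrict (P.cell x)) f := by
  rw [← P.restrict_iUnion_cell]
  exact lintegral_iUnion P.measurableSet_cell P.pairwise_disjoint_cell _

variable [NormedSpace ℝ V] {s : ℝ}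

theorem tsum_gagliardo_cell_le (u : Space n → V) :
    ∑' x, gagliardo (P.cell x) s p u ≤ gagliardo Ω s p u := by
  simp only [gagliardo, volSq, Measure.prod_restrict]
  refine (lintegral_iUnion (fun x => (P.measurableSet_cell x).prod (P.measurableSet_cell x))
    (fun x y hxy => Set.disjoint_prod.2 (Or.inl (P.pairwise_disjoint_cell hxy))) _).symm.trans_le ?_
  exact lintegral_mono_set
    (Set.iUnion_subset fun x => Set.prod_mono (P.cell_subset x) (P.cell_subset x))

/-- Both terms on the right are small when `R` is small and the averages over the cells are small:
this is what replaces the Rellich-Kondrachov theorem. -/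
theorem lpPow_le [CompleteSpace V] (hp : 1 ≤ p) (hs : 0 ≤ s) {u : Space n → V}
    (hu : IntegrableOn u Ω) :
    lpPow p (volume.restrict Ω) u ≤ 2 ^ (p - 1) * (poincareConst n s p R * gagliardo Ω s p u +
      ∑' x, ‖⨍ y in P.cell x, u y‖ₑ ^ p * volume (P.cell x)) := by
  have hu_cell : ∀ x, IntegrableOn u (P.cell x) := fun x => hu.mono_set (P.cell_subset x)
  calc lpPow p (volume.restrict Ω) u
      = ∑' x, lpPow p (volume.restrict (P.cell x)) u := P.lpPow_eq_tsum u
    _ ≤ ∑' x, 2 ^ (p - 1) * (poincareConst n s p R * gagliardo (P.cell x) s p u +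
          ‖⨍ y in P.cell x, u y‖ₑ ^ p * volume (P.cell x)) := by
        refine ENNReal.tsum_le_tsum fun x => ?_
        rw [← sub_add_cancel u fun _ => ⨍ y in P.cell x, u y]
        refine (lpPow_add_le hp ((hu_cell x).1.sub aestronglyMeasurable_const)).trans ?_
        rw [sub_add_cancel]
        gcongr
        · exact lpPow_sub_average_closedBall_le hp hs (P.radius_pos x x.2) (P.radius_le x x.2)
            (hu_cell x)
        · rw [lpPow, lintegral_const, Measure.restrict_apply_univ]
    _ = 2 ^ (p - 1) * (poincareConst n s p R * ∑' x, gagliardo (P.cell x) s p u +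
          ∑' x, ‖⨍ y in P.cell x, u y‖ₑ ^ p * volume (P.cell x)) := by
        rw [ENNReal.tsum_mul_left, ENNReal.tsum_add, ENNReal.tsum_mul_left]
    _ ≤ _ := by
        gcongr
        exact P.tsum_gagliardo_cell_le u

end BallPartition

end BallPartition

section Compactness

variable {V : Type*} [NormedAddCommGroup V] [NormedSpace ℝ V]

theorem setAverage_mem_closedBall {X : Type*} [MeasurableSpace X] {μ : Measure X} [CompleteSpace V]
    {A : Set X} (hA : μ A ≠ 0) (hA' : μ A ≠ ⊤) {u : X → V} (hu : IntegrableOn u A μ) {M : ℝ}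
    (hM : ∀ᵐ x ∂(μ.restrict A), ‖u x‖ ≤ M) : ⨍ x in A, u x ∂μ ∈ Metric.closedBall (0 : V) M :=
  (convex_closedBall (0 : V) M).set_average_mem Metric.isClosed_closedBall hA hA'
    (hM.mono fun x hx => by simpa using hx) hu

theorem exists_subseq_tendsto_setAverage {X ι : Type*} [MeasurableSpace X] [Countable ι]
    [ProperSpace V] {μ : Measure X} {A : ι → Set X} (hA : ∀ i, μ (A i) ≠ 0)
    (hA' : ∀ i, μ (A i) ≠ ⊤) {u : ℕ → X → V} (hu : ∀ k i, IntegrableOn (u k) (A i) μ) {M : ℝ}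
    (hM : ∀ k i, ∀ᵐ x ∂(μ.restrict (A i)), ‖u k x‖ ≤ M) :
    ∃ φ : ℕ → ℕ, StrictMono φ ∧
      ∀ i, ∃ c, Tendsto (fun k => ⨍ x in A i, u (φ k) x ∂μ) atTop (𝓝 c) := by
  obtain ⟨c, -, φ, hφ, hlim⟩ :=
    (isCompact_univ_pi fun _ : ι => isCompact_closedBall (0 : V) M).tendsto_subseq
      (x := fun k i => ⨍ x in A i, u k x ∂μ)
      fun k i _ => setAverage_mem_closedBall (hA i) (hA' i) (hu k i) (hM k i)
  exact ⟨φ, hφ, fun i => ⟨c i, tendsto_pi_nhds.1 hlim i⟩⟩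

theorem tendsto_tsum_mul_zero {ι κ : Type*} {l : Filter κ} [l.IsCountablyGenerated]
    {a : ι → ℝ≥0∞} (ha : ∑' i, a i ≠ ⊤) {b : κ → ι → ℝ≥0∞} {M : ℝ≥0∞} (hM : M ≠ ⊤)
    (hb : ∀ k i, b k i ≤ M) (hlim : ∀ i, Tendsto (fun k => b k i) l (𝓝 0)) :
    Tendsto (fun k => ∑' i, b k i * a i) l (𝓝 0) := by
  let _ : MeasurableSpace ι := ⊤
  have hcount := tendsto_lintegral_filter_of_dominated_convergence (μ := Measure.count) (l := l)
    (F := fun k i => b k i * a i) (f := fun _ => 0) (fun i => M * a i)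
    (.of_forall fun k => measurable_from_top)
    (.of_forall fun k => .of_forall fun i => mul_le_mul_left (hb k i) (a i))
    (by rw [lintegral_count, ENNReal.tsum_mul_left]; finiteness)
    (.of_forall fun i => by
      simpa using ENNReal.Tendsto.mul_const (hlim i)
        (Or.inr (ne_top_of_le_ne_top ha (ENNReal.le_tsum i))))
  simpa [lintegral_count] using hcount

variable {n : ℕ} {Ω : Set (Space n)} {s p : ℝ} {u : ℕ → Space n → V} {M : ℝ}

theorem BallPartition.tendsto_tsum_average_sub [CompleteSpace V] {R : ℝ} (P : BallPartition Ω R)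
    (hΩ : volume Ω ≠ ⊤) (hp : 0 < p) (hu : ∀ k, IntegrableOn (u k) Ω)
    (hM : ∀ k, ∀ᵐ x ∂(volume.restrict Ω), ‖u k x‖ ≤ M)
    (hlim : ∀ x, ∃ c, Tendsto (fun k => ⨍ y in P.cell x, u k y) atTop (𝓝 c)) :
    Tendsto (fun q : ℕ × ℕ =>
      ∑' x, ‖⨍ y in P.cell x, (u q.1 - u q.2) y‖ₑ ^ p * volume (P.cell x)) atTop (𝓝 0) := by
  have hu_cell : ∀ k x, IntegrableOn (u k) (P.cell x) := fun k x =>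
    (hu k).mono_set (P.cell_subset x)
  have hM_cell : ∀ k x, ∀ᵐ y ∂(volume.restrict (P.cell x)), ‖u k y‖ ≤ M := fun k x =>
    ae_restrict_of_ae_restrict_of_subset (P.cell_subset x) (hM k)
  refine tendsto_tsum_mul_zero (ne_top_of_le_ne_top hΩ P.tsum_volume_cell_le)
    (M := ENNReal.ofReal (M + M) ^ p) (by finiteness) (fun q x => ?_) fun x => ?_
  · have hdiff := setAverage_mem_closedBall (P.volume_cell_ne_zero x) (P.volume_cell_ne_top x)
      ((hu_cell q.1 x).sub (hu_cell q.2 x)) (M := M + M) (by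
        filter_upwards [hM_cell q.1 x, hM_cell q.2 x] with y hy hy'
        exact norm_sub_le_of_le hy hy')
    gcongr
    rw [← ofReal_norm]
    exact ENNReal.ofReal_le_ofReal (mem_closedBall_zero_iff.1 hdiff)
  · obtain ⟨c, hc⟩ := hlim x
    have hsub : Tendsto (fun q : ℕ × ℕ => ⨍ y in P.cell x, (u q.1 - u q.2) y) atTop (𝓝 0) := by
      rw [← prod_atTop_atTop_eq, ← sub_self c]
      refine ((hc.comp tendsto_fst).sub (hc.comp tendsto_snd)).congr fun q => ?_
      simp only [Function.comp_apply, setAverage_eq, Pi.sub_apply, ← smul_sub]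
      rw [integral_sub (hu_cell q.1 x) (hu_cell q.2 x)]
    simpa [hp] using hsub.enorm.ennrpow_const p

theorem tendsto_lpPow_sub_of_tendsto_average [CompleteSpace V] (hp : 1 ≤ p) (hs : 0 < s)
    (hΩ : volume Ω ≠ ⊤) (P : ∀ j : ℕ, BallPartition Ω (1 / ((j : ℝ) + 1)))
    (hu : ∀ k, IntegrableOn (u k) Ω) (hM : ∀ k, ∀ᵐ x ∂(volume.restrict Ω), ‖u k x‖ ≤ M)
    {B : ℝ≥0∞} (hBtop : B ≠ ⊤) (hB : ∀ k, gagliardo Ω s p (u k) ≤ B)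
    (hlim : ∀ j x, ∃ c, Tendsto (fun k => ⨍ y in (P j).cell x, u k y) atTop (𝓝 c)) :
    Tendsto (fun q : ℕ × ℕ => lpPow p (volume.restrict Ω) (u q.1 - u q.2)) atTop (𝓝 0) := by
  have hp0 : 0 < p := zero_lt_one.trans_le hp
  have htwo : (2 : ℝ≥0∞) ^ (p - 1) ≠ ⊤ := ENNReal.rpow_ne_top_of_nonneg (by linarith) (by simp)
  set B' : ℝ≥0∞ := 2 ^ (p - 1) * (B + B)
  have hB' : B' ≠ ⊤ := by finiteness
  have hgag : ∀ q : ℕ × ℕ, gagliardo Ω s p (u q.1 - u q.2) ≤ B' := fun q =>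
    (gagliardo_sub_le hp (hu q.1).1).trans (mul_le_mul_right (add_le_add (hB _) (hB _)) _)
  have hsmall : Tendsto (fun j : ℕ => 2 ^ (p - 1) * (poincareConst n s p (1 / ((j : ℝ) + 1)) * B'))
      atTop (𝓝 0) := by
    have hconst := (tendsto_poincareConst n hs hp0).comp tendsto_one_div_add_atTop_nhds_zero_nat
    simpa using ENNReal.Tendsto.const_mul (ENNReal.Tendsto.mul_const hconst (Or.inr hB'))
      (Or.inr htwo)
  refine ENNReal.tendsto_nhds_zero.2 fun ε hε => ?_
  obtain ⟨j, hj⟩ := (hsmall.eventually_lt_const hε).exists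
  have haverage := ENNReal.Tendsto.const_mul (((P j).tendsto_tsum_average_sub hΩ hp0 hu hM
    (hlim j)).const_add (poincareConst n s p (1 / ((j : ℝ) + 1)) * B')) (Or.inr htwo)
  rw [add_zero] at haverage
  filter_upwards [haverage.eventually_lt_const hj] with q hq
  refine ((P j).lpPow_le hp hs.le ((hu q.1).sub (hu q.2))).trans (le_trans ?_ hq.le)
  gcongr
  exact hgag q

theorem exists_tendsto_lpPow_of_tendsto_sub {X : Type*} [MeasurableSpace X] {μ : Measure X}
    {W : Type*} [NormedAddCommGroup W] [CompleteSpace W] (hp : 1 ≤ p) {u : ℕ → X → W}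
    (hu : ∀ k, MemLp (u k) (ENNReal.ofReal p) μ)
    (h : Tendsto (fun q : ℕ × ℕ => lpPow p μ (u q.1 - u q.2)) atTop (𝓝 0)) :
    ∃ w, AEStronglyMeasurable w μ ∧ Tendsto (fun k => lpPow p μ (u k - w)) atTop (𝓝 0) := by
  have hp0 : 0 < p := zero_lt_one.trans_le hp
  have : Fact (1 ≤ ENNReal.ofReal p) := ⟨by simpa using hp⟩
  have hcauchy : CauchySeq fun k => (hu k).toLp (u k) := by
    rw [cauchySeq_iff_tendsto_dist_atTop_0]
    simpa [dist_edist, Lp.edist_toLp_toLp, Function.comp_def] using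
      (ENNReal.tendsto_toReal ENNReal.zero_ne_top).comp (tendsto_eLpNorm_of_tendsto_lpPow hp0 h)
  obtain ⟨w, hw⟩ := cauchySeq_tendsto_of_complete hcauchy
  refine ⟨w, (Lp.memLp w).1, tendsto_lpPow_of_tendsto_eLpNorm hp0 ?_⟩
  exact ((Lp.tendsto_Lp_iff_tendsto_eLpNorm' _ _).1 hw).congr fun k =>
    eLpNorm_congr_ae ((hu k).coeFn_toLp.sub .rfl)

theorem exists_subseq_tendsto_average_cell [ProperSpace V] {R : ℕ → ℝ}
    (P : ∀ j, BallPartition Ω (R j)) (hu : ∀ k, IntegrableOn (u k) Ω)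
    (hM : ∀ k, ∀ᵐ x ∂(volume.restrict Ω), ‖u k x‖ ≤ M) :
    ∃ φ : ℕ → ℕ, StrictMono φ ∧
      ∀ j x, ∃ c, Tendsto (fun k => ⨍ y in (P j).cell x, u (φ k) y) atTop (𝓝 c) := by
  obtain ⟨φ, hφ, hlim⟩ := exists_subseq_tendsto_setAverage (μ := volume) (u := u) (M := M)
    (A := fun i : Σ j, (P j).centers => (P i.1).cell i.2)
    (fun i => (P i.1).volume_cell_ne_zero i.2) (fun i => (P i.1).volume_cell_ne_top i.2)
    (fun k i => (hu k).mono_set ((P i.1).cell_subset i.2))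
    (fun k i => ae_restrict_of_ae_restrict_of_subset ((P i.1).cell_subset i.2) (hM k))
  exact ⟨φ, hφ, fun j x => hlim ⟨j, x⟩⟩

theorem exists_subseq_tendsto_lpPow [ProperSpace V] (hp : 1 ≤ p) (hs : 0 < s) (hΩo : IsOpen Ω)
    (hΩ : volume Ω ≠ ⊤) (hu : ∀ k, AEStronglyMeasurable (u k) (volume.restrict Ω))
    (hM : ∀ k, ∀ᵐ x ∂(volume.restrict Ω), ‖u k x‖ ≤ M) {B : ℝ≥0∞} (hBtop : B ≠ ⊤)
    (hB : ∀ k, gagliardo Ω s p (u k) ≤ B) :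
    ∃ (φ : ℕ → ℕ) (w : Space n → V), StrictMono φ ∧
      AEStronglyMeasurable w (volume.restrict Ω) ∧
      Tendsto (fun k => lpPow p (volume.restrict Ω) (u (φ k) - w)) atTop (𝓝 0) := by
  have : IsFiniteMeasure (volume.restrict Ω) := ⟨by simpa using hΩ.lt_top⟩
  have hint : ∀ k, IntegrableOn (u k) Ω := fun k => Integrable.of_bound (hu k) M (hM k)
  obtain ⟨P⟩ : Nonempty (∀ j : ℕ, BallPartition Ω (1 / ((j : ℝ) + 1))) :=
    ⟨fun j => (nonempty_ballPartition hΩo (by positivity)).some⟩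
  obtain ⟨φ, hφ, hlim⟩ := exists_subseq_tendsto_average_cell P hint hM
  have hcauchy := tendsto_lpPow_sub_of_tendsto_average hp hs hΩ P (fun k => hint (φ k))
    (fun k => hM (φ k)) hBtop (fun k => hB (φ k)) hlim
  obtain ⟨w, hw, hconv⟩ := exists_tendsto_lpPow_of_tendsto_sub hp
    (fun k => MemLp.of_bound (hu (φ k)) M (hM (φ k))) hcauchy
  exact ⟨φ, w, hφ, hw, hconv⟩

end Compactness

section LocallyConstant

variable {X : Type*} [MeasurableSpace X] {μ : Measure X} {V : Type*} {Ω : Set X} {h : X → V}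

theorem neBot_nhds_inf_ae [TopologicalSpace X] [μ.IsOpenPosMeasure] (x : X) :
    (𝓝 x ⊓ ae μ).NeBot :=
  inf_neBot_iff.2 fun {U} hU {_} hs => mem_closure_iff_nhds.1 (Measure.dense_of_ae hs x) U hU

theorem exists_ae_eq_const_of_isConnected [TopologicalSpace X] [SecondCountableTopology X]
    [μ.IsOpenPosMeasure] (hΩ : IsConnected Ω) (hΩm : MeasurableSet Ω)
    (hh : ∀ x ∈ Ω, ∃ c, ∀ᶠ y in 𝓝 x ⊓ ae μ, h y = c) :
    ∃ c, ∀ᵐ x ∂(μ.restrict Ω), h x = c := by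
  obtain ⟨x₀, hx₀⟩ := hΩ.nonempty
  have : Nonempty V := ⟨h x₀⟩
  choose! c hc using hh
  have hc_const : ∀ x ∈ Ω, ∀ y ∈ Ω, c x = c y := by
    have : PreconnectedSpace Ω := isPreconnected_iff_preconnectedSpace.1 hΩ.isPreconnected
    have hloc : IsLocallyConstant fun x : Ω => c x := by
      refine (IsLocallyConstant.iff_eventually_eq _).2 fun x => ?_
      obtain ⟨U, hU, s, hs, hUs⟩ := mem_inf_iff_superset.1 (hc x x.2)
      have hnear : ∀ᶠ y in 𝓝 (x : X), U ∈ 𝓝 y := eventually_mem_nhds_iff.2 hU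
      filter_upwards [continuous_subtype_val.continuousAt.eventually hnear] with y hy
      have hcx : ∀ᶠ t in 𝓝 (y : X) ⊓ ae μ, h t = c x := mem_inf_iff_superset.2 ⟨U, hy, s, hs, hUs⟩
      have := neBot_nhds_inf_ae (μ := μ) (y : X)
      obtain ⟨t, hty, htx⟩ := ((hc y y.2).and hcx).exists
      exact hty.symm.trans htx
    exact fun x hx y hy => hloc.apply_eq_of_preconnectedSpace ⟨x, hx⟩ ⟨y, hy⟩
  refine ⟨c x₀, (ae_restrict_iff' hΩm).2 (measure_null_of_locally_null _ fun x hx => ?_)⟩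
  simp only [Set.mem_compl_iff, Set.mem_ofPred_eq, Classical.not_imp] at hx
  obtain ⟨U, hU, s, hs, hUs⟩ := mem_inf_iff_superset.1 (hc x hx.1)
  refine ⟨_, inter_mem_nhdsWithin _ hU, measure_mono_null (t := sᶜ) ?_ hs⟩
  rintro y ⟨hyh, hyU⟩ hys
  exact hyh fun _ => (hUs ⟨hyU, hys⟩).trans (hc_const x hx.1 x₀ hx₀)

theorem exists_ae_eq_const_of_ae_eq_of_dist_le [PseudoMetricSpace X] [OpensMeasurableSpace X]
    [SecondCountableTopology X] [SFinite μ] [μ.IsOpenPosMeasure] (hΩ : IsConnected Ω)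
    (hΩo : IsOpen Ω) {η : ℝ} (hη : 0 < η)
    (hh : ∀ᵐ q ∂((μ.restrict Ω).prod (μ.restrict Ω)), dist q.1 q.2 ≤ η → h q.1 = h q.2) :
    ∃ c, ∀ᵐ x ∂(μ.restrict Ω), h x = c := by
  refine exists_ae_eq_const_of_isConnected hΩ hΩo.measurableSet fun x hx => ?_
  have hnear : ∀ᶠ y in 𝓝 x ⊓ ae μ, dist y x < η / 2 ∧ y ∈ Ω :=
    mem_inf_of_left (inter_mem (Metric.ball_mem_nhds x (half_pos hη)) (hΩo.mem_nhds hx))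
  have hae : ∀ᶠ y in 𝓝 x ⊓ ae μ, y ∈ Ω → ∀ᵐ t ∂μ, t ∈ Ω → dist y t ≤ η → h y = h t := by
    have hprod := (ae_restrict_iff' hΩo.measurableSet).1 (Measure.ae_ae_of_ae_prod hh)
    simp only [ae_restrict_iff' hΩo.measurableSet] at hprod
    exact hprod.filter_mono inf_le_right
  have := neBot_nhds_inf_ae (μ := μ) x
  obtain ⟨y, ⟨hyx, hyΩ⟩, hy⟩ := (hnear.and hae).exists
  refine ⟨h y, ?_⟩
  filter_upwards [hnear, (hy hyΩ).filter_mono inf_le_right] with t ht hyt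
  exact (hyt ht.2 (by linarith [dist_triangle_right y t x])).symm

end LocallyConstant

section LogConvexBody

variable {m : ℕ} {K : Set (Mat m)}

namespace IsLogConvexBody

theorem exists_norm_Log_sub_le (hK : IsLogConvexBody K) :
    ∃ L : NNReal, ∀ A ∈ K, ∀ B ∈ K, ‖Log A - Log B‖ ≤ L * ‖A - B‖ :=
  hK.exists_lipschitzOnWith.imp fun _ hL _ hA _ hB => hL.norm_sub_le hA hB

theorem exists_norm_sub_le (hK : IsLogConvexBody K) :
    ∃ L : NNReal, ∀ A ∈ K, ∀ B ∈ K, ‖A - B‖ ≤ L * ‖Log A - Log B‖ :=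
  hK.exists_antilipschitzWith.imp fun L hL A hA B hB => by
    simpa only [Subtype.dist_eq, dist_eq_norm, Set.domRestrict_apply] using
      hL.le_mul_dist ⟨A, hA⟩ ⟨B, hB⟩

theorem exists_leftInverse (hK : IsLogConvexBody K) :
    ∃ E : Mat m → Mat m, Continuous E ∧ ∀ A ∈ K, E (Log A) = A := by
  obtain ⟨L, hL⟩ := hK.exists_norm_sub_le
  have hinj : Set.InjOn Log K := fun A hA B hB hAB => by
    simpa [hAB, sub_eq_zero] using hL A hA B hB
  have hlip : LipschitzOnWith L (Function.invFunOn Log K) (Log '' K) := by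
    refine LipschitzOnWith.of_dist_le_mul ?_
    rintro _ ⟨A, hA, rfl⟩ _ ⟨B, hB, rfl⟩
    simpa only [hinj.leftInvOn_invFunOn hA, hinj.leftInvOn_invFunOn hB, dist_eq_norm]
      using hL A hA B hB
  obtain ⟨E, hE, heq⟩ := hlip.extend_finite_dimension
  exact ⟨E, hE.continuous, fun A hA =>
    (heq (Set.mem_image_of_mem _ hA)).symm.trans (hinj.leftInvOn_invFunOn hA)⟩

theorem isCompact (hK : IsLogConvexBody K) : IsCompact K := by
  obtain ⟨E, hE, hinv⟩ := hK.exists_leftInverse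
  have himage : E '' (Log '' K) = K := by
    rw [Set.image_image, Set.image_congr hinv, Set.image_id']
  exact himage ▸ hK.isCompact_image.image hE

variable {X : Type*} [MeasurableSpace X] {μ : Measure X}

theorem aestronglyMeasurable_Log_comp (hK : IsLogConvexBody K) {w : X → Mat m}
    (hw : AEStronglyMeasurable w μ) (hwK : ∀ᵐ x ∂μ, w x ∈ K) :
    AEStronglyMeasurable (Log ∘ w) μ := by
  obtain ⟨L, hL⟩ := hK.exists_lipschitzOnWith
  obtain ⟨Λ, hΛ, heq⟩ := hL.extend_finite_dimension
  exact (hΛ.continuous.comp_aestronglyMeasurable hw).congr (hwK.mono fun x hx => (heq hx).symm)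

theorem exists_Log_comp_ae_eq (hK : IsLogConvexBody K) {g : X → Mat m}
    (hg : AEStronglyMeasurable g μ) (hgK : ∀ᵐ x ∂μ, g x ∈ Log '' K) :
    ∃ u : X → Mat m, AEStronglyMeasurable u μ ∧ (∀ᵐ x ∂μ, u x ∈ K) ∧ Log ∘ u =ᵐ[μ] g := by
  obtain ⟨E, hE, hinv⟩ := hK.exists_leftInverse
  refine ⟨E ∘ g, hE.comp_aestronglyMeasurable hg, hgK.mono ?_, hgK.mono ?_⟩
  all_goals
    rintro x ⟨A, hA, hx⟩
    simp only [Function.comp_apply, ← hx, hinv A hA, hA]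

theorem ae_eq_of_Log_comp_ae_eq (hK : IsLogConvexBody K) {v w : X → Mat m}
    (hv : ∀ᵐ x ∂μ, v x ∈ K) (hw : ∀ᵐ x ∂μ, w x ∈ K) (h : Log ∘ v =ᵐ[μ] Log ∘ w) :
    v =ᵐ[μ] w := by
  obtain ⟨E, -, hinv⟩ := hK.exists_leftInverse
  filter_upwards [hv, hw, h] with x hvx hwx hx
  rw [← hinv _ hvx, ← hinv _ hwx]
  exact congrArg E hx

theorem exists_lpPow_Log_sub_le (hK : IsLogConvexBody K) {p : ℝ} (hp : 0 ≤ p) :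
    ∃ c : ℝ≥0∞, c ≠ ⊤ ∧ ∀ {X : Type _} [MeasurableSpace X] {μ : Measure X} {v w : X → Mat m},
      (∀ᵐ x ∂μ, v x ∈ K) → (∀ᵐ x ∂μ, w x ∈ K) →
      lpPow p μ (Log ∘ v - Log ∘ w) ≤ c * lpPow p μ (v - w) := by
  obtain ⟨L, hL⟩ := hK.exists_norm_Log_sub_le
  refine ⟨(L : ℝ≥0∞) ^ p, ENNReal.rpow_ne_top_of_nonneg hp ENNReal.coe_ne_top,
    fun hv hw => lpPow_le_of_ae_norm_le_mul hp ?_⟩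
  filter_upwards [hv, hw] with x hvx hwx
  exact hL _ hvx _ hwx

end IsLogConvexBody

theorem lpPow_fracDiff_le_of_ae_norm_sub_le {E V W : Type*} [NormedAddCommGroup E]
    [MeasurableSpace E] [NormedAddCommGroup V] [NormedSpace ℝ V] [NormedAddCommGroup W]
    [NormedSpace ℝ W] {ν : Measure (E × E)} {a p : ℝ} (hp : 0 ≤ p) {L : NNReal} {f : E → V}
    {g : E → W} (h : ∀ᵐ q ∂ν, ‖g q.1 - g q.2‖ ≤ L * ‖f q.1 - f q.2‖) :
    lpPow p ν (fracDiff a g) ≤ (L : ℝ≥0∞) ^ p * lpPow p ν (fracDiff a f) := by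
  refine lpPow_le_of_ae_norm_le_mul hp (h.mono fun q hq => ?_)
  rw [norm_fracDiff, norm_fracDiff, mul_div_assoc']
  gcongr

variable {n : ℕ} {p : ℝ}

theorem IsLogConvexBody.exists_gagliardo_Log_le (hK : IsLogConvexBody K) (hp : 0 ≤ p)
    (Ω : Set (Space n)) (s : ℝ) :
    ∃ c : ℝ≥0∞, c ≠ ⊤ ∧ ∀ w : Space n → Mat m, (∀ᵐ x ∂volume.restrict Ω, w x ∈ K) →
      gagliardo Ω s p (Log ∘ w) ≤ c * gagliardo Ω s p w := by
  obtain ⟨L, hL⟩ := hK.exists_norm_Log_sub_le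
  exact ⟨(L : ℝ≥0∞) ^ p, ENNReal.rpow_ne_top_of_nonneg hp ENNReal.coe_ne_top, fun w hw =>
    lpPow_fracDiff_le_of_ae_norm_sub_le hp
      ((ae_prod_self_of_ae hw).mono fun q hq => hL _ hq.1 _ hq.2)⟩

theorem IsLogConvexBody.exists_gagliardo_le_Log (hK : IsLogConvexBody K) (hp : 0 ≤ p)
    (Ω : Set (Space n)) (s : ℝ) :
    ∃ c : ℝ≥0∞, c ≠ ⊤ ∧ ∀ w : Space n → Mat m, (∀ᵐ x ∂volume.restrict Ω, w x ∈ K) →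
      gagliardo Ω s p w ≤ c * gagliardo Ω s p (Log ∘ w) := by
  obtain ⟨L, hL⟩ := hK.exists_norm_sub_le
  exact ⟨(L : ℝ≥0∞) ^ p, ENNReal.rpow_ne_top_of_nonneg hp ENNReal.coe_ne_top, fun w hw =>
    lpPow_fracDiff_le_of_ae_norm_sub_le hp
      ((ae_prod_self_of_ae hw).mono fun q hq => hL _ hq.1 _ hq.2)⟩

end LogConvexBody

section Kernel

variable {n : ℕ} {κ : Space n → ℝ}

/-- The properties of the mollifier on which the regularizer depends: a bounded nonnegative
measurable weight that is bounded below near the origin. -/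
structure IsKernel (κ : Space n → ℝ) : Prop where
  measurable : Measurable κ
  nonneg : ∀ x, 0 ≤ κ x
  exists_le : ∃ C, ∀ x, κ x ≤ C
  exists_pos_le : ∃ τ > 0, ∃ η > 0, ∀ x, ‖x‖ ≤ η → τ ≤ κ x

theorem IsMollifier.isKernel {ρ : Space n → ℝ} (hρ : IsMollifier ρ) : IsKernel ρ where
  measurable := hρ.smooth.continuous.measurable
  nonneg := hρ.nonneg
  exists_le := by
    obtain ⟨C, hC⟩ := hρ.compactSupport.exists_bound_of_continuous hρ.smooth.continuous
    exact ⟨C, fun x => (le_abs_self _).trans (hC x)⟩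
  exists_pos_le := by
    obtain ⟨τ, η, hτ, -, hη, hset⟩ := hρ.superlevel
    exact ⟨τ, hτ, η, hη, fun x hx => hset.ge hx⟩

theorem IsKernel.pow (hκ : IsKernel κ) (l : ℕ) : IsKernel (κ ^ l) where
  measurable := hκ.measurable.pow_const l
  nonneg x := pow_nonneg (hκ.nonneg x) l
  exists_le := by
    obtain ⟨C, hC⟩ := hκ.exists_le
    exact ⟨C ^ l, fun x => pow_le_pow_left₀ (hκ.nonneg x) (hC x) l⟩
  exists_pos_le := by
    obtain ⟨τ, hτ, η, hη, h⟩ := hκ.exists_pos_le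
    exact ⟨τ ^ l, pow_pos hτ l, η, hη, fun x hx => pow_le_pow_left₀ hτ.le (h x hx) l⟩

/-- The measure `κ(x - y) d(x,y)` on `Ω × Ω`. -/
noncomputable def kernelMeasure (Ω : Set (Space n)) (κ : Space n → ℝ) :
    Measure (Space n × Space n) :=
  (volSq Ω).withDensity fun q => ENNReal.ofReal (κ (q.1 - q.2))

theorem kernelMeasure_absolutelyContinuous (Ω : Set (Space n)) (κ : Space n → ℝ) :
    kernelMeasure Ω κ ≪ volSq Ω :=
  withDensity_absolutelyContinuous _ _

theorem measurable_kernel_density (hκ : Measurable κ) :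
    Measurable fun q : Space n × Space n => ENNReal.ofReal (κ (q.1 - q.2)) := by
  fun_prop

variable {Ω : Set (Space n)} {V : Type*} [NormedAddCommGroup V] {s p : ℝ}

theorem lpPow_kernelMeasure (hκ : Measurable κ) (f : Space n × Space n → V) :
    lpPow p (kernelMeasure Ω κ) f =
      ∫⁻ q, ENNReal.ofReal (κ (q.1 - q.2)) * ‖f q‖ₑ ^ p ∂(volSq Ω) :=
  lintegral_withDensity_eq_lintegral_mul_non_measurable _ (measurable_kernel_density hκ)
    (.of_forall fun _ => ENNReal.ofReal_lt_top) _

theorem IsKernel.exists_lpPow_kernelMeasure_le (hκ : IsKernel κ) :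
    ∃ c : ℝ≥0∞, c ≠ ⊤ ∧ ∀ f : Space n × Space n → V,
      lpPow p (kernelMeasure Ω κ) f ≤ c * lpPow p (volSq Ω) f := by
  obtain ⟨C, hC⟩ := hκ.exists_le
  refine ⟨ENNReal.ofReal C, ENNReal.ofReal_ne_top, fun f => ?_⟩
  rw [lpPow_kernelMeasure hκ.measurable, lpPow, ← lintegral_const_mul' _ _ ENNReal.ofReal_ne_top]
  gcongr with q
  exact hC _

variable [NormedSpace ℝ V]

theorem norm_fracDiff_le_of_lt_norm_sub {E : Type*} [NormedAddCommGroup E] {a : ℝ} (ha : 0 ≤ a)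
    {w : E → V} {q : E × E} {η M : ℝ} (hη : 0 < η) (hq : η < ‖q.1 - q.2‖)
    (h₁ : ‖w q.1‖ ≤ M) (h₂ : ‖w q.2‖ ≤ M) : ‖fracDiff a w q‖ ≤ (M + M) / η ^ a := by
  rw [norm_fracDiff]
  have hsub : ‖w q.1 - w q.2‖ ≤ M + M := (norm_sub_le _ _).trans (add_le_add h₁ h₂)
  have hM : 0 ≤ M + M := (norm_nonneg _).trans hsub
  gcongr

/-- Near the diagonal the kernel is bounded below, away from it the difference quotient of a bounded
function is bounded. -/
theorem IsKernel.exists_gagliardo_le [IsFiniteMeasure (volume.restrict Ω)] (hκ : IsKernel κ)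
    (hp : 0 ≤ p) (hs : 0 ≤ s) (M : ℝ) :
    ∃ c c' : ℝ≥0∞, c ≠ ⊤ ∧ c' ≠ ⊤ ∧ ∀ w : Space n → V, (∀ᵐ x ∂volume.restrict Ω, ‖w x‖ ≤ M) →
      gagliardo Ω s p w ≤
        c * lpPow p (kernelMeasure Ω κ) (fracDiff ((n : ℝ) / p + s) w) + c' := by
  obtain ⟨τ, hτ, η, hη, hτκ⟩ := hκ.exists_pos_le
  set a : ℝ := (n : ℝ) / p + s
  set c' : ℝ≥0∞ := ENNReal.ofReal ((M + M) / η ^ a) ^ p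
  have hc' : c' ≠ ⊤ := ENNReal.rpow_ne_top_of_nonneg hp ENNReal.ofReal_ne_top
  have hτ0 : ENNReal.ofReal τ ≠ 0 := (ENNReal.ofReal_pos.2 hτ).ne'
  refine ⟨(ENNReal.ofReal τ)⁻¹, c' * volSq Ω Set.univ, ENNReal.inv_ne_top.2 hτ0,
    ENNReal.mul_ne_top hc' (measure_ne_top _ _), fun w hw => ?_⟩
  rw [gagliardo, lpPow_kernelMeasure hκ.measurable,
    ← lintegral_const_mul' _ _ (ENNReal.inv_ne_top.2 hτ0), ← lintegral_const,
    ← lintegral_add_right _ measurable_const]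
  refine lintegral_mono_ae ((ae_prod_self_of_ae hw).mono fun q hq => ?_)
  rcases le_or_gt ‖q.1 - q.2‖ η with hnear | hfar
  · refine le_add_right ?_
    rw [← mul_assoc, ← ENNReal.div_eq_inv_mul]
    refine le_mul_of_one_le_left' ?_
    rw [ENNReal.le_div_iff_mul_le (.inl hτ0) (.inl ENNReal.ofReal_ne_top), one_mul]
    exact ENNReal.ofReal_le_ofReal (hτκ _ hnear)
  · refine le_add_left (ENNReal.rpow_le_rpow ?_ hp)
    rw [← ofReal_norm]
    exact ENNReal.ofReal_le_ofReal
      (norm_fracDiff_le_of_lt_norm_sub (by positivity) hη hfar hq.1 hq.2)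

end Kernel

section Regularizer

variable {n m : ℕ} {Ω : Set (Space n)} {s p : ℝ} {l : ℕ} {ρ : Space n → ℝ} {K : Set (Mat m)}

theorem Phi_eq_lpPow (hp : 0 < p) (hρ : Measurable ρ) (w : Space n → Mat m) :
    Phi Ω s p l ρ w =
      lpPow p (kernelMeasure Ω (ρ ^ l)) (fracDiff ((n : ℝ) / p + s) (Log ∘ w)) := by
  rw [lpPow_kernelMeasure (show Measurable (ρ ^ l) from hρ.pow_const l), Phi]
  refine lintegral_congr fun q => ?_
  rw [mul_comm, ENNReal.ofReal_mul' (by unfold logDist; positivity), ← ofReal_norm, norm_fracDiff,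
    ENNReal.ofReal_rpow_of_nonneg (by positivity) hp.le, Real.div_rpow (norm_nonneg _)
    (by positivity), ← Real.rpow_mul (norm_nonneg _), add_mul, div_mul_cancel₀ _ hp.ne', mul_comm s]
  rfl

theorem WspSet_subset_LpSet : WspSet Ω s p K ⊆ LpSet Ω p K := fun _ hw => ⟨hw.1.1, hw.2⟩

theorem mem_WspSet_iff [IsFiniteMeasure (volume.restrict Ω)] (hK : IsLogConvexBody K)
    (hp : 0 < p) {w : Space n → Mat m} :
    w ∈ WspSet Ω s p K ↔ AEStronglyMeasurable w (volume.restrict Ω) ∧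
      (∀ᵐ x ∂volume.restrict Ω, w x ∈ K) ∧ gagliardo Ω s p w < ⊤ := by
  change w ∈ Wsp m Ω s p ∧ _ ↔ _
  rw [mem_Wsp_iff hp]
  refine ⟨fun h => ⟨h.1.1, h.2, h.1.2.2⟩, fun ⟨hmeas, hwK, hgag⟩ => ⟨⟨hmeas, ?_, hgag⟩, hwK⟩⟩
  obtain ⟨M, hM⟩ := hK.isCompact.isBounded.exists_norm_le
  exact (lpPow_le_of_ae_norm_le hp.le (hwK.mono fun x hx => hM _ hx)).trans_lt
    (ENNReal.mul_lt_top (ENNReal.rpow_lt_top_of_nonneg hp.le ENNReal.ofReal_ne_top)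
      (measure_lt_top _ _))

theorem WspSet_nonempty [IsFiniteMeasure (volume.restrict Ω)] (hK : IsLogConvexBody K)
    (hp : 0 < p) : (WspSet Ω s p K).Nonempty := by
  obtain ⟨A, hA⟩ := hK.nonempty
  refine ⟨fun _ => A, (mem_WspSet_iff hK hp).2
    ⟨aestronglyMeasurable_const, .of_forall fun _ => hA, ?_⟩⟩
  simp [gagliardo, lpPow, fracDiff_apply, ENNReal.zero_rpow_of_pos hp]

theorem Phi_lt_top (hK : IsLogConvexBody K) (hp : 0 < p) (hρ : IsKernel ρ) {w : Space n → Mat m}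
    (hw : w ∈ WspSet Ω s p K) : Phi Ω s p l ρ w < ⊤ := by
  obtain ⟨c, hc, hkernel⟩ := (hρ.pow l).exists_lpPow_kernelMeasure_le (Ω := Ω) (V := Mat m) (p := p)
  obtain ⟨c', hc', hLog⟩ := hK.exists_gagliardo_Log_le hp.le Ω s
  rw [Phi_eq_lpPow hp hρ.measurable]
  calc lpPow p (kernelMeasure Ω (ρ ^ l)) (fracDiff ((n : ℝ) / p + s) (Log ∘ w))
      ≤ c * (c' * gagliardo Ω s p w) := (hkernel _).trans (by gcongr; exact hLog w hw.2)
    _ < ⊤ := ENNReal.mul_lt_top hc.lt_top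
        (ENNReal.mul_lt_top hc'.lt_top ((mem_Wsp_iff hp).1 hw.1).2.2)

theorem exists_gagliardo_le_of_Phi_le [IsFiniteMeasure (volume.restrict Ω)]
    (hK : IsLogConvexBody K) (hp : 0 < p) (hs : 0 ≤ s) (hρ : IsKernel ρ) (l : ℕ) {B : ℝ≥0∞}
    (hB : B ≠ ⊤) :
    ∃ B' : ℝ≥0∞, B' ≠ ⊤ ∧ ∀ w : Space n → Mat m, (∀ᵐ x ∂volume.restrict Ω, w x ∈ K) →
      Phi Ω s p l ρ w ≤ B → gagliardo Ω s p w ≤ B' := by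
  obtain ⟨M, hM⟩ := hK.isCompact_image.isBounded.exists_norm_le
  obtain ⟨c, c', hc, hc', hcoercive⟩ :=
    (hρ.pow l).exists_gagliardo_le (Ω := Ω) (V := Mat m) hp.le hs M
  obtain ⟨c'', hc'', hLog⟩ := hK.exists_gagliardo_le_Log hp.le Ω s
  refine ⟨c'' * (c * B + c'), by finiteness, fun w hw hwB => (hLog w hw).trans ?_⟩
  rw [Phi_eq_lpPow hp hρ.measurable] at hwB
  have hbound := hcoercive (Log ∘ w) (hw.mono fun x hx => hM _ (Set.mem_image_of_mem _ hx))
  exact mul_le_mul_right (hbound.trans (add_le_add_left (mul_le_mul_right hwB c) c')) c''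

theorem tendsto_lpPow_Log_sub (hK : IsLogConvexBody K) (hp : 0 ≤ p)
    {X : Type*} [MeasurableSpace X] {μ : Measure X} {u : ℕ → X → Mat m} {w : X → Mat m}
    (hu : ∀ k, ∀ᵐ x ∂μ, u k x ∈ K) (hw : ∀ᵐ x ∂μ, w x ∈ K)
    (hlim : Tendsto (fun k => lpPow p μ (u k - w)) atTop (𝓝 0)) :
    Tendsto (fun k => lpPow p μ (Log ∘ u k - Log ∘ w)) atTop (𝓝 0) := by
  obtain ⟨c, hc, hLog⟩ := hK.exists_lpPow_Log_sub_le hp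
  refine tendsto_of_tendsto_of_tendsto_of_le_of_le tendsto_const_nhds ?_ (fun _ => zero_le)
    fun k => hLog (hu k) hw
  simpa using ENNReal.Tendsto.const_mul hlim (.inr hc)

theorem Phi_le_liminf (hK : IsLogConvexBody K) (hp : 0 < p) (hρ : Measurable ρ)
    {u : ℕ → Space n → Mat m} {w : Space n → Mat m} (hu : ∀ k, u k ∈ LpSet Ω p K)
    (hw : w ∈ LpSet Ω p K)
    (hlim : Tendsto (fun k => lpPow p (volume.restrict Ω) (u k - w)) atTop (𝓝 0)) :
    Phi Ω s p l ρ w ≤ liminf (fun k => Phi Ω s p l ρ (u k)) atTop := by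
  simp only [Phi_eq_lpPow hp hρ]
  exact lpPow_fracDiff_le_liminf hp (kernelMeasure_absolutelyContinuous Ω _)
    (fun k => hK.aestronglyMeasurable_Log_comp (hu k).1.1 (hu k).2)
    (hK.aestronglyMeasurable_Log_comp hw.1.1 hw.2)
    (tendsto_lpPow_Log_sub hK hp.le (fun k => (hu k).2) hw.2 hlim)

theorem ae_mem_of_tendsto_lpPow {X V : Type*} [MeasurableSpace X] [NormedAddCommGroup V]
    {μ : Measure X} {C : Set V} (hC : IsClosed C) (hp : 0 < p) {u : ℕ → X → V} {w : X → V}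
    (hu : ∀ k, AEStronglyMeasurable (u k) μ) (huC : ∀ k, ∀ᵐ x ∂μ, u k x ∈ C)
    (hw : AEStronglyMeasurable w μ)
    (hlim : Tendsto (fun k => lpPow p μ (u k - w)) atTop (𝓝 0)) : ∀ᵐ x ∂μ, w x ∈ C := by
  obtain ⟨φ, -, hφ⟩ := exists_subseq_ae_tendsto_of_tendsto_lpPow hp hu hw hlim
  filter_upwards [hφ, ae_all_iff.2 huC] with x hx hxC
  exact hC.mem_of_tendsto hx (.of_forall fun k => hxC (φ k))

theorem exists_subseq_tendsto_WspSet (hK : IsLogConvexBody K) (hp : 1 ≤ p) (hs : 0 < s)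
    (hΩo : IsOpen Ω) (hΩ : volume Ω ≠ ⊤) (hρ : IsKernel ρ) {u : ℕ → Space n → Mat m}
    (hu : ∀ k, u k ∈ WspSet Ω s p K) {B : ℝ≥0∞} (hBtop : B ≠ ⊤)
    (hB : ∀ k, Phi Ω s p l ρ (u k) ≤ B) :
    ∃ (φ : ℕ → ℕ) (w : Space n → Mat m), StrictMono φ ∧ w ∈ WspSet Ω s p K ∧
      Tendsto (fun k => lpPow p (volume.restrict Ω) (u (φ k) - w)) atTop (𝓝 0) := by
  have : IsFiniteMeasure (volume.restrict Ω) := isFiniteMeasure_restrict.2 hΩ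
  have hp0 : 0 < p := zero_lt_one.trans_le hp
  obtain ⟨M, hM⟩ := hK.isCompact.isBounded.exists_norm_le
  obtain ⟨B', hB'top, hB'⟩ :=
    exists_gagliardo_le_of_Phi_le (Ω := Ω) hK hp0 hs.le hρ l hBtop
  have hgag : ∀ k, gagliardo Ω s p (u k) ≤ B' := fun k => hB' _ (hu k).2 (hB k)
  obtain ⟨φ, w, hφ, hw, hlim⟩ := exists_subseq_tendsto_lpPow hp hs hΩo hΩ (fun k => (hu k).1.1.1)
    (fun k => (hu k).2.mono fun x hx => hM _ hx) hB'top hgag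
  refine ⟨φ, w, hφ, (mem_WspSet_iff hK hp0).2 ⟨hw, ?_, ?_⟩, hlim⟩
  · exact ae_mem_of_tendsto_lpPow hK.isCompact.isClosed hp0 (fun k => (hu (φ k)).1.1.1)
      (fun k => (hu (φ k)).2) hw hlim
  · exact (lpPow_fracDiff_le_liminf hp0 .rfl (fun k => (hu (φ k)).1.1.1) hw hlim).trans_lt
      ((liminf_le_of_frequently_le' (.of_forall fun k => hgag (φ k))).trans_lt hB'top.lt_top)

theorem weakTendsto_of_Phi_le [IsFiniteMeasure (volume.restrict Ω)] (hK : IsLogConvexBody K)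
    (hp : 1 < p) (hs : 0 ≤ s) (hρ : IsKernel ρ) {u : ℕ → Space n → Mat m} {w : Space n → Mat m}
    (hu : ∀ k, u k ∈ WspSet Ω s p K) (hw : w ∈ WspSet Ω s p K) {B : ℝ≥0∞} (hBtop : B ≠ ⊤)
    (hB : ∀ k, Phi Ω s p l ρ (u k) ≤ B)
    (hlim : Tendsto (fun k => lpPow p (volume.restrict Ω) (u k - w)) atTop (𝓝 0)) :
    WeakTendsto Ω s p u w := by
  obtain ⟨B', hB'top, hB'⟩ :=
    exists_gagliardo_le_of_Phi_le (Ω := Ω) hK (zero_lt_one.trans hp) hs hρ l hBtop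
  exact weakTendsto_of_tendsto_lpPow hp (fun k => (hu k).1) hw.1 hlim hB'top
    fun k => hB' _ (hu k).2 (hB k)

theorem WeakTendsto.comp {u : ℕ → Space n → Mat m} {w : Space n → Mat m}
    (h : WeakTendsto Ω s p u w) {φ : ℕ → ℕ} (hφ : Tendsto φ atTop atTop) :
    WeakTendsto Ω s p (fun k => u (φ k)) w := by
  obtain ⟨hu, hw, hlim⟩ := h
  exact ⟨fun k => hu (φ k), hw, fun f hf => (hlim f hf).comp hφ⟩

theorem WeakTendsto.mem_WspSet_and_tendsto_lpPow (hK : IsLogConvexBody K) (hp : 1 < p)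
    (hs : 0 < s) (hΩo : IsOpen Ω) (hΩ : volume Ω ≠ ⊤) (hρ : IsKernel ρ)
    {u : ℕ → Space n → Mat m} {w : Space n → Mat m} (hu : ∀ k, u k ∈ WspSet Ω s p K)
    {B : ℝ≥0∞} (hBtop : B ≠ ⊤) (hB : ∀ k, Phi Ω s p l ρ (u k) ≤ B)
    (h : WeakTendsto Ω s p u w) :
    w ∈ WspSet Ω s p K ∧ Tendsto (fun k => lpPow p (volume.restrict Ω) (u k - w)) atTop (𝓝 0) := by
  have : IsFiniteMeasure (volume.restrict Ω) := isFiniteMeasure_restrict.2 hΩ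
  have hsubseq : ∀ φ : ℕ → ℕ, Tendsto φ atTop atTop → ∃ ψ : ℕ → ℕ, w ∈ WspSet Ω s p K ∧
      Tendsto (fun k => lpPow p (volume.restrict Ω) (u (φ (ψ k)) - w)) atTop (𝓝 0) := by
    intro φ hφ
    obtain ⟨ψ, w', hψ, hw', hlim⟩ := exists_subseq_tendsto_WspSet hK hp.le hs hΩo hΩ hρ
      (fun k => hu (φ k)) hBtop fun k => hB (φ k)
    have hae : w' =ᵐ[volume.restrict Ω] w :=
      (weakTendsto_of_Phi_le hK hp hs.le hρ (fun k => hu (φ (ψ k))) hw' hBtop (fun k => hB _)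
        hlim).ae_unique hp.le (h.comp (hφ.comp hψ.tendsto_atTop))
    refine ⟨ψ, ⟨h.choose_spec.choose, ?_⟩, hlim.congr fun k => ?_⟩
    · filter_upwards [hw'.2, hae] with x hx hxw
      rwa [← hxw]
    · exact lpPow_congr (.sub .rfl hae)
  obtain ⟨-, hw, -⟩ := hsubseq id tendsto_id
  exact ⟨hw, tendsto_of_subseq_tendsto fun φ hφ => (hsubseq φ hφ).imp fun _ h => h.2⟩

end Regularizer

section Functional

variable {n m : ℕ} {Ω D : Set (Space n)} {s p α : ℝ} {l : ℕ} {ρ : Space n → ℝ} {K : Set (Mat m)}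

/-- The fidelity term `∫_{Ω∖D} d(w(x), v(x))^p dx` of `Func`. -/
noncomputable def fidelity (Ω D : Set (Space n)) (p : ℝ) (v w : Space n → Mat m) : ℝ≥0∞ :=
  lpPow p (volume.restrict (Ω \ D)) (Log ∘ w - Log ∘ v)

theorem Func_eq (hΩ : MeasurableSet Ω) (hD : NullMeasurableSet D volume) (hp : 0 ≤ p)
    (v w : Space n → Mat m) :
    Func Ω D s p l ρ α v w = fidelity Ω D p v w + ENNReal.ofReal α * Phi Ω s p l ρ w := by
  have hΩD : NullMeasurableSet (Ω \ D) (volume.restrict Ω) :=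
    (hΩ.nullMeasurableSet.diff hD).mono_ac Measure.absolutelyContinuous_restrict
  rw [Func, lintegral_indicator₀ hΩD, Measure.restrict_restrict₀ hΩD,
    Set.inter_eq_left.2 Set.sdiff_subset]
  simp only [fidelity, lpPow, logDist, Pi.sub_apply, Function.comp_apply, ← ofReal_norm,
    ENNReal.ofReal_rpow_of_nonneg (norm_nonneg _) hp]

theorem exists_fidelity_le [IsFiniteMeasure (volume.restrict Ω)] (hK : IsLogConvexBody K)
    (hp : 0 ≤ p) (D : Set (Space n)) :
    ∃ C : ℝ≥0∞, C ≠ ⊤ ∧ ∀ v ∈ LpSet Ω p K, ∀ w ∈ LpSet Ω p K, fidelity Ω D p v w ≤ C := by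
  obtain ⟨M, hM⟩ := hK.isCompact_image.isBounded.exists_norm_le
  refine ⟨ENNReal.ofReal (M + M) ^ p * (volume.restrict Ω) Set.univ, by finiteness,
    fun v hv w hw => ?_⟩
  refine (lpPow_mono_measure (Measure.restrict_mono Set.sdiff_subset le_rfl) _).trans
    (lpPow_le_of_ae_norm_le hp ?_)
  filter_upwards [hv.2, hw.2] with x hvx hwx
  exact (norm_sub_le _ _).trans
    (add_le_add (hM _ (Set.mem_image_of_mem _ hwx)) (hM _ (Set.mem_image_of_mem _ hvx)))

theorem fidelity_ne_top [IsFiniteMeasure (volume.restrict Ω)] (hK : IsLogConvexBody K)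
    (hp : 0 ≤ p) (D : Set (Space n)) {v w : Space n → Mat m} (hv : v ∈ LpSet Ω p K)
    (hw : w ∈ LpSet Ω p K) : fidelity Ω D p v w ≠ ⊤ := by
  obtain ⟨C, hC, hle⟩ := exists_fidelity_le (Ω := Ω) hK hp D
  exact ne_top_of_le_ne_top hC (hle v hv w hw)

theorem tendsto_fidelity [IsFiniteMeasure (volume.restrict Ω)] (hK : IsLogConvexBody K)
    (hp : 1 ≤ p) (D : Set (Space n)) {v w : ℕ → Space n → Mat m} {v' w' : Space n → Mat m}
    (hv : ∀ k, v k ∈ LpSet Ω p K) (hv' : v' ∈ LpSet Ω p K)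
    (hw : ∀ k, w k ∈ LpSet Ω p K) (hw' : w' ∈ LpSet Ω p K)
    (hvlim : Tendsto (fun k => lpPow p (volume.restrict Ω) (v k - v')) atTop (𝓝 0))
    (hwlim : Tendsto (fun k => lpPow p (volume.restrict Ω) (w k - w')) atTop (𝓝 0)) :
    Tendsto (fun k => fidelity Ω D p (v k) (w k)) atTop (𝓝 (fidelity Ω D p v' w')) := by
  have hp0 : 0 < p := zero_lt_one.trans_le hp
  have hmono : volume.restrict (Ω \ D) ≤ volume.restrict Ω :=
    Measure.restrict_mono Set.sdiff_subset le_rfl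
  have hmeas : ∀ u ∈ LpSet Ω p K, AEStronglyMeasurable (Log ∘ u) (volume.restrict (Ω \ D)) :=
    fun u hu => (hK.aestronglyMeasurable_Log_comp hu.1.1 hu.2).mono_measure hmono
  refine tendsto_lpPow_of_tendsto_lpPow_sub hp
    (fun k => (hmeas _ (hw k)).sub (hmeas _ (hv k)))
    ((memLp_iff_lpPow_lt_top hp0).2
      ⟨(hmeas _ hw').sub (hmeas _ hv'), (fidelity_ne_top hK hp0.le D hv' hw').lt_top⟩) ?_
  have hLog : Tendsto (fun k => lpPow p (volume.restrict Ω) (Log ∘ w k - Log ∘ w') +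
      lpPow p (volume.restrict Ω) (Log ∘ v k - Log ∘ v')) atTop (𝓝 0) := by
    simpa only [add_zero] using
      (tendsto_lpPow_Log_sub hK hp0.le (fun k => (hw k).2) hw'.2 hwlim).add
        (tendsto_lpPow_Log_sub hK hp0.le (fun k => (hv k).2) hv'.2 hvlim)
  have hLog_mul := ENNReal.Tendsto.const_mul (a := 2 ^ (p - 1)) hLog
    (.inr (ENNReal.rpow_ne_top_of_nonneg (sub_nonneg.2 hp) ENNReal.ofNat_ne_top))
  rw [mul_zero] at hLog_mul
  refine tendsto_of_tendsto_of_tendsto_of_le_of_le tendsto_const_nhds hLog_mul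
    (fun _ => zero_le) fun k => ?_
  rw [sub_sub_sub_comm, sub_eq_add_neg, neg_sub, lpPow_sub_comm (Log ∘ v k)]
  exact (lpPow_mono_measure hmono _).trans (lpPow_add_le hp
    ((hK.aestronglyMeasurable_Log_comp (hw k).1.1 (hw k).2).sub
      (hK.aestronglyMeasurable_Log_comp hw'.1.1 hw'.2)))

theorem Func_lt_top [IsFiniteMeasure (volume.restrict Ω)] (hK : IsLogConvexBody K) (hp : 0 < p)
    (hΩm : MeasurableSet Ω) (hD : NullMeasurableSet D volume) (hρ : IsKernel ρ) (α : ℝ)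
    {v w : Space n → Mat m} (hv : v ∈ LpSet Ω p K) (hw : w ∈ WspSet Ω s p K) :
    Func Ω D s p l ρ α v w < ⊤ := by
  rw [Func_eq hΩm hD hp.le]
  exact ENNReal.add_lt_top.2 ⟨(fidelity_ne_top hK hp.le D hv (WspSet_subset_LpSet hw)).lt_top,
    ENNReal.mul_lt_top ENNReal.ofReal_lt_top (Phi_lt_top hK hp hρ hw)⟩

theorem Phi_le_div (hα : 0 < α) {v w : Space n → Mat m} {B : ℝ≥0∞}
    (hB : Func Ω D s p l ρ α v w ≤ B) : Phi Ω s p l ρ w ≤ B / ENNReal.ofReal α := by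
  rw [ENNReal.le_div_iff_mul_le (.inl (ENNReal.ofReal_pos.2 hα).ne') (.inl ENNReal.ofReal_ne_top),
    mul_comm]
  exact le_add_self.trans hB

theorem tendsto_Func [IsFiniteMeasure (volume.restrict Ω)] (hK : IsLogConvexBody K)
    (hp : 1 ≤ p) (hΩm : MeasurableSet Ω) (hD : NullMeasurableSet D volume)
    {v : ℕ → Space n → Mat m} {v' u : Space n → Mat m} (hv : ∀ k, v k ∈ LpSet Ω p K)
    (hv' : v' ∈ LpSet Ω p K) (hu : u ∈ LpSet Ω p K)
    (hvlim : Tendsto (fun k => lpPow p (volume.restrict Ω) (v k - v')) atTop (𝓝 0)) :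
    Tendsto (fun k => Func Ω D s p l ρ α (v k) u) atTop (𝓝 (Func Ω D s p l ρ α v' u)) := by
  have hp0 : 0 < p := zero_lt_one.trans_le hp
  simp only [Func_eq hΩm hD hp0.le]
  exact (tendsto_fidelity hK hp D hv hv' (fun _ => hu) hu hvlim
    (by simp [lpPow, ENNReal.zero_rpow_of_pos hp0])).add_const _

theorem Func_le_liminf [IsFiniteMeasure (volume.restrict Ω)] (hK : IsLogConvexBody K)
    (hp : 1 ≤ p) (hΩm : MeasurableSet Ω) (hD : NullMeasurableSet D volume) (hρ : Measurable ρ)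
    {v w : ℕ → Space n → Mat m} {v' w' : Space n → Mat m}
    (hv : ∀ k, v k ∈ LpSet Ω p K) (hv' : v' ∈ LpSet Ω p K)
    (hw : ∀ k, w k ∈ LpSet Ω p K) (hw' : w' ∈ LpSet Ω p K)
    (hvlim : Tendsto (fun k => lpPow p (volume.restrict Ω) (v k - v')) atTop (𝓝 0))
    (hwlim : Tendsto (fun k => lpPow p (volume.restrict Ω) (w k - w')) atTop (𝓝 0)) :
    Func Ω D s p l ρ α v' w' ≤ liminf (fun k => Func Ω D s p l ρ α (v k) (w k)) atTop := by
  have hp0 : 0 < p := zero_lt_one.trans_le hp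
  simp only [Func_eq hΩm hD hp0.le]
  calc fidelity Ω D p v' w' + ENNReal.ofReal α * Phi Ω s p l ρ w'
      ≤ liminf (fun k => fidelity Ω D p (v k) (w k)) atTop +
          liminf (fun k => ENNReal.ofReal α * Phi Ω s p l ρ (w k)) atTop := by
        rw [(tendsto_fidelity hK hp D hv hv' hw hw' hvlim hwlim).liminf_eq,
          ENNReal.liminf_const_mul_of_ne_top ENNReal.ofReal_ne_top]
        gcongr
        exact Phi_le_liminf hK hp0 hρ hw hw' hwlim
    _ ≤ liminf (fun k => fidelity Ω D p (v k) (w k) +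
          ENNReal.ofReal α * Phi Ω s p l ρ (w k)) atTop :=
        liminf_add_liminf_le_liminf_add _ _

theorem exists_isMinimizer (hK : IsLogConvexBody K) (hp : 1 ≤ p) (hs : 0 < s) (hΩo : IsOpen Ω)
    (hΩ : volume Ω ≠ ⊤) (hD : NullMeasurableSet D volume) (hρ : IsKernel ρ) (hα : 0 < α)
    {v : Space n → Mat m} (hv : v ∈ LpSet Ω p K) : ∃ w, IsMinimizer Ω D s p l ρ K α v w := by
  have : IsFiniteMeasure (volume.restrict Ω) := isFiniteMeasure_restrict.2 hΩ
  have hp0 : 0 < p := zero_lt_one.trans_le hp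
  obtain ⟨F, hF_anti, hF, hFmem⟩ := exists_seq_tendsto_sInf
    ((WspSet_nonempty (Ω := Ω) (s := s) hK hp0).image (Func Ω D s p l ρ α v)) (OrderBot.bddBelow _)
  choose u hu hFu using hFmem
  obtain rfl : (fun k => Func Ω D s p l ρ α v (u k)) = F := funext hFu
  obtain ⟨φ, w, hφ, hw, hlim⟩ := exists_subseq_tendsto_WspSet hK hp hs hΩo hΩ hρ hu
    (ENNReal.div_ne_top (Func_lt_top hK hp0 hΩo.measurableSet hD hρ α hv (hu 0)).ne
      (ENNReal.ofReal_pos.2 hα).ne') fun k => Phi_le_div hα (hF_anti (Nat.zero_le k))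
  refine ⟨w, hw, fun u' hu' => ?_⟩
  calc Func Ω D s p l ρ α v w
      ≤ liminf (fun k => Func Ω D s p l ρ α v (u (φ k))) atTop :=
        Func_le_liminf hK hp hΩo.measurableSet hD hρ.measurable (fun _ => hv) hv
          (fun k => WspSet_subset_LpSet (hu (φ k))) (WspSet_subset_LpSet hw)
          (by simp [lpPow, ENNReal.zero_rpow_of_pos hp0]) hlim
    _ = sInf (Func Ω D s p l ρ α v '' WspSet Ω s p K) := (hF.comp hφ.tendsto_atTop).liminf_eq
    _ ≤ Func Ω D s p l ρ α v u' := sInf_le (Set.mem_image_of_mem _ hu')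

theorem exists_Phi_le_of_isMinimizer [IsFiniteMeasure (volume.restrict Ω)]
    (hK : IsLogConvexBody K) (hp : 0 < p) (hΩm : MeasurableSet Ω)
    (hD : NullMeasurableSet D volume) (hρ : IsKernel ρ) (hα : 0 < α)
    {v w : ℕ → Space n → Mat m} (hv : ∀ k, v k ∈ LpSet Ω p K)
    (hw : ∀ k, IsMinimizer Ω D s p l ρ K α (v k) (w k)) :
    ∃ B : ℝ≥0∞, B ≠ ⊤ ∧ ∀ k, Phi Ω s p l ρ (w k) ≤ B := by
  obtain ⟨C, hC, hfid⟩ := exists_fidelity_le (Ω := Ω) hK hp.le D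
  obtain ⟨u, hu⟩ := WspSet_nonempty (Ω := Ω) (s := s) hK hp
  have hPhi : Phi Ω s p l ρ u ≠ ⊤ := (Phi_lt_top hK hp hρ hu).ne
  refine ⟨(C + ENNReal.ofReal α * Phi Ω s p l ρ u) / ENNReal.ofReal α,
    ENNReal.div_ne_top (by finiteness) (ENNReal.ofReal_pos.2 hα).ne',
    fun k => Phi_le_div hα (((hw k).2 u hu).trans ?_)⟩
  rw [Func_eq hΩm hD hp.le]
  exact add_le_add_left (hfid _ (hv k) _ (WspSet_subset_LpSet hu)) _

theorem isMinimizer_of_tendsto [IsFiniteMeasure (volume.restrict Ω)] (hK : IsLogConvexBody K)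
    (hp : 1 ≤ p) (hΩm : MeasurableSet Ω) (hD : NullMeasurableSet D volume) (hρ : Measurable ρ)
    {v w : ℕ → Space n → Mat m} {v' w' : Space n → Mat m}
    (hv : ∀ k, v k ∈ LpSet Ω p K) (hv' : v' ∈ LpSet Ω p K)
    (hw : ∀ k, IsMinimizer Ω D s p l ρ K α (v k) (w k)) (hw' : w' ∈ WspSet Ω s p K)
    (hvlim : Tendsto (fun k => lpPow p (volume.restrict Ω) (v k - v')) atTop (𝓝 0))
    (hwlim : Tendsto (fun k => lpPow p (volume.restrict Ω) (w k - w')) atTop (𝓝 0)) :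
    IsMinimizer Ω D s p l ρ K α v' w' := by
  refine ⟨hw', fun u hu => ?_⟩
  calc Func Ω D s p l ρ α v' w'
      ≤ liminf (fun k => Func Ω D s p l ρ α (v k) (w k)) atTop :=
        Func_le_liminf hK hp hΩm hD hρ hv hv' (fun k => WspSet_subset_LpSet (hw k).1)
          (WspSet_subset_LpSet hw') hvlim hwlim
    _ ≤ liminf (fun k => Func Ω D s p l ρ α (v k) u) atTop :=
        liminf_le_liminf (.of_forall fun k => (hw k).2 u hu)
    _ = Func Ω D s p l ρ α v' u :=
        (tendsto_Func hK hp hΩm hD hv hv' (WspSet_subset_LpSet hu) hvlim).liminf_eq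

theorem tendsto_Phi_of_isMinimizer [IsFiniteMeasure (volume.restrict Ω)] (hK : IsLogConvexBody K)
    (hp : 1 ≤ p) (hΩm : MeasurableSet Ω) (hD : NullMeasurableSet D volume) (hρ : Measurable ρ)
    (hα : 0 < α) {v w : ℕ → Space n → Mat m} {v' w' : Space n → Mat m}
    (hv : ∀ k, v k ∈ LpSet Ω p K) (hv' : v' ∈ LpSet Ω p K)
    (hw : ∀ k, IsMinimizer Ω D s p l ρ K α (v k) (w k)) (hw' : w' ∈ WspSet Ω s p K)
    (hvlim : Tendsto (fun k => lpPow p (volume.restrict Ω) (v k - v')) atTop (𝓝 0))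
    (hwlim : Tendsto (fun k => lpPow p (volume.restrict Ω) (w k - w')) atTop (𝓝 0)) :
    Tendsto (fun k => Phi Ω s p l ρ (w k)) atTop (𝓝 (Phi Ω s p l ρ w')) := by
  have hp0 : 0 < p := zero_lt_one.trans_le hp
  have hwLp : ∀ k, w k ∈ LpSet Ω p K := fun k => WspSet_subset_LpSet (hw k).1
  have hw'Lp := WspSet_subset_LpSet hw'
  have hfid := tendsto_fidelity hK hp D hv hv' hwLp hw'Lp hvlim hwlim
  have hFunc : Tendsto (fun k => Func Ω D s p l ρ α (v k) (w k)) atTop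
      (𝓝 (Func Ω D s p l ρ α v' w')) := by
    refine tendsto_of_le_liminf_of_limsup_le
      (Func_le_liminf hK hp hΩm hD hρ hv hv' hwLp hw'Lp hvlim hwlim) ?_
    rw [← (tendsto_Func hK hp hΩm hD hv hv' hw'Lp hvlim).limsup_eq]
    exact limsup_le_limsup (.of_forall fun k => (hw k).2 w' hw')
  have hsub := ENNReal.Tendsto.sub hFunc hfid (.inr (fidelity_ne_top hK hp0.le D hv' hw'Lp))
  have hdiv := ENNReal.Tendsto.div_const hsub (b := ENNReal.ofReal α)
    (.inr (ENNReal.ofReal_pos.2 hα).ne')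
  have hPhi_eq : ∀ {v w : Space n → Mat m}, v ∈ LpSet Ω p K → w ∈ LpSet Ω p K →
      (Func Ω D s p l ρ α v w - fidelity Ω D p v w) / ENNReal.ofReal α = Phi Ω s p l ρ w := by
    intro v w hv hw
    rw [Func_eq hΩm hD hp0.le, ENNReal.add_sub_cancel_left (fidelity_ne_top hK hp0.le D hv hw),
      mul_comm, ENNReal.mul_div_cancel_right (ENNReal.ofReal_pos.2 hα).ne' ENNReal.ofReal_ne_top]
  simpa only [hPhi_eq, hv, hwLp, hv', hw'Lp] using hdiv

theorem exists_subseq_weakTendsto_of_isMinimizer (hK : IsLogConvexBody K) (hp : 1 < p)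
    (hs : 0 < s) (hΩo : IsOpen Ω) (hΩ : volume Ω ≠ ⊤) (hD : NullMeasurableSet D volume)
    (hρ : IsKernel ρ) (hα : 0 < α) {v w : ℕ → Space n → Mat m} (hv : ∀ k, v k ∈ LpSet Ω p K)
    (hw : ∀ k, IsMinimizer Ω D s p l ρ K α (v k) (w k)) :
    ∃ φ : ℕ → ℕ, StrictMono φ ∧ ∃ w', WeakTendsto Ω s p (fun j => w (φ j)) w' := by
  have : IsFiniteMeasure (volume.restrict Ω) := isFiniteMeasure_restrict.2 hΩ
  obtain ⟨B, hBtop, hB⟩ := exists_Phi_le_of_isMinimizer hK (zero_lt_one.trans hp)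
    hΩo.measurableSet hD hρ hα hv hw
  obtain ⟨φ, w', hφ, hw', hlim⟩ := exists_subseq_tendsto_WspSet hK hp.le hs hΩo hΩ hρ
    (fun k => (hw k).1) hBtop hB
  exact ⟨φ, hφ, w', weakTendsto_of_Phi_le hK hp hs.le hρ (fun k => (hw (φ k)).1) hw' hBtop
    (fun k => hB (φ k)) hlim⟩

theorem isMinimizer_and_tendsto_Phi_of_weakTendsto (hK : IsLogConvexBody K) (hp : 1 < p)
    (hs : 0 < s) (hΩo : IsOpen Ω) (hΩ : volume Ω ≠ ⊤) (hD : NullMeasurableSet D volume)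
    (hρ : IsKernel ρ) (hα : 0 < α) {v w : ℕ → Space n → Mat m} {v' w' : Space n → Mat m}
    (hv : ∀ k, v k ∈ LpSet Ω p K) (hv' : v' ∈ LpSet Ω p K)
    (hw : ∀ k, IsMinimizer Ω D s p l ρ K α (v k) (w k))
    (hvlim : Tendsto (fun k => lpPow p (volume.restrict Ω) (v k - v')) atTop (𝓝 0))
    (hweak : WeakTendsto Ω s p w w') :
    IsMinimizer Ω D s p l ρ K α v' w' ∧
      Tendsto (fun k => Phi Ω s p l ρ (w k)) atTop (𝓝 (Phi Ω s p l ρ w')) := by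
  have : IsFiniteMeasure (volume.restrict Ω) := isFiniteMeasure_restrict.2 hΩ
  obtain ⟨B, hBtop, hB⟩ := exists_Phi_le_of_isMinimizer hK (zero_lt_one.trans hp)
    hΩo.measurableSet hD hρ hα hv hw
  obtain ⟨hw', hwlim⟩ := hweak.mem_WspSet_and_tendsto_lpPow hK hp hs hΩo hΩ hρ
    (fun k => (hw k).1) hBtop hB
  exact ⟨isMinimizer_of_tendsto hK hp.le hΩo.measurableSet hD hρ.measurable hv hv' hw hw'
      hvlim hwlim,
    tendsto_Phi_of_isMinimizer hK hp.le hΩo.measurableSet hD hρ.measurable hα hv hv' hw hw'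
      hvlim hwlim⟩

end Functional

section Convergence

variable {n m : ℕ} {Ω D : Set (Space n)} {s p : ℝ} {l : ℕ} {ρ : Space n → ℝ} {K : Set (Mat m)}

theorem exists_Log_comp_ae_eq_midpoint [IsFiniteMeasure (volume.restrict Ω)]
    (hK : IsLogConvexBody K) (hp : 1 ≤ p) {v w : Space n → Mat m} (hv : v ∈ WspSet Ω s p K)
    (hw : w ∈ WspSet Ω s p K) :
    ∃ u ∈ WspSet Ω s p K,
      Log ∘ u =ᵐ[volume.restrict Ω] (2⁻¹ : ℝ) • (Log ∘ v + Log ∘ w) := by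
  have hp0 : 0 < p := zero_lt_one.trans_le hp
  have hv_meas := hK.aestronglyMeasurable_Log_comp hv.1.1.1 hv.2
  have hw_meas := hK.aestronglyMeasurable_Log_comp hw.1.1.1 hw.2
  obtain ⟨u, hu, huK, hLog⟩ := hK.exists_Log_comp_ae_eq ((hv_meas.add hw_meas).const_smul (2⁻¹ : ℝ))
    (by
      filter_upwards [hv.2, hw.2] with x hvx hwx
      simp only [Pi.smul_apply, Pi.add_apply, smul_add]
      exact hK.convex_image (Set.mem_image_of_mem _ hvx) (Set.mem_image_of_mem _ hwx)
        (by norm_num) (by norm_num) (by norm_num))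
  refine ⟨u, (mem_WspSet_iff hK hp0).2 ⟨hu, huK, ?_⟩, hLog⟩
  obtain ⟨c, hc, hgag⟩ := hK.exists_gagliardo_le_Log hp0.le Ω s
  obtain ⟨c', hc', hgag'⟩ := hK.exists_gagliardo_Log_le hp0.le Ω s
  have hLog_fin : ∀ {w : Space n → Mat m}, w ∈ WspSet Ω s p K → gagliardo Ω s p (Log ∘ w) ≠ ⊤ :=
    fun {w} hw => ne_top_of_le_ne_top
      (ENNReal.mul_ne_top hc' ((mem_WspSet_iff hK hp0).1 hw).2.2.ne) (hgag' w hw.2)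
  refine (hgag u huK).trans_lt (ENNReal.mul_lt_top hc.lt_top ?_)
  rw [gagliardo, lpPow_congr (fracDiff_ae_congr hLog), map_smul, map_add]
  exact (lpPow_midpoint_le hp (aestronglyMeasurable_fracDiff hv_meas) _).trans_lt
    (ENNReal.mul_lt_top (by simp)
      (ENNReal.add_lt_top.2 ⟨(hLog_fin hv).lt_top, (hLog_fin hw).lt_top⟩))

theorem IsKernel.exists_ae_sub_eq_const {κ : Space n → ℝ} (hκ : IsKernel κ) (hΩ : IsConnected Ω)
    (hΩo : IsOpen Ω) {V : Type*} [NormedAddCommGroup V] [NormedSpace ℝ V] {a : ℝ}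
    {f g : Space n → V} (h : fracDiff a f =ᵐ[kernelMeasure Ω κ] fracDiff a g) :
    ∃ c, ∀ᵐ x ∂volume.restrict Ω, f x - g x = c := by
  obtain ⟨τ, hτ, η, hη, hτκ⟩ := hκ.exists_pos_le
  refine exists_ae_eq_const_of_ae_eq_of_dist_le hΩ hΩo hη ?_
  filter_upwards [(ae_withDensity_iff (measurable_kernel_density hκ.measurable)).1 h] with q hq hqη
  rw [dist_eq_norm] at hqη
  have hfrac := hq (ENNReal.ofReal_pos.2 (hτ.trans_le (hτκ _ hqη))).ne'
  rcases eq_or_ne q.1 q.2 with hdiag | hoff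
  · rw [hdiag]
  · have hweight : (‖q.1 - q.2‖ ^ a)⁻¹ ≠ 0 :=
      inv_ne_zero (Real.rpow_pos_of_pos (norm_pos_iff.2 (sub_ne_zero.2 hoff)) _).ne'
    exact sub_eq_sub_iff_sub_eq_sub.2 (smul_right_injective V hweight hfrac)

/-- The midpoint of the logarithms is the logarithm of a competitor of the true solution. -/
theorem IsTrueSolution.fracDiff_Log_ae_eq [IsFiniteMeasure (volume.restrict Ω)]
    (hK : IsLogConvexBody K) (hp : 1 < p) (hρ : IsKernel ρ) {w0 w : Space n → Mat m}
    (h0 : IsTrueSolution Ω D s p l ρ K w0) (hw : w ∈ WspSet Ω s p K)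
    (hww0 : w =ᵐ[volume.restrict (Ω \ D)] w0) (hle : Phi Ω s p l ρ w ≤ Phi Ω s p l ρ w0) :
    fracDiff ((n : ℝ) / p + s) (Log ∘ w0) =ᵐ[kernelMeasure Ω (ρ ^ l)]
      fracDiff ((n : ℝ) / p + s) (Log ∘ w) := by
  have hp0 : 0 < p := zero_lt_one.trans hp
  have hac := kernelMeasure_absolutelyContinuous Ω (ρ ^ l)
  have hsub : ae (volume.restrict (Ω \ D)) ≤ ae (volume.restrict Ω) :=
    ae_mono (Measure.restrict_mono Set.sdiff_subset le_rfl)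
  have hmeas : ∀ {w : Space n → Mat m}, w ∈ WspSet Ω s p K →
      AEStronglyMeasurable (fracDiff ((n : ℝ) / p + s) (Log ∘ w)) (kernelMeasure Ω (ρ ^ l)) :=
    fun hw => (aestronglyMeasurable_fracDiff
      (hK.aestronglyMeasurable_Log_comp hw.1.1.1 hw.2)).mono_ac hac
  have hfin : ∀ {w : Space n → Mat m}, w ∈ WspSet Ω s p K →
      lpPow p (kernelMeasure Ω (ρ ^ l)) (fracDiff ((n : ℝ) / p + s) (Log ∘ w)) ≠ ⊤ :=
    fun {w} hw => Phi_eq_lpPow hp0 hρ.measurable w ▸ (Phi_lt_top hK hp0 hρ hw).ne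
  obtain ⟨u, hu, hLog⟩ := exists_Log_comp_ae_eq_midpoint hK hp.le h0.1 hw
  have huw0 : u =ᵐ[volume.restrict (Ω \ D)] w0 := by
    refine hK.ae_eq_of_Log_comp_ae_eq (hsub hu.2) (hsub h0.1.2) ?_
    filter_upwards [hsub hLog, hww0] with x hx hwx
    rw [hx, Pi.smul_apply, Pi.add_apply, Function.comp_apply, Function.comp_apply, hwx,
      ← two_smul ℝ, inv_smul_smul₀ two_ne_zero]
  have hmid := add_le_add (h0.2 u hu huw0) (hle.trans (h0.2 u hu huw0))
  rw [← two_mul] at hmid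
  simp only [Phi_eq_lpPow hp0 hρ.measurable] at hmid
  rw [lpPow_congr (hac.ae_le (fracDiff_ae_congr hLog)), map_smul, map_add] at hmid
  exact ae_eq_of_lpPow_add_lpPow_le_two_mul hp (hmeas h0.1) (hmeas hw) (hfin h0.1) (hfin hw) hmid

theorem IsTrueSolution.ae_eq_of_Phi_le [IsFiniteMeasure (volume.restrict Ω)]
    (hK : IsLogConvexBody K) (hp : 1 < p) (hΩc : IsConnected Ω) (hΩo : IsOpen Ω)
    (hΩD : volume (Ω \ D) ≠ 0) (hρ : IsKernel ρ) {w0 w : Space n → Mat m}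
    (h0 : IsTrueSolution Ω D s p l ρ K w0) (hw : w ∈ WspSet Ω s p K)
    (hww0 : w =ᵐ[volume.restrict (Ω \ D)] w0) (hle : Phi Ω s p l ρ w ≤ Phi Ω s p l ρ w0) :
    w =ᵐ[volume.restrict Ω] w0 := by
  obtain ⟨c, hc⟩ := (hρ.pow l).exists_ae_sub_eq_const hΩc hΩo
    (h0.fracDiff_Log_ae_eq hK hp hρ hw hww0 hle)
  have hc0 : c = 0 := by
    have : NeZero (volume.restrict (Ω \ D)) := ⟨Measure.restrict_eq_zero.not.2 hΩD⟩
    have hc' := ae_mono (Measure.restrict_mono (Set.sdiff_subset : Ω \ D ⊆ Ω) le_rfl) hc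
    obtain ⟨x, hcx, hx⟩ := (Eventually.and hc' hww0).exists
    simp only [← hcx, Function.comp_apply, hx, sub_self]
  exact hK.ae_eq_of_Log_comp_ae_eq hw.2 h0.1.2
    (hc.mono fun x hx => (sub_eq_zero.1 (hx.trans hc0)).symm)

theorem exists_Func_le_of_isMinimizer (hK : IsLogConvexBody K) (hp : 0 ≤ p)
    (hΩm : MeasurableSet Ω) (hD : NullMeasurableSet D volume) {w0 : Space n → Mat m}
    (hw0 : w0 ∈ WspSet Ω s p K) :
    ∃ c : ℝ≥0∞, c ≠ ⊤ ∧ ∀ (α : ℝ) (v w : Space n → Mat m), v ∈ LpSet Ω p K →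
      IsMinimizer Ω D s p l ρ K α v w → Func Ω D s p l ρ α v w ≤
        c * lpPow p (volume.restrict Ω) (v - w0) + ENNReal.ofReal α * Phi Ω s p l ρ w0 := by
  obtain ⟨c, hc, hLog⟩ := hK.exists_lpPow_Log_sub_le hp
  refine ⟨c, hc, fun α v w hv hw => (hw.2 w0 hw0).trans ?_⟩
  rw [Func_eq hΩm hD hp, lpPow_sub_comm v]
  exact add_le_add_left
    ((lpPow_mono_measure (Measure.restrict_mono Set.sdiff_subset le_rfl) _).trans
      (hLog hw0.2 hv.2)) _

theorem tendsto_lpPow_sub_div_ofReal {X V : Type*} [MeasurableSpace X] [NormedAddCommGroup V]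
    {μ : Measure X} (hp : 0 < p) {α δ : ℕ → ℝ} (hα : ∀ k, 0 < α k) (hδ : ∀ k, 0 ≤ δ k)
    (hδα : Tendsto (fun k => δ k ^ p / α k) atTop (𝓝 0)) {v : ℕ → X → V} {w0 : X → V}
    (hv : ∀ k, eLpNorm (w0 - v k) (ENNReal.ofReal p) μ ≤ ENNReal.ofReal (δ k)) :
    Tendsto (fun k => lpPow p μ (v k - w0) / ENNReal.ofReal (α k)) atTop (𝓝 0) := by
  have hlim := ENNReal.tendsto_ofReal hδα
  rw [ENNReal.ofReal_zero] at hlim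
  refine tendsto_of_tendsto_of_tendsto_of_le_of_le tendsto_const_nhds hlim (fun _ => zero_le)
    fun k => ?_
  rw [ENNReal.ofReal_div_of_pos (hα k), ← ENNReal.ofReal_rpow_of_nonneg (hδ k) hp.le,
    lpPow_sub_comm, ← eLpNorm_rpow_eq_lpPow hp]
  gcongr
  exact hv k

section VanishingNoise

variable {α : ℕ → ℝ} {v w : ℕ → Space n → Mat m} {w0 : Space n → Mat m}

theorem limsup_Phi_le_of_isMinimizer (hK : IsLogConvexBody K) (hp : 0 ≤ p)
    (hΩm : MeasurableSet Ω) (hD : NullMeasurableSet D volume) (hw0 : w0 ∈ WspSet Ω s p K)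
    (hα : ∀ k, 0 < α k) (hv : ∀ k, v k ∈ LpSet Ω p K)
    (hvα : Tendsto (fun k => lpPow p (volume.restrict Ω) (v k - w0) / ENNReal.ofReal (α k)) atTop
      (𝓝 0))
    (hw : ∀ k, IsMinimizer Ω D s p l ρ K (α k) (v k) (w k)) :
    limsup (fun k => Phi Ω s p l ρ (w k)) atTop ≤ Phi Ω s p l ρ w0 := by
  obtain ⟨c, hc, hFunc⟩ := exists_Func_le_of_isMinimizer (l := l) (ρ := ρ) hK hp hΩm hD hw0
  have hlim := (ENNReal.Tendsto.const_mul (a := c) hvα (.inr hc)).add_const (Phi Ω s p l ρ w0)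
  rw [mul_zero, zero_add] at hlim
  refine (limsup_le_limsup (.of_forall fun k => ?_)).trans_eq hlim.limsup_eq
  calc Phi Ω s p l ρ (w k)
      ≤ (c * lpPow p (volume.restrict Ω) (v k - w0) +
          ENNReal.ofReal (α k) * Phi Ω s p l ρ w0) / ENNReal.ofReal (α k) :=
        Phi_le_div (hα k) (hFunc _ _ _ (hv k) (hw k))
    _ = c * (lpPow p (volume.restrict Ω) (v k - w0) / ENNReal.ofReal (α k)) +
          Phi Ω s p l ρ w0 := by
        rw [ENNReal.add_div, mul_div_assoc, mul_comm (ENNReal.ofReal (α k)),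
          ENNReal.mul_div_cancel_right (ENNReal.ofReal_pos.2 (hα k)).ne' ENNReal.ofReal_ne_top]

theorem tendsto_fidelity_of_isMinimizer (hK : IsLogConvexBody K) (hp : 0 < p)
    (hΩm : MeasurableSet Ω) (hD : NullMeasurableSet D volume) (hρ : IsKernel ρ)
    (hw0 : w0 ∈ WspSet Ω s p K) (hαlim : Tendsto α atTop (𝓝 0)) (hv : ∀ k, v k ∈ LpSet Ω p K)
    (hvlim : Tendsto (fun k => lpPow p (volume.restrict Ω) (v k - w0)) atTop (𝓝 0))
    (hw : ∀ k, IsMinimizer Ω D s p l ρ K (α k) (v k) (w k)) :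
    Tendsto (fun k => fidelity Ω D p (v k) (w k)) atTop (𝓝 0) := by
  obtain ⟨c, hc, hFunc⟩ := exists_Func_le_of_isMinimizer (l := l) (ρ := ρ) hK hp.le hΩm hD hw0
  have hlim := (ENNReal.Tendsto.const_mul (a := c) hvlim (.inr hc)).add
    (ENNReal.Tendsto.mul_const (ENNReal.tendsto_ofReal hαlim)
      (.inr (Phi_lt_top (l := l) hK hp hρ hw0).ne))
  rw [mul_zero, ENNReal.ofReal_zero, zero_mul, add_zero] at hlim
  refine tendsto_of_tendsto_of_tendsto_of_le_of_le tendsto_const_nhds hlim (fun _ => zero_le)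
    fun k => le_trans ?_ (hFunc _ _ _ (hv k) (hw k))
  rw [Func_eq hΩm hD hp.le]
  exact le_self_add

theorem ae_eq_of_tendsto_of_limsup_Phi_le [IsFiniteMeasure (volume.restrict Ω)]
    (hK : IsLogConvexBody K) (hp : 1 < p) (hΩc : IsConnected Ω) (hΩo : IsOpen Ω)
    (hΩD : volume (Ω \ D) ≠ 0) (hρ : IsKernel ρ) (h0 : IsTrueSolution Ω D s p l ρ K w0)
    (hv : ∀ k, v k ∈ LpSet Ω p K)
    (hvlim : Tendsto (fun k => lpPow p (volume.restrict Ω) (v k - w0)) atTop (𝓝 0))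
    (hw : ∀ k, w k ∈ LpSet Ω p K)
    (hfid : Tendsto (fun k => fidelity Ω D p (v k) (w k)) atTop (𝓝 0))
    (hPhi : limsup (fun k => Phi Ω s p l ρ (w k)) atTop ≤ Phi Ω s p l ρ w0)
    {w' : Space n → Mat m} (hw' : w' ∈ WspSet Ω s p K)
    (hwlim : Tendsto (fun k => lpPow p (volume.restrict Ω) (w k - w')) atTop (𝓝 0)) :
    w' =ᵐ[volume.restrict Ω] w0 := by
  have hp0 : 0 < p := zero_lt_one.trans hp
  have hmono : volume.restrict (Ω \ D) ≤ volume.restrict Ω :=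
    Measure.restrict_mono Set.sdiff_subset le_rfl
  have hmeas : ∀ {u : Space n → Mat m}, u ∈ WspSet Ω s p K →
      AEStronglyMeasurable (Log ∘ u) (volume.restrict (Ω \ D)) :=
    fun hu => (hK.aestronglyMeasurable_Log_comp hu.1.1.1 hu.2).mono_measure hmono
  have hfid0 : fidelity Ω D p w0 w' = 0 := tendsto_nhds_unique
    (tendsto_fidelity hK hp.le D hv (WspSet_subset_LpSet h0.1) hw (WspSet_subset_LpSet hw') hvlim
      hwlim) hfid
  refine h0.ae_eq_of_Phi_le hK hp hΩc hΩo hΩD hρ hw' ?_ ?_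
  · exact hK.ae_eq_of_Log_comp_ae_eq (ae_mono hmono hw'.2) (ae_mono hmono h0.1.2)
      (ae_eq_of_lpPow_sub_eq_zero hp0 (hmeas hw') (hmeas h0.1) hfid0)
  · calc Phi Ω s p l ρ w' ≤ liminf (fun k => Phi Ω s p l ρ (w k)) atTop :=
        Phi_le_liminf hK hp0 hρ.measurable hw (WspSet_subset_LpSet hw') hwlim
      _ ≤ limsup (fun k => Phi Ω s p l ρ (w k)) atTop := liminf_le_limsup
      _ ≤ Phi Ω s p l ρ w0 := hPhi

theorem tendsto_lpPow_of_limsup_Phi_le (hK : IsLogConvexBody K) (hp : 1 < p) (hs : 0 < s)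
    (hΩc : IsConnected Ω) (hΩo : IsOpen Ω) (hΩ : volume Ω ≠ ⊤) (hΩD : volume (Ω \ D) ≠ 0)
    (hρ : IsKernel ρ) (h0 : IsTrueSolution Ω D s p l ρ K w0) (hv : ∀ k, v k ∈ LpSet Ω p K)
    (hvlim : Tendsto (fun k => lpPow p (volume.restrict Ω) (v k - w0)) atTop (𝓝 0))
    (hw : ∀ k, w k ∈ WspSet Ω s p K)
    (hfid : Tendsto (fun k => fidelity Ω D p (v k) (w k)) atTop (𝓝 0))
    {B : ℝ≥0∞} (hBtop : B ≠ ⊤) (hB : ∀ k, Phi Ω s p l ρ (w k) ≤ B)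
    (hPhi : limsup (fun k => Phi Ω s p l ρ (w k)) atTop ≤ Phi Ω s p l ρ w0) :
    Tendsto (fun k => lpPow p (volume.restrict Ω) (w k - w0)) atTop (𝓝 0) := by
  have : IsFiniteMeasure (volume.restrict Ω) := isFiniteMeasure_restrict.2 hΩ
  refine tendsto_of_subseq_tendsto fun φ hφ => ?_
  obtain ⟨ψ, w', hψ, hw', hlim⟩ := exists_subseq_tendsto_WspSet hK hp.le hs hΩo hΩ hρ
    (fun k => hw (φ k)) hBtop fun k => hB (φ k)
  have hφψ : Tendsto (fun k => φ (ψ k)) atTop atTop := hφ.comp hψ.tendsto_atTop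
  have hPhi' : limsup (fun k => Phi Ω s p l ρ (w (φ (ψ k)))) atTop ≤ Phi Ω s p l ρ w0 :=
    (hφψ.limsup_comp_le_limsup (u := fun k => Phi Ω s p l ρ (w k))).trans hPhi
  have hae : w' =ᵐ[volume.restrict Ω] w0 :=
    ae_eq_of_tendsto_of_limsup_Phi_le hK hp hΩc hΩo hΩD hρ h0 (fun k => hv (φ (ψ k)))
      (hvlim.comp hφψ) (fun k => WspSet_subset_LpSet (hw (φ (ψ k)))) (hfid.comp hφψ) hPhi' hw' hlim
  exact ⟨ψ, hlim.congr fun k => lpPow_congr (.sub .rfl hae)⟩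

theorem weakTendsto_and_tendsto_Phi_of_isTrueSolution (hK : IsLogConvexBody K) (hp : 1 < p)
    (hs : 0 < s) (hΩc : IsConnected Ω) (hΩo : IsOpen Ω) (hΩ : volume Ω ≠ ⊤)
    (hD : NullMeasurableSet D volume) (hΩD : volume (Ω \ D) ≠ 0) (hρ : IsKernel ρ)
    (h0 : IsTrueSolution Ω D s p l ρ K w0) (hα : ∀ k, 0 < α k) (hαlim : Tendsto α atTop (𝓝 0))
    (hv : ∀ k, v k ∈ LpSet Ω p K)
    (hvα : Tendsto (fun k => lpPow p (volume.restrict Ω) (v k - w0) / ENNReal.ofReal (α k)) atTop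
      (𝓝 0))
    (hw : ∀ k, IsMinimizer Ω D s p l ρ K (α k) (v k) (w k)) :
    WeakTendsto Ω s p w w0 ∧
      Tendsto (fun k => Phi Ω s p l ρ (w k)) atTop (𝓝 (Phi Ω s p l ρ w0)) := by
  have : IsFiniteMeasure (volume.restrict Ω) := isFiniteMeasure_restrict.2 hΩ
  have hp0 : 0 < p := zero_lt_one.trans hp
  have hvlim := tendsto_of_tendsto_div_ofReal hα hαlim hvα
  have hPhi := limsup_Phi_le_of_isMinimizer hK hp0.le hΩo.measurableSet hD h0.1 hα hv hvα hw
  have hfid := tendsto_fidelity_of_isMinimizer hK hp0 hΩo.measurableSet hD hρ h0.1 hαlim hv hvlim hw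
  obtain ⟨B, hBtop, hB⟩ := exists_forall_le_of_limsup_ne_top
    (fun k => (Phi_lt_top hK hp0 hρ (hw k).1).ne)
    (ne_top_of_le_ne_top (Phi_lt_top hK hp0 hρ h0.1).ne hPhi)
  have hlim := tendsto_lpPow_of_limsup_Phi_le hK hp hs hΩc hΩo hΩ hΩD hρ h0 hv hvlim
    (fun k => (hw k).1) hfid hBtop hB hPhi
  exact ⟨weakTendsto_of_Phi_le hK hp hs.le hρ (fun k => (hw k).1) h0.1 hBtop hB hlim,
    tendsto_of_le_liminf_of_limsup_le (Phi_le_liminf hK hp0 hρ.measurable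
      (fun k => WspSet_subset_LpSet (hw k).1) (WspSet_subset_LpSet h0.1) hlim) hPhi⟩

end VanishingNoise

end Convergence

end TensorReg

theorem mainTheorem2_general {n m : ℕ} {Ω D : Set (Space n)} (hΩc : IsConnected Ω)
    (hΩo : IsOpen Ω) (hΩ : volume Ω ≠ ⊤) (hD : NullMeasurableSet D volume) {s p : ℝ} (hs : 0 < s)
    (hp : 1 < p) (l : ℕ) {ρ : Space n → ℝ} (hρ : IsKernel ρ) {K : Set (Mat m)}
    (hK : IsLogConvexBody K) :
    (∀ v ∈ LpSet Ω p K, ∀ α : ℝ, 0 < α → ∀ w ∈ WspSet Ω s p K,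
      Func Ω D s p l ρ α v w < ⊤) ∧
    (∀ v ∈ LpSet Ω p K, ∀ α : ℝ, 0 < α →
      ∃ w, IsMinimizer Ω D s p l ρ K α v w) ∧
    (∀ α : ℝ, 0 < α → ∀ wδ ∈ LpSet Ω p K, ∀ v : ℕ → Space n → Mat m,
      (∀ k, v k ∈ LpSet Ω p K) →
      Tendsto (fun k => eLpNorm (wδ - v k) (ENNReal.ofReal p) (volume.restrict Ω)) atTop (𝓝 0) →
      ∀ w : ℕ → Space n → Mat m,
      (∀ k, IsMinimizer Ω D s p l ρ K α (v k) (w k)) →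
      (∃ φ : ℕ → ℕ, StrictMono φ ∧ ∃ w' : Space n → Mat m,
        WeakTendsto Ω s p (fun j => w (φ j)) w') ∧
      (∀ φ : ℕ → ℕ, StrictMono φ → ∀ w' : Space n → Mat m,
        WeakTendsto Ω s p (fun j => w (φ j)) w' →
        IsMinimizer Ω D s p l ρ K α wδ w' ∧
        Tendsto (fun j => Phi Ω s p l ρ (w (φ j))) atTop (𝓝 (Phi Ω s p l ρ w')))) ∧
    (volume (Ω \ D) ≠ 0 →
      ∀ w0 : Space n → Mat m, IsTrueSolution Ω D s p l ρ K w0 →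
      ∀ α : ℝ → ℝ, (∀ δ, 0 < δ → 0 < α δ) →
      Tendsto α (𝓝[>] 0) (𝓝 0) → Tendsto (fun δ => δ ^ p / α δ) (𝓝[>] 0) (𝓝 0) →
      ∀ δ : ℕ → ℝ, (∀ k, 0 < δ k) → Tendsto δ atTop (𝓝 0) →
      ∀ v : ℕ → Space n → Mat m, (∀ k, v k ∈ LpSet Ω p K) →
      (∀ k, eLpNorm (w0 - v k) (ENNReal.ofReal p) (volume.restrict Ω) ≤ ENNReal.ofReal (δ k)) →
      ∀ w : ℕ → Space n → Mat m,
      (∀ k, IsMinimizer Ω D s p l ρ K (α (δ k)) (v k) (w k)) →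
      (∃ φ : ℕ → ℕ, StrictMono φ ∧ WeakTendsto Ω s p (fun j => w (φ j)) w0 ∧
        Tendsto (fun j => Phi Ω s p l ρ (w (φ j))) atTop (𝓝 (Phi Ω s p l ρ w0))) ∧
      WeakTendsto Ω s p w w0 ∧
      Tendsto (fun k => Phi Ω s p l ρ (w k)) atTop (𝓝 (Phi Ω s p l ρ w0))) := by
  have : IsFiniteMeasure (volume.restrict Ω) := isFiniteMeasure_restrict.2 hΩ
  have hp0 : 0 < p := zero_lt_one.trans hp
  refine ⟨fun v hv α _ w hw => Func_lt_top hK hp0 hΩo.measurableSet hD hρ α hv hw,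
    fun v hv α hα => exists_isMinimizer hK hp.le hs hΩo hΩ hD hρ hα hv,
    fun α hα wδ hwδ v hv hvlim w hw =>
      ⟨exists_subseq_weakTendsto_of_isMinimizer hK hp hs hΩo hΩ hD hρ hα hv hw,
        fun φ hφ w' hweak => ?_⟩,
    fun hΩD w0 h0 α hα hαlim hδα δ hδ hδlim v hv hvδ w hw => ?_⟩
  · have hvlim' : Tendsto (fun k => lpPow p (volume.restrict Ω) (v k - wδ)) atTop (𝓝 0) := by
      simpa only [lpPow_sub_comm wδ] using tendsto_lpPow_of_tendsto_eLpNorm hp0 hvlim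
    exact isMinimizer_and_tendsto_Phi_of_weakTendsto hK hp hs hΩo hΩ hD hρ hα
      (fun k => hv (φ k)) hwδ (fun k => hw (φ k)) (hvlim'.comp hφ.tendsto_atTop) hweak
  · have hδ_right : Tendsto δ atTop (𝓝[>] 0) :=
      tendsto_nhdsWithin_iff.2 ⟨hδlim, .of_forall hδ⟩
    have hlim := weakTendsto_and_tendsto_Phi_of_isTrueSolution hK hp hs hΩc hΩo hΩ hD hΩD hρ h0
      (fun k => hα _ (hδ k)) (hαlim.comp hδ_right) hv
      (tendsto_lpPow_sub_div_ofReal hp0 (fun k => hα _ (hδ k)) (fun k => (hδ k).le)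
        (hδα.comp hδ_right) hvδ) hw
    exact ⟨⟨id, strictMono_id, hlim⟩, hlim⟩

theorem mainTheorem2 (n m : ℕ) (Ω D : Set (Space n))
    (hΩne : Ω.Nonempty) (hΩb : Bornology.IsBounded Ω) (hΩc : IsConnected Ω) (hΩo : IsOpen Ω)
    (hΩL : HasLipschitzBoundary Ω) (hDΩ : D ⊆ Ω) (hD : NullMeasurableSet D volume)
    (s p : ℝ) (hs0 : 0 < s) (hs1 : s < 1) (hp : 1 < p) (l : ℕ) (hl : l = 0 ∨ l = 1)
    (ρ : Space n → ℝ) (hρ : IsMollifier ρ) (z : ℝ) (hz : 0 ≤ z) :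
    -- the functional is finite on `W^{s,p}(Ω; K)`
    (∀ v ∈ LpSet Ω p (SPDLog m z), ∀ α : ℝ, 0 < α → ∀ w ∈ WspSet Ω s p (SPDLog m z),
      Func Ω D s p l ρ α v w < ⊤) ∧
    -- existence
    (∀ v ∈ LpSet Ω p (SPDLog m z), ∀ α : ℝ, 0 < α →
      ∃ w, IsMinimizer Ω D s p l ρ (SPDLog m z) α v w) ∧
    -- stability
    (∀ α : ℝ, 0 < α → ∀ wδ ∈ LpSet Ω p (SPDLog m z), ∀ v : ℕ → Space n → Mat m,
      (∀ k, v k ∈ LpSet Ω p (SPDLog m z)) →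
      Tendsto (fun k => eLpNorm (wδ - v k) (ENNReal.ofReal p) (volume.restrict Ω)) atTop (𝓝 0) →
      ∀ w : ℕ → Space n → Mat m,
      (∀ k, IsMinimizer Ω D s p l ρ (SPDLog m z) α (v k) (w k)) →
      (∃ φ : ℕ → ℕ, StrictMono φ ∧ ∃ w' : Space n → Mat m,
        WeakTendsto Ω s p (fun j => w (φ j)) w') ∧
      (∀ φ : ℕ → ℕ, StrictMono φ → ∀ w' : Space n → Mat m,
        WeakTendsto Ω s p (fun j => w (φ j)) w' →
        IsMinimizer Ω D s p l ρ (SPDLog m z) α wδ w' ∧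
        Tendsto (fun j => Phi Ω s p l ρ (w (φ j))) atTop (𝓝 (Phi Ω s p l ρ w')))) ∧
    -- convergence
    (volume (Ω \ D) ≠ 0 →
      ∀ w0 : Space n → Mat m, IsTrueSolution Ω D s p l ρ (SPDLog m z) w0 →
      ∀ α : ℝ → ℝ, (∀ δ, 0 < δ → 0 < α δ) →
      Tendsto α (𝓝[>] 0) (𝓝 0) → Tendsto (fun δ => δ ^ p / α δ) (𝓝[>] 0) (𝓝 0) →
      ∀ δ : ℕ → ℝ, (∀ k, 0 < δ k) → Tendsto δ atTop (𝓝 0) →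
      ∀ v : ℕ → Space n → Mat m, (∀ k, v k ∈ LpSet Ω p (SPDLog m z)) →
      (∀ k, eLpNorm (w0 - v k) (ENNReal.ofReal p) (volume.restrict Ω) ≤ ENNReal.ofReal (δ k)) →
      ∀ w : ℕ → Space n → Mat m,
      (∀ k, IsMinimizer Ω D s p l ρ (SPDLog m z) (α (δ k)) (v k) (w k)) →
      (∃ φ : ℕ → ℕ, StrictMono φ ∧ WeakTendsto Ω s p (fun j => w (φ j)) w0 ∧
        Tendsto (fun j => Phi Ω s p l ρ (w (φ j))) atTop (𝓝 (Phi Ω s p l ρ w0))) ∧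
      WeakTendsto Ω s p w w0 ∧
      Tendsto (fun k => Phi Ω s p l ρ (w k)) atTop (𝓝 (Phi Ω s p l ρ w0))) := by
  exact mainTheorem2_general hΩc hΩo hΩb.measure_lt_top.ne hD hs0 hp l hρ.isKernel
    (isLogConvexBody_SPDLog m hz)
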